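/- **Volterra extension theorem.** Let $\alpha,\gamma\in(0,1)$ with $\rho:=\alpha-\gamma>0$, put $n=\lfloor 1/\rho\rfloor$, let $T>0$, and let $E$ be a real Banach space. Let $E^{\otimes m}$ be the completed projective tensor power ($E^{\otimes 0}=\mathbb R$), and let $\Delta=\{(s,t,\tau):0\le s\le t\le\tau\le T\}$. For $z:\Delta\to E^{\otimes m}$, $(s,t,\tau)\mapsto z^{\tau}_{ts}$, and $a\ge\gamma$ set $$w_a(s,t,\tau)=|\tau-t|^{-\gamma}|t-s|^{a}\wedge|\tau-s|^{a-\gamma},$$ $$\|z\|_{(a,\gamma),1}=\sup_{0\le s<t<\tau\le T}\frac{|z^\tau_{ts}|}{w_a(s,t,\tau)},\qquad \|z\|_{(a,\gamma),1,2}=\sup_{\substack{0\le s<t<\tau'<\tau\le T\\ \eta\in[0,1]}}\frac{|z^\tau_{ts}-z^{\tau'}_{ts}|}{|\tau-\tau'|^{\eta}|\tau'-t|^{-\eta}\,w_a(s,t,\tau')},$$ and $\|z\|_{(a,\gamma)}=\|z\|_{(a,\gamma),1}+\|z\|_{(a,\gamma),1,2}$. For a family $(\mathbf z^{m})_m$ of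 such functions with $\mathbf z^0\equiv1$ and a function $y$ of the upper variable, the convolution product is defined recursively by $\mathbf z^{0}\ast y=y^{\tau}$ and, for $p\ge1$, $$\mathbf z^{p,\tau}_{tu}\ast y=\lim_{|\mathcal P|\to0}\sum_{[a,b]\in\mathcal P}\Big(\mathbf z^{p,\tau}_{ba}\otimes y^{a}+\sum_{j=1}^{p-1}\mathbf z^{p-j,\tau}_{ba}\ast\big(\mathbf z^{j,\cdot}_{au}\ast y\big)\Big),$$ the limit being over the partitions $\mathcal P$ of $[u,t]$ whose mesh tends to $0$; moreover $\mathbf z^p\ast1=\mathbf z^p$. For $N\in\mathbb N\cup\{\infty\}$, a *Volterra convolutional functional of degree $N$* is a family of continuous maps $\mathbf z^m:\Delta\to E^{\otimes m}$, $m\le N$, with $\mathbf z^0\equiv1$, such that for all $m\le N$ and $0\le s\le u\le t\le\tau\le T$ $$\mathbf z^{m,\tau}_{ts}=\sum_{i=0}^{m}\mathbf z^{m-i,\tau}_{tu}\ast\mathbf z^{i,\cdot}_{us}.\tag{1}$$ Let $\mathbf z=(1,\mathbf z^1,\dots,\mathbf z^n)$ be a Volterra rough path, that is, a Volterra convolutional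 functional of degree $n$ for which there are constants $C,M>0$ with $\|\mathbf z^1\|_{(\alpha,\gamma)}\le M$ and $$\|\mathbf z^{j}\|_{(j\rho+\gamma,\gamma),1}\le \frac{C\,M^j}{\Gamma(j\rho+1)},\qquad \|\mathbf z^{j}\|_{(j\rho+\gamma,\gamma),1,2}\le \frac{C\,M^j}{\Gamma(j\rho+1)},\qquad 1\le j\le n.$$ Then $\mathbf z$ extends to a Volterra convolutional functional $(1,\mathbf z^1,\mathbf z^2,\dots)$ of degree $\infty$ with $\|\mathbf z^m\|_{(m\rho+\gamma,\gamma)}<\infty$ for all $m\ge1$. In particular (1) holds for every $m\ge n+1$, and all the limits that define the convolution products $\mathbf z^{p,\tau}_{tu}\ast\mathbf z^{i,\cdot}_{us}$ of the extension exist. The extension is unique: for every $N\in\mathbb N\cup\{\infty\}$, any Volterra convolutional functional of degree $N$ that agrees with $\mathbf z$ on the levels up to $n$ and whose $m$-th component has finite $\|\cdot\|_{(m\rho+\gamma,\gamma)}$ norm for $1\le m\le N$ coincides with it on the levels up to $N$. Moreover, there is a constant $K>0$ depending only on $\alpha,\gamma,C$ such that for all $m\ge n+1$ $$\|\mathbf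 z^{m}\|_{(m\rho+\gamma,\gamma),1}\le \frac{K^m M^m}{\Gamma(m\rho+1)},\qquad \|\mathbf z^{m}\|_{(m\rho+\gamma,\gamma),1,2}\le \frac{K^m M^m}{\Gamma(m\rho+1)}.$$ -/

import Mathlib

open scoped ENNReal

/-! ### The tensor powers of a Banach space

`E^{⊗m}` is the completed projective tensor power. All the powers are realised inside one Banach
algebra, the completion of the tensor algebra for the projective norm, so that the tensor product
`E^{⊗p} × E^{⊗q} → E^{⊗(p+q)}` is the multiplication of that algebra. -/

namespace ProjectiveTensor

variable {E : Type*} [NormedAddCommGroup E] [NormedSpace ℝ E]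

/-- The element `∑ c • (v₁ ⊗ ⋯ ⊗ v_k)` of the tensor algebra written by a finite list of terms
`(c, [v₁, …, v_k])`. -/
noncomputable def value (L : List (ℝ × List E)) : TensorAlgebra ℝ E :=
  (L.map fun w => w.1 • (w.2.map (TensorAlgebra.ι ℝ)).prod).sum

/-- The cost `∑ |c| ‖v₁‖ ⋯ ‖v_k‖` of such a list. -/
noncomputable def cost (L : List (ℝ × List E)) : ℝ :=
  (L.map fun w => |w.1| * (w.2.map fun v => ‖v‖).prod).sum

/-- The projective norm: the infimum of the costs of all the ways to write `x`. -/
noncomputable def projNorm (x : TensorAlgebra ℝ E) : ℝ :=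
  sInf {c | ∃ L : List (ℝ × List E), value L = x ∧ cost L = c}

lemma word_nonneg (l : List E) : 0 ≤ (l.map fun v => ‖v‖).prod :=
  List.prod_nonneg (by simp)

lemma cost_nonneg (L : List (ℝ × List E)) : 0 ≤ cost L := by
  refine List.sum_nonneg ?_
  simp only [List.mem_map, forall_exists_index, and_imp, forall_apply_eq_imp_iff₂]
  exact fun w _ => mul_nonneg (abs_nonneg _) (word_nonneg _)

lemma value_append (L L' : List (ℝ × List E)) : value (L ++ L') = value L + value L' := by
  simp [value]

lemma cost_append (L L' : List (ℝ × List E)) : cost (L ++ L') = cost L + cost L' := by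
  simp [cost]

lemma exists_smul (a : ℝ) (L : List (ℝ × List E)) :
    ∃ L', value L' = a • value L ∧ cost L' = |a| * cost L := by
  induction L with
  | nil => exact ⟨[], by simp [value, cost]⟩
  | cons w L ih =>
    obtain ⟨L', h1, h2⟩ := ih
    refine ⟨(a * w.1, w.2) :: L', ?_, ?_⟩
    · simp only [value, List.map_cons, List.sum_cons, smul_add] at h1 ⊢
      rw [h1, mul_smul]
    · simp only [cost, List.map_cons, List.sum_cons] at h2 ⊢
      rw [h2, abs_mul]; ring

lemma exists_word_mul (w : ℝ × List E) (L : List (ℝ × List E)) :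
    ∃ L', value L' = (w.1 • (w.2.map (TensorAlgebra.ι ℝ)).prod) * value L ∧
      cost L' = (|w.1| * (w.2.map fun v => ‖v‖).prod) * cost L := by
  induction L with
  | nil => exact ⟨[], by simp [value, cost]⟩
  | cons v L ih =>
    obtain ⟨L', h1, h2⟩ := ih
    refine ⟨(w.1 * v.1, w.2 ++ v.2) :: L', ?_, ?_⟩
    · simp only [value, List.map_cons, List.sum_cons, mul_add] at h1 ⊢
      rw [h1, List.map_append, List.prod_append, smul_mul_smul_comm]
    · simp only [cost, List.map_cons, List.sum_cons] at h2 ⊢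
      rw [h2, abs_mul, List.map_append, List.prod_append]; ring

lemma exists_mul (L₁ L₂ : List (ℝ × List E)) :
    ∃ L', value L' = value L₁ * value L₂ ∧ cost L' = cost L₁ * cost L₂ := by
  induction L₁ with
  | nil => exact ⟨[], by simp [value, cost]⟩
  | cons w L ih =>
    obtain ⟨L', h1, h2⟩ := ih
    obtain ⟨L'', h3, h4⟩ := exists_word_mul w L₂
    refine ⟨L'' ++ L', ?_, ?_⟩
    · rw [value_append, h1, h3]
      simp only [value, List.map_cons, List.sum_cons, add_mul]
    · rw [cost_append, h2, h4]
      simp only [cost, List.map_cons, List.sum_cons, add_mul]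

lemma exists_value (x : TensorAlgebra ℝ E) : ∃ L, value L = x := by
  induction x using TensorAlgebra.induction with
  | algebraMap r => exact ⟨[(r, [])], by simp [value, Algebra.algebraMap_eq_smul_one]⟩
  | ι v => exact ⟨[(1, [v])], by simp [value]⟩
  | mul a b ha hb =>
    obtain ⟨L, rfl⟩ := ha
    obtain ⟨L', rfl⟩ := hb
    obtain ⟨L'', h, -⟩ := exists_mul L L'
    exact ⟨L'', h⟩
  | add a b ha hb =>
    obtain ⟨L, rfl⟩ := ha
    obtain ⟨L', rfl⟩ := hb
    exact ⟨L ++ L', value_append L L'⟩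

lemma projNorm_le (L : List (ℝ × List E)) : projNorm (value L) ≤ cost L :=
  csInf_le ⟨0, by rintro _ ⟨L, -, rfl⟩; exact cost_nonneg L⟩ ⟨L, rfl, rfl⟩

lemma projNorm_nonneg (x : TensorAlgebra ℝ E) : 0 ≤ projNorm x :=
  Real.sInf_nonneg (by rintro _ ⟨L, -, rfl⟩; exact cost_nonneg L)

lemma exists_lt (x : TensorAlgebra ℝ E) {ε : ℝ} (hε : 0 < ε) :
    ∃ L, value L = x ∧ cost L < projNorm x + ε := by
  obtain ⟨L, hL⟩ := exists_value x
  obtain ⟨_, ⟨L', h, rfl⟩, hlt⟩ := exists_lt_of_csInf_lt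
    (s := {c | ∃ L : List (ℝ × List E), value L = x ∧ cost L = c}) ⟨_, L, hL, rfl⟩
    (lt_add_of_pos_right _ hε)
  exact ⟨L', h, hlt⟩

lemma projNorm_smul_le (a : ℝ) (x : TensorAlgebra ℝ E) :
    projNorm (a • x) ≤ |a| * projNorm x := by
  refine le_of_forall_pos_le_add fun ε hε => ?_
  have hpos : 0 < |a| + 1 := by positivity
  obtain ⟨L, rfl, hL⟩ := exists_lt x (div_pos hε hpos)
  obtain ⟨L', h1, h2⟩ := exists_smul a L
  rw [← h1]
  refine (projNorm_le L').trans ?_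
  rw [h2]
  have h3 : |a| * (ε / (|a| + 1)) ≤ ε := by
    rw [mul_div_assoc', div_le_iff₀ hpos]; nlinarith [abs_nonneg a]
  nlinarith [mul_le_mul_of_nonneg_left hL.le (abs_nonneg a)]

lemma projNorm_add_le (x y : TensorAlgebra ℝ E) :
    projNorm (x + y) ≤ projNorm x + projNorm y := by
  refine le_of_forall_pos_le_add fun ε hε => ?_
  obtain ⟨L, rfl, hL⟩ := exists_lt x (half_pos hε)
  obtain ⟨L', rfl, hL'⟩ := exists_lt y (half_pos hε)
  have h := projNorm_le (L ++ L')
  rw [value_append, cost_append] at h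
  linarith

lemma projNorm_mul_le (x y : TensorAlgebra ℝ E) :
    projNorm (x * y) ≤ projNorm x * projNorm y := by
  have key : ∀ ε : ℝ, 0 < ε → projNorm (x * y) ≤ (projNorm x + ε) * (projNorm y + ε) := by
    intro ε hε
    obtain ⟨L, rfl, hL⟩ := exists_lt x hε
    obtain ⟨L', rfl, hL'⟩ := exists_lt y hε
    obtain ⟨L'', h1, h2⟩ := exists_mul L L'
    rw [← h1]
    refine (projNorm_le L'').trans ?_
    rw [h2]
    exact mul_le_mul hL.le hL'.le (cost_nonneg _)
      (add_nonneg (projNorm_nonneg _) hε.le)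
  have hc : Filter.Tendsto (fun ε : ℝ => (projNorm x + ε) * (projNorm y + ε))
      (nhdsWithin 0 (Set.Ioi 0)) (nhds ((projNorm x + 0) * (projNorm y + 0))) :=
    (Continuous.tendsto (by fun_prop) 0).mono_left nhdsWithin_le_nhds
  simp only [add_zero] at hc
  exact ge_of_tendsto hc (Filter.eventually_of_mem self_mem_nhdsWithin key)

lemma projNorm_zero : projNorm (0 : TensorAlgebra ℝ E) = 0 :=
  le_antisymm (by simpa [value, cost] using projNorm_le ([] : List (ℝ × List E)))
    (projNorm_nonneg _)

/-- The projective norm as a submultiplicative seminorm. -/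
noncomputable def projSeminorm (E : Type*) [NormedAddCommGroup E] [NormedSpace ℝ E] :
    RingSeminorm (TensorAlgebra ℝ E) where
  toFun := projNorm
  map_zero' := projNorm_zero
  add_le' := projNorm_add_le
  neg' x := by
    have h : ∀ y : TensorAlgebra ℝ E, projNorm (-y) ≤ projNorm y := fun y => by
      simpa using projNorm_smul_le (-1) y
    exact le_antisymm (h x) (by simpa using h (-x))
  mul_le' := projNorm_mul_le

end ProjectiveTensor

noncomputable instance TensorAlgebra.projSeminormedRing
    (E : Type*) [NormedAddCommGroup E] [NormedSpace ℝ E] : SeminormedRing (TensorAlgebra ℝ E) :=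
  (ProjectiveTensor.projSeminorm E).toSeminormedRing

noncomputable instance TensorAlgebra.projNormedSpace
    (E : Type*) [NormedAddCommGroup E] [NormedSpace ℝ E] : NormedSpace ℝ (TensorAlgebra ℝ E) where
  norm_smul_le a x := ProjectiveTensor.projNorm_smul_le a x

/-- The Banach algebra generated by `E`: the tensor algebra completed for the projective norm. -/
abbrev BanachTensor (E : Type*) [NormedAddCommGroup E] [NormedSpace ℝ E] : Type _ :=
  UniformSpace.Completion (TensorAlgebra ℝ E)

/-- `E^{⊗m}`, the closed span of the products `v₁ ⊗ ⋯ ⊗ v_m`. -/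
noncomputable def tensorPow (E : Type*) [NormedAddCommGroup E] [NormedSpace ℝ E] (m : ℕ) :
    Submodule ℝ (BanachTensor E) :=
  (((LinearMap.range (TensorAlgebra.ι ℝ : E →ₗ[ℝ] TensorAlgebra ℝ E)) ^ m).map
    (UniformSpace.Completion.toComplL (𝕜 := ℝ) (E := TensorAlgebra ℝ E)).toLinearMap).topologicalClosure

/-! ### Volterra–Hölder seminorms

A function `z` of `(s, t, τ)` is written `z s t τ` for `z_{ts}^τ`. -/

namespace Volterra

/-- `|τ-t|^{-γ} |t-s|^α ∧ |τ-s|^{α-γ}`; only used for `s < t < τ`. -/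
noncomputable def weight (α γ s t τ : ℝ) : ℝ :=
  min ((τ - t) ^ (-γ) * (t - s) ^ α) ((τ - s) ^ (α - γ))

section Norms

variable {A : Type*} [NormedRing A]

/-- The seminorm `‖z‖_{(α,γ),1}` on `[0,T]`. -/
noncomputable def norm1 (T α γ : ℝ) (z : ℝ → ℝ → ℝ → A) : ℝ≥0∞ :=
  ⨆ (s : ℝ) (t : ℝ) (τ : ℝ) (_ : 0 ≤ s ∧ s < t ∧ t < τ ∧ τ ≤ T),
    ‖z s t τ‖ₑ / ENNReal.ofReal (weight α γ s t τ)

/-- The seminorm `‖z‖_{(α,γ),1,2}` on `[0,T]`; here `τ' < τ` is written `q < τ`. -/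
noncomputable def norm12 (T α γ : ℝ) (z : ℝ → ℝ → ℝ → A) : ℝ≥0∞ :=
  ⨆ (s : ℝ) (t : ℝ) (q : ℝ) (τ : ℝ) (η : ℝ)
    (_ : 0 ≤ s ∧ s < t ∧ t < q ∧ q < τ ∧ τ ≤ T ∧ 0 ≤ η ∧ η ≤ 1),
    ‖z s t τ - z s t q‖ₑ /
      ENNReal.ofReal ((τ - q) ^ η * (q - t) ^ (-η) * weight α γ s t q)

/-- `‖z‖_{(α,γ)} = ‖z‖_{(α,γ),1} + ‖z‖_{(α,γ),1,2}`. -/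
noncomputable def fullNorm (T α γ : ℝ) (z : ℝ → ℝ → ℝ → A) : ℝ≥0∞ :=
  norm1 T α γ z + norm12 T α γ z

end Norms

/-! ### The convolution product -/

/-- `a = x₀ < x₁ < ⋯ < x_N = b`. -/
structure IsPartition (a b : ℝ) (N : ℕ) (x : ℕ → ℝ) : Prop where
  left : x 0 = a
  right : x N = b
  lt : ∀ k < N, x k < x (k + 1)

section Convolution

variable {A : Type*} [NormedRing A]

/-- `L` is the limit of `∑_{[u,v] ∈ P} F u v` over the partitions `P` of `[a,b]` as the mesh of
`P` goes to `0`. -/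
def IsMeshLimit (a b : ℝ) (F : ℝ → ℝ → A) (L : A) : Prop :=
  ∀ ε > 0, ∃ δ > 0, ∀ (N : ℕ) (x : ℕ → ℝ), IsPartition a b N x →
    (∀ k < N, x (k + 1) - x k < δ) →
      ‖∑ k ∈ Finset.range N, F (x k) (x (k + 1)) - L‖ < ε

open Classical in
/-- The mesh limit where it exists, and `0` otherwise. -/
noncomputable def meshLimit (a b : ℝ) (F : ℝ → ℝ → A) : A :=
  if h : ∃ L, IsMeshLimit a b F L then h.choose else 0

/-- The convolution product: `conv z p y u t τ` is `z^{p,τ}_{tu} ∗ y^·` for a function `y` of the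
upper variable. For `p = 0` it is `1 ∗ y = y^τ`. For `p ≥ 1` it is the limit over the partitions
of `[u,t]` of
`∑_{[a,b]} ( z^{p,τ}_{ba} ⊗ y^a + ∑_{0<j<p} z^{p-j,τ}_{ba} ∗ (z^{j,·}_{au} ∗ y) )`,
where the inner sum is `(δ_a z^{p,τ}_{bu}) ∗ y`. -/
noncomputable def conv (z : ℕ → ℝ → ℝ → ℝ → A) : ℕ → (ℝ → A) → ℝ → ℝ → ℝ → A
  | 0, y, _, _, τ => y τ
  | p + 1, y, u, t, τ => meshLimit u t fun a b =>
      z (p + 1) a b τ * y a +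
        ∑ j : Fin p, conv z (p - j) (fun r => conv z (j + 1) y u a r) a b τ
  termination_by p => p
  decreasing_by all_goals (have := j.2; omega)

/-- All the limits in the recursive definition of `z^{p,τ}_{tu} ∗ y` exist. -/
def ConvExists (z : ℕ → ℝ → ℝ → ℝ → A) : ℕ → (ℝ → A) → ℝ → ℝ → ℝ → Prop
  | 0, _, _, _, _ => True
  | p + 1, y, u, t, τ =>
      (∃ L, IsMeshLimit u t (fun a b =>
        z (p + 1) a b τ * y a +
          ∑ j : Fin p, conv z (p - j) (fun r => conv z (j + 1) y u a r) a b τ) L) ∧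
      ∀ a b, u ≤ a → a ≤ b → b ≤ t → ∀ j : Fin p,
        (∀ r, a ≤ r → r ≤ b → ConvExists z (j + 1) y u a r) ∧
        ConvExists z (p - j) (fun r => conv z (j + 1) y u a r) a b τ
  termination_by p => p
  decreasing_by all_goals (have := j.2; omega)

/-- The term `z^{m-i,τ}_{tu} ∗ z^{i,·}_{us}` of the Chen relation, with the convention
`z^m ∗ 1 = z^m` for `i = 0`; for `i = m` it is `1 ∗ z^m = z^m` by the definition of `conv`. -/
noncomputable def chenTerm (z : ℕ → ℝ → ℝ → ℝ → A) (m i : ℕ) (s u t τ : ℝ) : A :=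
  if i = 0 then z m u t τ else conv z (m - i) (fun r => z i s u r) u t τ

end Convolution

/-! ### Volterra rough paths -/

/-- The simplex `0 ≤ s ≤ t ≤ τ ≤ T`, closed because the convolution product evaluates its factors
on the diagonals. -/
def simplex (T : ℝ) : Set (ℝ × ℝ × ℝ) :=
  {x | 0 ≤ x.1 ∧ x.1 ≤ x.2.1 ∧ x.2.1 ≤ x.2.2 ∧ x.2.2 ≤ T}

section RoughPaths

variable {E : Type*} [NormedAddCommGroup E] [NormedSpace ℝ E]

/-- A Volterra convolutional functional `(1, z¹, …, z^N)` of degree `N`, where `N = ⊤` stands for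
values in the full tensor space. Levels above `N` are ignored. -/
structure IsConvolutionalFunctional (T : ℝ) (N : ℕ∞)
    (z : ℕ → ℝ → ℝ → ℝ → BanachTensor E) : Prop where
  level_zero : ∀ s t τ, (s, t, τ) ∈ simplex T → z 0 s t τ = 1
  mem_tensorPow : ∀ m : ℕ, (m : ℕ∞) ≤ N →
    ∀ s t τ, (s, t, τ) ∈ simplex T → z m s t τ ∈ tensorPow E m
  continuousOn : ∀ m : ℕ, (m : ℕ∞) ≤ N →
    ContinuousOn (fun x : ℝ × ℝ × ℝ => z m x.1 x.2.1 x.2.2) (simplex T)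
  chen : ∀ m : ℕ, (m : ℕ∞) ≤ N → ∀ s u t τ, 0 ≤ s → s ≤ u → u ≤ t → t ≤ τ → τ ≤ T →
    z m s t τ = ∑ i ∈ Finset.range (m + 1), chenTerm z m i s u t τ

/-- A Volterra rough path of regularity `(α,γ)`, with `ρ = α - γ`: a convolutional functional of
degree `⌊1/ρ⌋` whose `j`-th component has `(jρ+γ,γ)` seminorms at most `C M^j / Γ(jρ+1)`. -/
structure IsRoughPath (α γ T C M : ℝ) (z : ℕ → ℝ → ℝ → ℝ → BanachTensor E) : Prop where
  functional : IsConvolutionalFunctional T (⌊1 / (α - γ)⌋₊ : ℕ) z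
  norm_one_le : fullNorm T α γ (z 1) ≤ ENNReal.ofReal M
  norm1_le : ∀ j : ℕ, 1 ≤ j → j ≤ ⌊1 / (α - γ)⌋₊ →
    norm1 T (j * (α - γ) + γ) γ (z j) ≤
      ENNReal.ofReal (C * (M ^ j / Real.Gamma (j * (α - γ) + 1)))
  norm12_le : ∀ j : ℕ, 1 ≤ j → j ≤ ⌊1 / (α - γ)⌋₊ →
    norm12 T (j * (α - γ) + γ) γ (z j) ≤
      ENNReal.ofReal (C * (M ^ j / Real.Gamma (j * (α - γ) + 1)))

/-- `Z` extends the Volterra rough path `z` to the tensor levels up to `N`: it is a convolutional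
functional of degree `N`, it agrees with `z` up to level `⌊1/ρ⌋`, and its `m`-th component has a
finite `(mρ+γ,γ)` norm. -/
structure IsExtension (α γ T : ℝ) (N : ℕ∞) (z Z : ℕ → ℝ → ℝ → ℝ → BanachTensor E) : Prop where
  functional : IsConvolutionalFunctional T N Z
  agrees : ∀ j : ℕ, j ≤ ⌊1 / (α - γ)⌋₊ →
    ∀ s t τ, (s, t, τ) ∈ simplex T → Z j s t τ = z j s t τ
  norm_lt_top : ∀ m : ℕ, 1 ≤ m → (m : ℕ∞) ≤ N → fullNorm T (m * (α - γ) + γ) γ (Z m) < ⊤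

end RoughPaths

end Volterra

/-! The seminorm with the free exponent `η` says that, as a function of the upper variable,
`z^p_{ts}` oscillates over `[q,τ]` by at most a constant times `(τ-q)/(τ-t)`: it is bounded, and
Lipschitz away from the singular point `t`. `Controlled` records this property, and `le_weight` and
`weight_le` replace the Volterra weight by the equivalent `(t-s)^{pρ} ((t-s)/(τ-s))^γ`.

This regularity makes `z^p ∗ y` well defined for every `p ≥ 1`, even if `pρ < 1`. By `germ_defect`,
the defect of its germ at a point `d` of `[a,b]` involves `y` only through `y - y(a)` on `[a,d]`,
which has size `(d-a)/(d-u)`. The defect is therefore of order `(b-a)^{pρ} (b-a)/(b-u)`: the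
exponent exceeds `1`, at the price of a singularity at `u` that is only logarithmic after summation.
`exists_isMeshLimit_of_defect_le` sews such germs. The algebraic input is that moving the base point
changes the germ by an exact increment (`sum_conv_change_base`), so that `z^p ∗ y` satisfies Chen's
relation itself (`chen_of_isMeshLimit`). Existence, linearity, control, Chen's relation and bounds
form one strong induction, `convRegular_and_convBounds`.

For `m > n` one has `mρ > 1`. In Chen's relation the terms `z^m_{ba}`, of order `(b-a)^{mρ}`, sum to
zero in the limit, so `z^m_{ts}` must be the mesh limit of `∑_{0<j<m} z^{m-j}_{ba} ∗ z^j_{as}`.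
Conversely the defect of this germ is `-∑ z^{m-j}_{bd} ∗ z^j_{da}`, of order `(b-a)^{mρ}`, so the
limit exists; it inherits Chen's relation and the estimates (`LevelBounds.update`). Uniqueness holds
because the difference of two candidates is additive and of order greater than `1` (`level_unique`).

The factorial bounds come from the constants `c_p = b Λ^p / ((p+1)² Γ(pρ+1))`. On dyadic partitions
every cut is a midpoint, which gains `2^{-pρ}`; this cancels the `2^{pρ}` in `Gamma_add_le`, a crude
form of the neoclassical inequality. The factor `(p+1)^{-2}` is stable under discrete convolution,
so `∑ c_i c_{p-i} ≤ 8b 2^{pρ} c_p` (`sum_levelConst_le`). A small `b`, depending only on `ρ`, then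
reproduces the same constants at every level, while `C` and `M` are absorbed in `Λ = KM`. -/

namespace Volterra

section MeshLimit

variable {A : Type*} [NormedRing A]

/-! ### Partitions and mesh limits -/

lemma IsPartition.le_of_le {a b : ℝ} {N : ℕ} {x : ℕ → ℝ} (h : IsPartition a b N x) {i j : ℕ}
    (hij : i ≤ j) (hj : j ≤ N) : x i ≤ x j := by
  induction j, hij using Nat.le_induction with
  | base => exact le_rfl
  | succ j _ ih => exact (ih (by omega)).trans (h.lt j (by omega)).le

lemma IsPartition.lt_of_lt {a b : ℝ} {N : ℕ} {x : ℕ → ℝ} (h : IsPartition a b N x) {i j : ℕ}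
    (hij : i < j) (hj : j ≤ N) : x i < x j :=
  (h.lt i (by omega)).trans_le (h.le_of_le hij hj)

lemma IsPartition.left_le {a b : ℝ} {N : ℕ} {x : ℕ → ℝ} (h : IsPartition a b N x) {i : ℕ}
    (hi : i ≤ N) : a ≤ x i := h.left ▸ h.le_of_le (Nat.zero_le i) hi

lemma IsPartition.le_right {a b : ℝ} {N : ℕ} {x : ℕ → ℝ} (h : IsPartition a b N x) {i : ℕ}
    (hi : i ≤ N) : x i ≤ b := h.right ▸ h.le_of_le hi le_rfl

lemma isPartition_uniform {a b : ℝ} (hab : a < b) {N : ℕ} (hN : 0 < N) :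
    IsPartition a b N fun i => a + i * ((b - a) / N) := by
  have hN' : (0 : ℝ) < N := by exact_mod_cast hN
  refine ⟨by simp, by field_simp; ring, fun k _ => ?_⟩
  have : 0 < (b - a) / N := div_pos (by linarith) hN'
  push_cast
  nlinarith

lemma exists_partition {a b : ℝ} (hab : a ≤ b) {δ : ℝ} (hδ : 0 < δ) :
    ∃ N x, IsPartition a b N x ∧ ∀ k < N, x (k + 1) - x k < δ := by
  rcases hab.eq_or_lt with rfl | hab
  · exact ⟨0, fun _ => a, ⟨rfl, rfl, by simp⟩, by simp⟩
  · obtain ⟨n, hn⟩ := exists_nat_gt ((b - a) / δ)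
    have hn' : (0 : ℝ) < n := (div_pos (by linarith) hδ).trans hn
    refine ⟨n, _, isPartition_uniform hab (by exact_mod_cast hn'), fun k _ => ?_⟩
    rw [div_lt_iff₀ hδ] at hn
    have : (b - a) / n < δ := by rw [div_lt_iff₀ hn']; linarith
    push_cast
    linarith

lemma IsPartition.eq_zero {a : ℝ} {N : ℕ} {x : ℕ → ℝ} (h : IsPartition a a N x) : N = 0 := by
  by_contra hN
  have := h.lt_of_lt (Nat.pos_of_ne_zero hN) le_rfl
  rw [h.left, h.right] at this
  exact lt_irrefl _ this

lemma isMeshLimit_self (a : ℝ) (F : ℝ → ℝ → A) : IsMeshLimit a a F 0 := by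
  intro ε hε
  refine ⟨1, one_pos, fun N x hx _ => ?_⟩
  simpa [hx.eq_zero] using hε

lemma IsMeshLimit.unique {a b : ℝ} (hab : a ≤ b) {F : ℝ → ℝ → A} {L L' : A}
    (h : IsMeshLimit a b F L) (h' : IsMeshLimit a b F L') : L = L' := by
  refine eq_of_forall_dist_le fun ε hε => ?_
  obtain ⟨δ, hδ, H⟩ := h (ε / 2) (half_pos hε)
  obtain ⟨δ', hδ', H'⟩ := h' (ε / 2) (half_pos hε)
  obtain ⟨N, x, hx, hm⟩ := exists_partition hab (lt_min hδ hδ')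
  have h1 := H N x hx fun k hk => (hm k hk).trans_le (min_le_left _ _)
  have h2 := H' N x hx fun k hk => (hm k hk).trans_le (min_le_right _ _)
  rw [← dist_eq_norm] at h1 h2
  have := dist_triangle_left L L' (∑ k ∈ Finset.range N, F (x k) (x (k + 1)))
  linarith

lemma IsMeshLimit.meshLimit_eq {a b : ℝ} (hab : a ≤ b) {F : ℝ → ℝ → A} {L : A}
    (h : IsMeshLimit a b F L) : meshLimit a b F = L := by
  have hex : ∃ L, IsMeshLimit a b F L := ⟨L, h⟩
  rw [meshLimit, dif_pos hex]
  exact hex.choose_spec.unique hab h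

lemma isMeshLimit_meshLimit {a b : ℝ} {F : ℝ → ℝ → A} (h : ∃ L, IsMeshLimit a b F L) :
    IsMeshLimit a b F (meshLimit a b F) := by
  rw [meshLimit, dif_pos h]
  exact h.choose_spec

lemma meshLimit_self (a : ℝ) (F : ℝ → ℝ → A) : meshLimit a a F = 0 :=
  (isMeshLimit_self a F).meshLimit_eq le_rfl

lemma IsMeshLimit.congr {a b : ℝ} {F F' : ℝ → ℝ → A} {L : A} (h : IsMeshLimit a b F L)
    (hF : ∀ x y, a ≤ x → x ≤ y → y ≤ b → F x y = F' x y) : IsMeshLimit a b F' L := by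
  intro ε hε
  obtain ⟨δ, hδ, H⟩ := h ε hε
  refine ⟨δ, hδ, fun N x hx hm => ?_⟩
  rw [← Finset.sum_congr rfl fun k hk => ?_]
  · exact H N x hx hm
  · have hk := Finset.mem_range.1 hk
    exact hF _ _ (hx.left_le hk.le) (hx.lt k hk).le (hx.le_right hk)

lemma meshLimit_congr {a b : ℝ} {F F' : ℝ → ℝ → A}
    (hF : ∀ x y, a ≤ x → x ≤ y → y ≤ b → F x y = F' x y) : meshLimit a b F = meshLimit a b F' := by
  -- The two predicates are equal, so the chosen values agree even where no limit exists and both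
  -- are the default `0`.
  have : IsMeshLimit a b F = IsMeshLimit a b F' := by
    funext L
    exact propext ⟨fun h => h.congr hF, fun h => h.congr fun x y h1 h2 h3 => (hF x y h1 h2 h3).symm⟩
  unfold meshLimit
  rw [this]

lemma IsMeshLimit.add {a b : ℝ} {F F' : ℝ → ℝ → A} {L L' : A}
    (h : IsMeshLimit a b F L) (h' : IsMeshLimit a b F' L') :
    IsMeshLimit a b (fun x y => F x y + F' x y) (L + L') := by
  intro ε hε
  obtain ⟨δ, hδ, H⟩ := h (ε / 2) (half_pos hε)
  obtain ⟨δ', hδ', H'⟩ := h' (ε / 2) (half_pos hε)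
  refine ⟨min δ δ', lt_min hδ hδ', fun N x hx hm => ?_⟩
  have h1 := H N x hx fun k hk => (hm k hk).trans_le (min_le_left _ _)
  have h2 := H' N x hx fun k hk => (hm k hk).trans_le (min_le_right _ _)
  rw [Finset.sum_add_distrib, add_sub_add_comm]
  exact (norm_add_le _ _).trans_lt (by linarith)

lemma IsMeshLimit.neg {a b : ℝ} {F : ℝ → ℝ → A} {L : A} (h : IsMeshLimit a b F L) :
    IsMeshLimit a b (fun x y => -F x y) (-L) := by
  intro ε hε
  obtain ⟨δ, hδ, H⟩ := h ε hε
  refine ⟨δ, hδ, fun N x hx hm => ?_⟩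
  rw [Finset.sum_neg_distrib, ← neg_sub', norm_neg]
  exact H N x hx hm

lemma IsMeshLimit.sub {a b : ℝ} {F F' : ℝ → ℝ → A} {L L' : A}
    (h : IsMeshLimit a b F L) (h' : IsMeshLimit a b F' L') :
    IsMeshLimit a b (fun x y => F x y - F' x y) (L - L') := by
  simpa only [sub_eq_add_neg] using h.add h'.neg

lemma IsMeshLimit.mul_const {a b : ℝ} {F : ℝ → ℝ → A} {L : A} (h : IsMeshLimit a b F L) (w : A) :
    IsMeshLimit a b (fun x y => F x y * w) (L * w) := by
  intro ε hε
  obtain ⟨δ, hδ, H⟩ := h (ε / (‖w‖ + 1)) (by positivity)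
  refine ⟨δ, hδ, fun N x hx hm => ?_⟩
  rw [← Finset.sum_mul, ← sub_mul]
  refine (norm_mul_le _ _).trans_lt ?_
  have h1 := H N x hx hm
  rw [lt_div_iff₀ (by positivity)] at h1
  nlinarith [norm_nonneg (∑ k ∈ Finset.range N, F (x k) (x (k + 1)) - L), norm_nonneg w]

lemma isMeshLimit_increment (a b : ℝ) (f : ℝ → A) :
    IsMeshLimit a b (fun x y => f y - f x) (f b - f a) := by
  intro ε hε
  refine ⟨1, one_pos, fun N x hx _ => ?_⟩
  rw [Finset.sum_range_sub (fun k => f (x k)), hx.left, hx.right]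
  simpa using hε

/-- Mesh limits over adjacent intervals add up. -/
lemma IsMeshLimit.eq_add {a c b : ℝ} (hac : a ≤ c) (hcb : c ≤ b) {F : ℝ → ℝ → A} {L L₁ L₂ : A}
    (h : IsMeshLimit a b F L) (h₁ : IsMeshLimit a c F L₁) (h₂ : IsMeshLimit c b F L₂) :
    L = L₁ + L₂ := by
  refine eq_of_forall_dist_le fun ε hε => ?_
  obtain ⟨δ, hδ, H⟩ := h (ε / 3) (by positivity)
  obtain ⟨δ₁, hδ₁, H₁⟩ := h₁ (ε / 3) (by positivity)
  obtain ⟨δ₂, hδ₂, H₂⟩ := h₂ (ε / 3) (by positivity)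
  obtain ⟨N, x, hx, hm⟩ := exists_partition hac (lt_min hδ hδ₁)
  obtain ⟨N', x', hx', hm'⟩ := exists_partition hcb (lt_min hδ hδ₂)
  have e1 := H₁ N x hx fun k hk => (hm k hk).trans_le (min_le_right _ _)
  have e2 := H₂ N' x' hx' fun k hk => (hm' k hk).trans_le (min_le_right _ _)
  set y : ℕ → ℝ := fun k => if k ≤ N then x k else x' (k - N) with hy
  have y1 : ∀ k ≤ N, y k = x k := fun k hk => if_pos hk
  have y2 : ∀ k, y (N + k) = x' k := fun k => by
    rcases Nat.eq_zero_or_pos k with rfl | hk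
    · rw [add_zero, y1 N le_rfl, hx.right, hx'.left]
    · rw [hy]; dsimp only; rw [if_neg (by omega), Nat.add_sub_cancel_left]
  have step : ∀ k < N + N', y k < y (k + 1) ∧ y (k + 1) - y k < δ := by
    intro k hk
    rcases lt_or_ge k N with h | h
    · rw [y1 k h.le, y1 (k + 1) h]
      exact ⟨hx.lt k h, (hm k h).trans_le (min_le_left _ _)⟩
    · obtain ⟨l, rfl⟩ := Nat.exists_eq_add_of_le h
      rw [add_assoc, y2, y2]
      exact ⟨hx'.lt l (by omega), (hm' l (by omega)).trans_le (min_le_left _ _)⟩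
  have e := H (N + N') y
    ⟨by rw [y1 0 (Nat.zero_le _), hx.left], by rw [y2, hx'.right], fun k hk => (step k hk).1⟩
    fun k hk => (step k hk).2
  have hsum : ∑ k ∈ Finset.range (N + N'), F (y k) (y (k + 1)) =
      ∑ k ∈ Finset.range N, F (x k) (x (k + 1)) +
        ∑ k ∈ Finset.range N', F (x' k) (x' (k + 1)) := by
    rw [Finset.sum_range_add]
    congr 1
    · refine Finset.sum_congr rfl fun k hk => ?_
      have := Finset.mem_range.1 hk
      rw [y1 k this.le, y1 (k + 1) this]
    · exact Finset.sum_congr rfl fun k _ => by rw [add_assoc, y2, y2]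
  rw [hsum] at e
  rw [dist_eq_norm]
  set X := ∑ k ∈ Finset.range N, F (x k) (x (k + 1))
  set X' := ∑ k ∈ Finset.range N', F (x' k) (x' (k + 1))
  have : L - (L₁ + L₂) = -(X + X' - L) + (X - L₁) + (X' - L₂) := by abel
  rw [this]
  refine (norm_add₃_le).trans ?_
  rw [norm_neg]
  linarith

lemma IsMeshLimit.mem {a b : ℝ} (hab : a ≤ b) {F : ℝ → ℝ → A} {L : A} (h : IsMeshLimit a b F L)
    {S : AddSubmonoid A} (hS : IsClosed (S : Set A))
    (hF : ∀ x y, a ≤ x → x ≤ y → y ≤ b → F x y ∈ S) : L ∈ S := by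
  have : L ∈ closure (S : Set A) := by
    refine Metric.mem_closure_iff.2 fun ε hε => ?_
    obtain ⟨δ, hδ, H⟩ := h ε hε
    obtain ⟨N, x, hx, hm⟩ := exists_partition hab hδ
    refine ⟨∑ k ∈ Finset.range N, F (x k) (x (k + 1)), S.sum_mem fun k hk => ?_, ?_⟩
    · have hk := Finset.mem_range.1 hk
      exact hF _ _ (hx.left_le hk.le) (hx.lt k hk).le (hx.le_right hk)
    · rw [dist_comm, dist_eq_norm]
      exact H N x hx hm
  rwa [hS.closure_eq] at this

/-- Convergence is not needed, since the default value `0` lies in every submonoid. -/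
lemma meshLimit_mem {a b : ℝ} (hab : a ≤ b) {F : ℝ → ℝ → A}
    {S : AddSubmonoid A} (hS : IsClosed (S : Set A))
    (hF : ∀ x y, a ≤ x → x ≤ y → y ≤ b → F x y ∈ S) : meshLimit a b F ∈ S := by
  by_cases h : ∃ L, IsMeshLimit a b F L
  · exact (isMeshLimit_meshLimit h).mem hab hS hF
  · rw [meshLimit, dif_neg h]
    exact S.zero_mem

/-! ### Sewing -/

/-- The maximal inequality for an almost additive double sequence. -/
lemma norm_sum_sub_le_of_almost_additive {F : ℕ → ℕ → A} {G : ℕ → ℝ} {K θ : ℝ} (hK : 0 ≤ K)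
    (hθ : 1 < θ) {L : ℕ} (hG : ∀ i j, i ≤ j → j ≤ L → G i ≤ G j)
    (hF : ∀ i k j, i ≤ k → k ≤ j → j ≤ L → ‖F i j - F i k - F k j‖ ≤ K * (G j - G i) ^ θ) :
    ∀ i j, i ≤ j → j ≤ L → ‖∑ k ∈ Finset.Ico i j, F k (k + 1) - F i j‖ ≤
      2 * K / (1 - 2 ^ (1 - θ)) * (G j - G i) ^ θ := by
  have hr : (2 : ℝ) ^ (1 - θ) < 1 := Real.rpow_lt_one_of_one_lt_of_neg one_lt_two (by linarith)
  set C := 2 * K / (1 - 2 ^ (1 - θ)) with hC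
  have hC0 : 0 ≤ C := div_nonneg (by positivity) (by linarith)
  -- `C` is the fixed point of the induction: two defects of size `K`, and two parts of weight at
  -- most `W/2`, which cost `2 · 2^{-θ} C`.
  have hCeq : 2 * K + C * 2 ^ (1 - θ) = C := by
    have : (1 : ℝ) - 2 ^ (1 - θ) ≠ 0 := by linarith
    rw [hC]; field_simp; ring
  suffices H : ∀ n i j, i ≤ j → j ≤ L → j - i ≤ n →
      ‖∑ k ∈ Finset.Ico i j, F k (k + 1) - F i j‖ ≤ C * (G j - G i) ^ θ from
    fun i j hij hj => H _ i j hij hj le_rfl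
  intro n
  induction n with
  | zero =>
    intro i j hij hj hn
    obtain rfl : i = j := by omega
    have := hF i i i le_rfl le_rfl hj
    have h0 : (0 : ℝ) ^ θ = 0 := Real.zero_rpow (by linarith)
    simp only [sub_self, h0, mul_zero, zero_sub, norm_neg] at this
    simpa [h0] using this
  | succ n ih =>
    intro i j hij hj hn
    rcases hij.eq_or_lt with rfl | hlt
    · exact ih i i le_rfl hj (by omega)
    set W := G j - G i with hW
    have hW0 : 0 ≤ W := sub_nonneg.2 (hG i j hij hj)
    -- The cut is made at the first index where `G` has passed half of its increment. The single
    -- step across that level is split off, as it carries no error, and both remaining parts have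
    -- weight at most `W/2`. The alternative `k = j` covers `W = 0`.
    have hex : ∃ k, i < k ∧ (k = j ∨ W / 2 < G k - G i) := ⟨j, hlt, Or.inl rfl⟩
    classical
    obtain ⟨hk1, hk2⟩ := Nat.find_spec hex
    have hmin := fun {m} => Nat.find_min hex (m := m)
    have hkj : Nat.find hex ≤ j := Nat.find_min' hex ⟨hlt, Or.inl rfl⟩
    obtain ⟨k, hk⟩ : ∃ k, Nat.find hex = k + 1 := ⟨Nat.find hex - 1, by omega⟩
    rw [hk] at hk1 hk2 hkj
    rw [hk] at hmin
    have hik : i ≤ k := by omega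
    have hleft : G k - G i ≤ W / 2 := by
      rcases hik.eq_or_lt with rfl | h
      · simp; positivity
      · have := hmin (m := k) (by omega)
        push Not at this
        exact (this h).2
    have hright : G j - G (k + 1) ≤ W / 2 := by
      rcases hk2 with h | h
      · rw [h]; simp; positivity
      · linarith
    have b1 := ih i k hik (by omega) (by omega)
    have b2 := ih (k + 1) j hkj hj (by omega)
    have d1 := hF i k j hik (by omega) hj
    have d2 := hF k (k + 1) j (by omega) hkj hj
    have p1 : (G k - G i) ^ θ ≤ (W / 2) ^ θ :=
      Real.rpow_le_rpow (sub_nonneg.2 (hG i k hik (by omega))) hleft (by linarith)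
    have p2 : (G j - G (k + 1)) ^ θ ≤ (W / 2) ^ θ :=
      Real.rpow_le_rpow (sub_nonneg.2 (hG _ _ hkj hj)) hright (by linarith)
    have p3 : (G j - G k) ^ θ ≤ W ^ θ :=
      Real.rpow_le_rpow (sub_nonneg.2 (hG _ _ (by omega) hj))
        (by have := hG i k hik (by omega); rw [hW]; linarith) (by linarith)
    have p4 : 2 * (W / 2) ^ θ = 2 ^ (1 - θ) * W ^ θ := by
      rw [Real.div_rpow hW0 (by norm_num), Real.rpow_sub (by norm_num), Real.rpow_one]
      ring
    rw [← Finset.sum_Ico_consecutive _ hik (show k ≤ j by omega),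
      ← Finset.sum_Ico_consecutive _ (Nat.le_succ k) hkj, Nat.Ico_succ_singleton,
      Finset.sum_singleton]
    have hsplit : ∑ m ∈ Finset.Ico i k, F m (m + 1) + (F k (k + 1) +
        ∑ m ∈ Finset.Ico (k + 1) j, F m (m + 1)) - F i j =
        (∑ m ∈ Finset.Ico i k, F m (m + 1) - F i k) +
        (∑ m ∈ Finset.Ico (k + 1) j, F m (m + 1) - F (k + 1) j) +
        (-(F i j - F i k - F k j) + -(F k j - F k (k + 1) - F (k + 1) j)) := by abel
    rw [hsplit]
    refine (norm_add₃_le).trans ?_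
    have d3 := norm_add_le (-(F i j - F i k - F k j)) (-(F k j - F k (k + 1) - F (k + 1) j))
    rw [norm_neg, norm_neg] at d3
    have q1 := mul_le_mul_of_nonneg_left p1 hC0
    have q2 := mul_le_mul_of_nonneg_left p2 hC0
    have q3 := mul_le_mul_of_nonneg_left p3 hK
    calc _ ≤ C * (W / 2) ^ θ + C * (W / 2) ^ θ + 2 * K * W ^ θ := by linarith
      _ = (2 * K + C * 2 ^ (1 - θ)) * W ^ θ := by linear_combination C * p4
      _ = C * W ^ θ := by rw [hCeq]

lemma sum_range_eq_sum_sum_Ico (f : ℕ → A) (φ : ℕ → ℕ) (N : ℕ) (h0 : φ 0 = 0)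
    (hφ : ∀ k < N, φ k ≤ φ (k + 1)) :
    ∑ i ∈ Finset.range (φ N), f i =
      ∑ k ∈ Finset.range N, ∑ i ∈ Finset.Ico (φ k) (φ (k + 1)), f i := by
  induction N with
  | zero => simp [h0]
  | succ N ih =>
    rw [Finset.sum_range_succ, ← ih fun k hk => hφ k (by omega),
      Finset.sum_range_add_sum_Ico _ (hφ N (by omega))]

/-- Any two partitions have a common refinement. -/
lemma exists_common_refinement {a b : ℝ} {N N' : ℕ} {x x' : ℕ → ℝ} (hx : IsPartition a b N x)
    (hx' : IsPartition a b N' x') :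
    ∃ (L : ℕ) (y : ℕ → ℝ) (φ φ' : ℕ → ℕ), IsPartition a b L y ∧
      (φ 0 = 0 ∧ φ N = L ∧ (∀ k < N, φ k ≤ φ (k + 1)) ∧ ∀ k ≤ N, φ k ≤ L ∧ y (φ k) = x k) ∧
      (φ' 0 = 0 ∧ φ' N' = L ∧ (∀ k < N', φ' k ≤ φ' (k + 1)) ∧
        ∀ k ≤ N', φ' k ≤ L ∧ y (φ' k) = x' k) := by
  classical
  set S : Finset ℝ := (Finset.range (N + 1)).image x ∪ (Finset.range (N' + 1)).image x' with hS
  have haS : a ∈ S := by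
    rw [hS, Finset.mem_union]; left
    exact Finset.mem_image.2 ⟨0, by simp, hx.left⟩
  have hbS : b ∈ S := by
    rw [hS, Finset.mem_union]; left
    exact Finset.mem_image.2 ⟨N, by simp, hx.right⟩
  have hSab : ∀ r ∈ S, a ≤ r ∧ r ≤ b := by
    intro r hr
    rw [hS, Finset.mem_union, Finset.mem_image, Finset.mem_image] at hr
    rcases hr with ⟨k, hk, rfl⟩ | ⟨k, hk, rfl⟩
    · have := Finset.mem_range.1 hk
      exact ⟨hx.left_le (by omega), hx.le_right (by omega)⟩
    · have := Finset.mem_range.1 hk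
      exact ⟨hx'.left_le (by omega), hx'.le_right (by omega)⟩
  have hcard : 0 < S.card := Finset.card_pos.2 ⟨a, haS⟩
  obtain ⟨L, hL⟩ : ∃ L, S.card = L + 1 := ⟨S.card - 1, by omega⟩
  set e := S.orderEmbOfFin hL with he
  set y : ℕ → ℝ := fun i => e (Fin.ofNat (L + 1) i) with hy
  have hye : ∀ i (h : i < L + 1), y i = e ⟨i, h⟩ := fun i h => by
    rw [hy]; dsimp only
    congr 1
    ext
    simp [Fin.ofNat, Nat.mod_eq_of_lt h]
  have hlt : ∀ i j, i < j → j ≤ L → y i < y j := fun i j hij hj => by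
    rw [hye i (by omega), hye j (by omega)]
    exact e.strictMono (by simpa using hij)
  have hinj : ∀ i j, i ≤ L → j ≤ L → y i = y j → i = j := fun i j hi hj hij => by
    rcases lt_trichotomy i j with h | h | h
    · exact absurd hij (hlt i j h hj).ne
    · exact h
    · exact absurd hij.symm (hlt j i h hi).ne
  have hmem : ∀ i ≤ L, y i ∈ S := fun i hi => by
    rw [hye i (by omega)]
    exact Finset.orderEmbOfFin_mem _ _ _
  have hsurj : ∀ r ∈ S, ∃ i ≤ L, y i = r := by
    intro r hr
    have : r ∈ Set.range e := by rw [he, Finset.range_orderEmbOfFin]; exact hr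
    obtain ⟨i, rfl⟩ := this
    exact ⟨i, by omega, hye i i.2⟩
  have hmono : ∀ i j, i ≤ j → j ≤ L → y i ≤ y j := fun i j hij hj => by
    rcases hij.eq_or_lt with rfl | h
    · exact le_rfl
    · exact (hlt i j h hj).le
  have hy0 : y 0 = a := by
    obtain ⟨i, hi, hia⟩ := hsurj a haS
    exact le_antisymm (hia ▸ hmono 0 i (Nat.zero_le _) hi) (hSab _ (hmem 0 (Nat.zero_le _))).1
  have hyL : y L = b := by
    obtain ⟨i, hi, hib⟩ := hsurj b hbS
    exact le_antisymm (hSab _ (hmem L le_rfl)).2 (hib ▸ hmono i L hi le_rfl)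
  have key : ∀ {M : ℕ} {w : ℕ → ℝ}, IsPartition a b M w → (∀ k ≤ M, w k ∈ S) →
      ∃ φ : ℕ → ℕ, φ 0 = 0 ∧ φ M = L ∧ (∀ k < M, φ k ≤ φ (k + 1)) ∧
        ∀ k ≤ M, φ k ≤ L ∧ y (φ k) = w k := by
    intro M w hw hwS
    have : ∀ k, ∃ i, k ≤ M → i ≤ L ∧ y i = w k := fun k => by
      by_cases hk : k ≤ M
      · obtain ⟨i, hi, h⟩ := hsurj _ (hwS k hk)
        exact ⟨i, fun _ => ⟨hi, h⟩⟩
      · exact ⟨0, fun h => absurd h hk⟩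
    choose φ hφ using this
    refine ⟨φ, ?_, ?_, fun k hk => ?_, hφ⟩
    · obtain ⟨h1, h2⟩ := hφ 0 (Nat.zero_le _)
      exact hinj _ _ h1 (Nat.zero_le _) (by rw [h2, hy0, hw.left])
    · obtain ⟨h1, h2⟩ := hφ M le_rfl
      exact hinj _ _ h1 le_rfl (by rw [h2, hyL, hw.right])
    · obtain ⟨h1, h2⟩ := hφ k hk.le
      obtain ⟨h3, h4⟩ := hφ (k + 1) hk
      by_contra hcon
      push Not at hcon
      have := hlt _ _ hcon h1
      rw [h2, h4] at this
      exact lt_asymm this (hw.lt k hk)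
  obtain ⟨φ, hφ⟩ := key hx fun k hk => by
    rw [hS, Finset.mem_union]; left
    exact Finset.mem_image.2 ⟨k, by simp; omega, rfl⟩
  obtain ⟨φ', hφ'⟩ := key hx' fun k hk => by
    rw [hS, Finset.mem_union]; right
    exact Finset.mem_image.2 ⟨k, by simp; omega, rfl⟩
  exact ⟨L, y, φ, φ', ⟨hy0, hyL, fun k hk => hlt k (k + 1) (by omega) (by omega)⟩, hφ, hφ'⟩

end MeshLimit

section Sewing

variable {A : Type*} [NormedRing A]

lemma exists_isMeshLimit_of_cauchy [CompleteSpace A] {a b : ℝ} (hab : a ≤ b) {F : ℝ → ℝ → A}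
    (h : ∀ ε > 0, ∃ δ > 0, ∀ (N : ℕ) (x : ℕ → ℝ) (N' : ℕ) (x' : ℕ → ℝ), IsPartition a b N x →
      IsPartition a b N' x' → (∀ k < N, x (k + 1) - x k < δ) → (∀ k < N', x' (k + 1) - x' k < δ) →
      ‖∑ k ∈ Finset.range N, F (x k) (x (k + 1)) - ∑ k ∈ Finset.range N', F (x' k) (x' (k + 1))‖
        < ε) : ∃ L, IsMeshLimit a b F L := by
  choose N x hx hm using fun n : ℕ => exists_partition hab (δ := 1 / ((n : ℝ) + 1)) (by positivity)
  have hsmall : ∀ δ > 0, ∃ n₀ : ℕ, ∀ n ≥ n₀, ∀ k < N n, x n (k + 1) - x n k < δ := by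
    intro δ hδ
    obtain ⟨n₀, hn₀⟩ := exists_nat_one_div_lt hδ
    refine ⟨n₀, fun n hn k hk => (hm n k hk).trans (lt_of_le_of_lt ?_ hn₀)⟩
    exact one_div_le_one_div_of_le (by positivity) (by simpa using hn)
  have hc : CauchySeq fun n => ∑ k ∈ Finset.range (N n), F (x n k) (x n (k + 1)) := by
    refine Metric.cauchySeq_iff.2 fun ε hε => ?_
    obtain ⟨δ, hδ, H⟩ := h ε hε
    obtain ⟨n₀, hn₀⟩ := hsmall δ hδ
    refine ⟨n₀, fun m hm' n hn' => ?_⟩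
    rw [dist_eq_norm]
    exact H _ _ _ _ (hx m) (hx n) (hn₀ m hm') (hn₀ n hn')
  obtain ⟨L, hL⟩ := cauchySeq_tendsto_of_complete hc
  refine ⟨L, fun ε hε => ?_⟩
  obtain ⟨δ, hδ, H⟩ := h (ε / 2) (half_pos hε)
  obtain ⟨n₀, hn₀⟩ := hsmall δ hδ
  obtain ⟨n₁, hn₁⟩ := Metric.tendsto_atTop.1 hL (ε / 2) (half_pos hε)
  refine ⟨δ, hδ, fun N' x' hx' hm' => ?_⟩
  have e1 := H _ _ _ _ hx' (hx (max n₀ n₁)) hm' (hn₀ _ (le_max_left _ _))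
  have e2 := hn₁ _ (le_max_right n₀ n₁)
  rw [← dist_eq_norm] at e1 ⊢
  exact (dist_triangle _ _ _).trans_lt (by linarith)

/-- The sewing lemma for a germ whose defect is bounded by a power of an additive control. -/
lemma exists_isMeshLimit_of_control [CompleteSpace A] {u t K θ s : ℝ} (hut : u ≤ t) (hK : 0 ≤ K)
    (hθ : 1 < θ) (hs : 0 < s) {g : ℝ → ℝ}
    (hmono : ∀ a b, u ≤ a → a ≤ b → b ≤ t → g a ≤ g b)
    (hg : ∀ a b, u ≤ a → a ≤ b → b ≤ t → g b - g a ≤ (b - a) ^ s) {F : ℝ → ℝ → A}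
    (hF : ∀ a c b, u ≤ a → a ≤ c → c ≤ b → b ≤ t →
      ‖F a b - F a c - F c b‖ ≤ K * (g b - g a) ^ θ) : ∃ L, IsMeshLimit u t F L := by
  set C := 2 * K / (1 - 2 ^ (1 - θ)) with hC
  have hr : (2 : ℝ) ^ (1 - θ) < 1 := Real.rpow_lt_one_of_one_lt_of_neg one_lt_two (by linarith)
  have hC0 : 0 ≤ C := div_nonneg (by positivity) (by linarith)
  -- A partition is compared with a refinement. Each block costs the power `θ` of an increment of
  -- `g`; one factor telescopes and the remaining power `θ - 1` is small with the mesh.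
  have key : ∀ (δ : ℝ) (N : ℕ) (x : ℕ → ℝ) (L : ℕ) (y : ℕ → ℝ) (φ : ℕ → ℕ), 0 < δ →
      IsPartition u t N x → IsPartition u t L y → (∀ k < N, x (k + 1) - x k < δ) →
      (φ 0 = 0 ∧ φ N = L ∧ (∀ k < N, φ k ≤ φ (k + 1)) ∧ ∀ k ≤ N, φ k ≤ L ∧ y (φ k) = x k) →
      ‖∑ i ∈ Finset.range L, F (y i) (y (i + 1)) - ∑ k ∈ Finset.range N, F (x k) (x (k + 1))‖ ≤
        C * ((g t - g u) * (δ ^ s) ^ (θ - 1)) := by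
    rintro δ N x L y φ hδ hx hy hm ⟨h0, hL, hφ, hyx⟩
    have hmax := norm_sum_sub_le_of_almost_additive (F := fun i j => F (y i) (y j))
      (G := fun i => g (y i)) hK hθ (L := L)
      (fun i j hij hj => hmono _ _ (hy.left_le (hij.trans hj)) (hy.le_of_le hij hj)
        (hy.le_right hj))
      (fun i k j hik hkj hj => hF _ _ _ (hy.left_le ((hik.trans hkj).trans hj))
        (hy.le_of_le hik (hkj.trans hj)) (hy.le_of_le hkj hj) (hy.le_right hj))
    rw [← hL, sum_range_eq_sum_sum_Ico _ φ N h0 hφ, ← Finset.sum_sub_distrib]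
    refine (norm_sum_le _ _).trans ?_
    have hstep : ∀ k ∈ Finset.range N,
        ‖∑ i ∈ Finset.Ico (φ k) (φ (k + 1)), F (y i) (y (i + 1)) - F (x k) (x (k + 1))‖ ≤
          C * ((g (x (k + 1)) - g (x k)) * (δ ^ s) ^ (θ - 1)) := by
      intro k hk
      have hk := Finset.mem_range.1 hk
      have h1 := hmax _ _ (hφ k hk) (hyx (k + 1) hk).1
      rw [(hyx k hk.le).2, (hyx (k + 1) hk).2] at h1
      refine h1.trans (mul_le_mul_of_nonneg_left ?_ hC0)
      have hd0 : 0 ≤ g (x (k + 1)) - g (x k) := sub_nonneg.2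
        (hmono _ _ (hx.left_le hk.le) (hx.lt k hk).le (hx.le_right hk))
      have hd1 : g (x (k + 1)) - g (x k) ≤ δ ^ s :=
        (hg _ _ (hx.left_le hk.le) (hx.lt k hk).le (hx.le_right hk)).trans
          (Real.rpow_le_rpow (sub_nonneg.2 (hx.lt k hk).le) (hm k hk).le hs.le)
      calc (g (x (k + 1)) - g (x k)) ^ θ
          = (g (x (k + 1)) - g (x k)) ^ (1 + (θ - 1)) := by congr 1; ring
        _ = (g (x (k + 1)) - g (x k)) * (g (x (k + 1)) - g (x k)) ^ (θ - 1) := by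
          rw [Real.rpow_add_of_nonneg hd0 zero_le_one (by linarith), Real.rpow_one]
        _ ≤ _ := mul_le_mul_of_nonneg_left (Real.rpow_le_rpow hd0 hd1 (by linarith)) hd0
    refine (Finset.sum_le_sum hstep).trans (le_of_eq ?_)
    rw [← Finset.mul_sum, ← Finset.sum_mul, Finset.sum_range_sub (fun k => g (x k)), hx.left,
      hx.right]
  refine exists_isMeshLimit_of_cauchy hut fun ε hε => ?_
  have hlim : Filter.Tendsto (fun δ : ℝ => C * ((g t - g u) * (δ ^ s) ^ (θ - 1)))
      (nhdsWithin 0 (Set.Ioi 0)) (nhds 0) := by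
    have h1 : Filter.Tendsto (fun δ : ℝ => C * ((g t - g u) * (δ ^ s) ^ (θ - 1))) (nhds 0)
        (nhds (C * ((g t - g u) * ((0 : ℝ) ^ s) ^ (θ - 1)))) := by
      refine ((((Real.continuousAt_rpow_const 0 s (Or.inr hs.le)).tendsto).rpow_const
        (Or.inr (by linarith))).const_mul _).const_mul _
    rw [Real.zero_rpow hs.ne', Real.zero_rpow (by linarith), mul_zero, mul_zero] at h1
    exact h1.mono_left nhdsWithin_le_nhds
  obtain ⟨δ, hδ1, hδ⟩ := ((hlim.eventually (gt_mem_nhds (half_pos hε))).and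
    self_mem_nhdsWithin).exists
  refine ⟨δ, hδ, fun N x N' x' hx hx' hm hm' => ?_⟩
  obtain ⟨L, y, φ, φ', hy, hφ, hφ'⟩ := exists_common_refinement hx hx'
  have e1 := key δ N x L y φ hδ hx hy hm hφ
  have e2 := key δ N' x' L y φ' hδ hx' hy hm' hφ'
  rw [← dist_eq_norm] at e1 e2 ⊢
  refine (dist_triangle_left _ _ (∑ i ∈ Finset.range L, F (y i) (y (i + 1)))).trans_lt ?_
  linarith

/-- For `X = b - a` and `Z = b - u` this bounds a singular defect by the power `1 + σ/2` of an
increment of the concave control `x ↦ (x-u)^s`. The exponent `s` solves `s (1 + σ/2) = σ`, which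
makes both sides homogeneous of the same degree. With `x = X/Z` it then suffices that `1 - (1-x)^s ≥
s x`, by Bernoulli, and that `x^{1+σ} ≤ x^{1+σ/2}`. -/
lemma rpow_mul_div_le_rpow_sub {X Z σ : ℝ} (hX : 0 ≤ X) (hXZ : X ≤ Z) (hσ : 0 < σ) (hσ1 : σ ≤ 1) :
    X ^ σ * (X / Z) ≤ (((2 * σ / (2 + σ))⁻¹) ^ (1 + σ / 2)) *
      (Z ^ (2 * σ / (2 + σ)) - (Z - X) ^ (2 * σ / (2 + σ))) ^ (1 + σ / 2) := by
  set s := 2 * σ / (2 + σ) with hs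
  have hs0 : 0 < s := by positivity
  have hs1 : s ≤ 1 := by rw [hs, div_le_one (by positivity)]; linarith
  have hmono : 0 ≤ Z ^ s - (Z - X) ^ s :=
    sub_nonneg.2 (Real.rpow_le_rpow (by linarith) (by linarith) hs0.le)
  rcases (hX.trans hXZ).eq_or_lt with hZ | hZ
  · rw [← hZ, div_zero, mul_zero]
    rw [← hZ] at hmono
    positivity
  set x := X / Z with hx
  have hx0 : 0 ≤ x := by positivity
  have hx1 : x ≤ 1 := by rw [hx, div_le_one hZ]; exact hXZ
  have hXe : X = Z * x := by rw [hx]; field_simp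
  have hb : Z ^ s * (s * x) ≤ Z ^ s - (Z - X) ^ s := by
    have h1 := rpow_one_add_le_one_add_mul_self (s := -x) (by linarith) hs0.le hs1
    have h2 : Z - X = Z * (1 + -x) := by rw [hXe]; ring
    rw [h2, Real.mul_rpow hZ.le (by linarith)]
    have := mul_le_mul_of_nonneg_left h1 (Real.rpow_nonneg hZ.le s)
    linarith
  have hsθ : s * (1 + σ / 2) = σ := by rw [hs]; field_simp
  calc X ^ σ * x = Z ^ σ * x ^ (1 + σ) := by
        rw [hXe, Real.mul_rpow hZ.le hx0, Real.rpow_add_of_nonneg hx0 zero_le_one hσ.le,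
          Real.rpow_one]
        ring
    _ ≤ Z ^ σ * x ^ (1 + σ / 2) := by
        refine mul_le_mul_of_nonneg_left ?_ (by positivity)
        exact Real.rpow_le_rpow_of_exponent_ge' hx0 hx1 (by positivity) (by linarith)
    _ = (s⁻¹ * (Z ^ s * (s * x))) ^ (1 + σ / 2) := by
        have : s⁻¹ * (Z ^ s * (s * x)) = Z ^ s * x := by field_simp
        rw [this, Real.mul_rpow (by positivity) hx0, ← Real.rpow_mul hZ.le, hsθ]
    _ ≤ (s⁻¹ * (Z ^ s - (Z - X) ^ s)) ^ (1 + σ / 2) := by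
        refine Real.rpow_le_rpow (by positivity) ?_ (by positivity)
        exact mul_le_mul_of_nonneg_left hb (by positivity)
    _ = _ := Real.mul_rpow (by positivity) hmono

/-- The sewing lemma for a germ with a singularity at the left end of the interval. -/
theorem exists_isMeshLimit_of_defect_le [CompleteSpace A] {u t K σ : ℝ} (hut : u ≤ t) (hK : 0 ≤ K)
    (hσ : 0 < σ) {F : ℝ → ℝ → A}
    (hF : ∀ a c b, u ≤ a → a ≤ c → c ≤ b → b ≤ t →
      ‖F a b - F a c - F c b‖ ≤ K * (b - a) ^ σ * ((b - a) / (b - u))) :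
    ∃ L, IsMeshLimit u t F L := by
  -- The exponent is lowered to at most `1`, where the concave control is available; the surplus
  -- becomes the factor `(t-u)^{σ-r}`.
  set r := min σ 1 with hr
  have hr0 : 0 < r := lt_min hσ one_pos
  have hr1 : r ≤ 1 := min_le_right _ _
  have hrσ : r ≤ σ := min_le_left _ _
  set s := 2 * r / (2 + r) with hs
  have hs0 : 0 < s := by positivity
  have hs1 : s ≤ 1 := by rw [hs, div_le_one (by positivity)]; linarith
  have htu : 0 ≤ t - u := sub_nonneg.2 hut
  refine exists_isMeshLimit_of_control (θ := 1 + r / 2) (s := s) (g := fun x => (x - u) ^ s)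
    (K := K * (t - u) ^ (σ - r) * (s⁻¹) ^ (1 + r / 2)) hut (by positivity) (by linarith) hs0
    (fun a b ha hab _ => Real.rpow_le_rpow (by linarith) (by linarith) hs0.le)
    (fun a b ha hab _ => ?_) fun a c b ha hac hcb hb => (hF a c b ha hac hcb hb).trans ?_
  · have := Real.rpow_add_le_add_rpow (sub_nonneg.2 hab) (sub_nonneg.2 ha) hs0.le hs1
    rw [sub_add_sub_cancel] at this
    linarith
  · have hab : 0 ≤ b - a := by linarith
    have h1 : (b - a) ^ σ ≤ (t - u) ^ (σ - r) * (b - a) ^ r := by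
      calc (b - a) ^ σ = (b - a) ^ (σ - r) * (b - a) ^ r := by
            rw [← Real.rpow_add_of_nonneg hab (by linarith) hr0.le, sub_add_cancel]
        _ ≤ _ := by
            refine mul_le_mul_of_nonneg_right ?_ (by positivity)
            exact Real.rpow_le_rpow hab (by linarith) (by linarith)
    have h2 := rpow_mul_div_le_rpow_sub hab (show b - a ≤ b - u by linarith) hr0 hr1
    rw [show b - u - (b - a) = a - u by ring] at h2
    have h3 : 0 ≤ (b - a) / (b - u) := div_nonneg hab (by linarith)
    calc K * (b - a) ^ σ * ((b - a) / (b - u))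
        ≤ K * ((t - u) ^ (σ - r) * (b - a) ^ r) * ((b - a) / (b - u)) := by gcongr
      _ = K * (t - u) ^ (σ - r) * ((b - a) ^ r * ((b - a) / (b - u))) := by ring
      _ ≤ K * (t - u) ^ (σ - r) * _ := mul_le_mul_of_nonneg_left h2 (by positivity)
      _ = _ := by ring

/-! ### Dyadic sums -/

/-- The sum of a germ over the partition of `[u,t]` into `2^k` equal intervals. -/
noncomputable def dyadicSum (F : ℝ → ℝ → A) (u t : ℝ) (k : ℕ) : A :=
  ∑ i ∈ Finset.range (2 ^ k), F (u + i * ((t - u) / 2 ^ k)) (u + (i + 1) * ((t - u) / 2 ^ k))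

/-- The defect of a germ at the midpoint of the `i`-th dyadic interval of level `k`. -/
noncomputable def dyadicDefect (F : ℝ → ℝ → A) (u t : ℝ) (k i : ℕ) : A :=
  F (u + i * ((t - u) / 2 ^ k)) (u + (i + 1) * ((t - u) / 2 ^ k)) -
    F (u + i * ((t - u) / 2 ^ k)) (u + (i + 1 / 2) * ((t - u) / 2 ^ k)) -
    F (u + (i + 1 / 2) * ((t - u) / 2 ^ k)) (u + (i + 1) * ((t - u) / 2 ^ k))

lemma sum_range_two_mul (f : ℕ → A) (N : ℕ) :
    ∑ i ∈ Finset.range (2 * N), f i = ∑ i ∈ Finset.range N, (f (2 * i) + f (2 * i + 1)) := by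
  induction N with
  | zero => simp
  | succ N ih => rw [mul_add, mul_one, Finset.sum_range_succ, Finset.sum_range_succ, ih,
      Finset.sum_range_succ, add_assoc]

lemma dyadicSum_succ (F : ℝ → ℝ → A) (u t : ℝ) (k : ℕ) :
    dyadicSum F u t k - dyadicSum F u t (k + 1) =
      ∑ i ∈ Finset.range (2 ^ k), dyadicDefect F u t k i := by
  unfold dyadicSum
  rw [pow_succ' 2 k, sum_range_two_mul, ← Finset.sum_sub_distrib]
  refine Finset.sum_congr rfl fun i _ => ?_
  have e1 : u + ((2 * i : ℕ) : ℝ) * ((t - u) / 2 ^ (k + 1)) = u + i * ((t - u) / 2 ^ k) := by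
    push_cast; rw [pow_succ]; field_simp
  have e2 : u + (((2 * i : ℕ) : ℝ) + 1) * ((t - u) / 2 ^ (k + 1)) =
      u + (i + 1 / 2) * ((t - u) / 2 ^ k) := by
    push_cast; rw [pow_succ]; field_simp
  have e3 : u + ((2 * i + 1 : ℕ) : ℝ) * ((t - u) / 2 ^ (k + 1)) =
      u + (i + 1 / 2) * ((t - u) / 2 ^ k) := by
    push_cast; rw [pow_succ]; field_simp
  have e4 : u + (((2 * i + 1 : ℕ) : ℝ) + 1) * ((t - u) / 2 ^ (k + 1)) =
      u + (i + 1) * ((t - u) / 2 ^ k) := by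
    push_cast; rw [pow_succ]; field_simp; ring
  rw [e1, e2, e3, e4, dyadicDefect]
  abel

/-- The hypothesis `h0` serves the case `u = t`, where the dyadic points are not strictly increasing
and the sum is a multiple of `F u u`. -/
lemma IsMeshLimit.tendsto_dyadicSum {u t : ℝ} (hut : u ≤ t) {F : ℝ → ℝ → A} {L : A}
    (hL : IsMeshLimit u t F L) (h0 : F u u = 0) :
    Filter.Tendsto (dyadicSum F u t) Filter.atTop (nhds L) := by
  rcases hut.eq_or_lt with rfl | hlt
  · have : L = 0 := hL.unique le_rfl (isMeshLimit_self u F)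
    have h : dyadicSum F u u = fun _ => 0 := by
      funext k
      simp [dyadicSum, h0]
    rw [h, this]
    exact tendsto_const_nhds
  · refine Metric.tendsto_atTop.2 fun ε hε => ?_
    obtain ⟨δ, hδ, H⟩ := hL ε hε
    have hlim : Filter.Tendsto (fun k : ℕ => (t - u) / 2 ^ k) Filter.atTop (nhds 0) := by
      have := (tendsto_pow_atTop_nhds_zero_of_lt_one (r := (1 / 2 : ℝ)) (by norm_num)
        (by norm_num)).const_mul (t - u)
      simpa [div_eq_mul_inv] using this
    obtain ⟨k₀, hk₀⟩ := (hlim.eventually (gt_mem_nhds hδ)).exists_forall_of_atTop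
    refine ⟨k₀, fun k hk => ?_⟩
    have hp := isPartition_uniform hlt (N := 2 ^ k) (by positivity)
    have := H _ _ hp fun i _ => by
      have := hk₀ k hk
      push_cast
      linarith
    rw [dist_eq_norm]
    push_cast at this
    exact this

/-- The distance from a mesh limit to a dyadic sum is controlled by the dyadic defects. -/
lemma IsMeshLimit.norm_sub_dyadicSum_le {u t : ℝ} (hut : u ≤ t) {F : ℝ → ℝ → A} {L : A}
    (hL : IsMeshLimit u t F L) (h0 : F u u = 0) {D : ℕ → ℝ} (hs : Summable D)
    (hD : ∀ k, ∑ i ∈ Finset.range (2 ^ k), ‖dyadicDefect F u t k i‖ ≤ D k) (k : ℕ) :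
    ‖L - dyadicSum F u t k‖ ≤ ∑' j, D (j + k) := by
  have h := dist_le_tsum_of_dist_le_of_tendsto (f := dyadicSum F u t) D (fun n => by
    rw [dist_eq_norm, Nat.succ_eq_add_one, dyadicSum_succ]
    exact (norm_sum_le _ _).trans (hD n)) hs (hL.tendsto_dyadicSum hut h0) k
  rw [← dist_eq_norm, dist_comm]
  simpa only [add_comm] using h

lemma dyadicSum_zero (F : ℝ → ℝ → A) (u t : ℝ) : dyadicSum F u t 0 = F u t := by
  simp [dyadicSum]

end Sewing

section ConvAlgebra

variable {A : Type*} [NormedRing A]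

/-! ### The recursion for the convolution product -/

/-- The germ whose mesh limit over `[u,t]` is `z^{p,τ}_{tu} ∗ y`. -/
noncomputable def germ (z : ℕ → ℝ → ℝ → ℝ → A) (p : ℕ) (y : ℝ → A) (u τ a b : ℝ) : A :=
  z p a b τ * y a + ∑ j ∈ Finset.Ico 1 p, conv z (p - j) (fun r => conv z j y u a r) a b τ

lemma sum_fin_eq_sum_Ico (p : ℕ) (f : ℕ → ℕ → A) :
    ∑ j : Fin p, f (p - j) (j + 1) = ∑ j ∈ Finset.Ico 1 (p + 1), f (p + 1 - j) j := by
  rw [Finset.sum_Ico_eq_sum_range, Finset.sum_range fun k => f (p + 1 - (1 + k)) (1 + k)]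
  refine Finset.sum_congr (by simp) fun j _ => ?_
  rw [add_comm 1 (j : ℕ), Nat.add_sub_add_right]

lemma conv_eq_meshLimit (z : ℕ → ℝ → ℝ → ℝ → A) {p : ℕ} (hp : 1 ≤ p) (y : ℝ → A) (u t τ : ℝ) :
    conv z p y u t τ = meshLimit u t (germ z p y u τ) := by
  obtain ⟨p, rfl⟩ : ∃ k, p = k + 1 := ⟨p - 1, by omega⟩
  rw [conv]
  congr 1
  funext a b
  rw [germ, ← sum_fin_eq_sum_Ico p fun k j => conv z k (fun r => conv z j y u a r) a b τ]

lemma convExists_iff (z : ℕ → ℝ → ℝ → ℝ → A) {p : ℕ} (hp : 1 ≤ p) (y : ℝ → A) (u t τ : ℝ) :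
    ConvExists z p y u t τ ↔ (∃ L, IsMeshLimit u t (germ z p y u τ) L) ∧
      ∀ a b, u ≤ a → a ≤ b → b ≤ t → ∀ j, 1 ≤ j → j < p →
        (∀ r, a ≤ r → r ≤ b → ConvExists z j y u a r) ∧
        ConvExists z (p - j) (fun r => conv z j y u a r) a b τ := by
  obtain ⟨p, rfl⟩ : ∃ k, p = k + 1 := ⟨p - 1, by omega⟩
  rw [ConvExists]
  have hg : (fun a b => z (p + 1) a b τ * y a +
      ∑ j : Fin p, conv z (p - j) (fun r => conv z (j + 1) y u a r) a b τ) =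
      germ z (p + 1) y u τ := by
    funext a b
    rw [germ, ← sum_fin_eq_sum_Ico p fun k j => conv z k (fun r => conv z j y u a r) a b τ]
  rw [hg]
  refine and_congr_right fun _ => forall₂_congr fun a b => forall₃_congr fun _ _ _ => ?_
  constructor
  · intro h j hj1 hj2
    obtain ⟨j, rfl⟩ : ∃ k, j = k + 1 := ⟨j - 1, by omega⟩
    rw [Nat.add_sub_add_right]
    exact h ⟨j, by omega⟩
  · intro h j
    have := h (j + 1) (by omega) (by omega)
    rwa [Nat.add_sub_add_right] at this

lemma conv_self (z : ℕ → ℝ → ℝ → ℝ → A) {p : ℕ} (hp : 1 ≤ p) (y : ℝ → A) (u τ : ℝ) :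
    conv z p y u u τ = 0 := by
  rw [conv_eq_meshLimit z hp, meshLimit_self]

/-- The convolution product only depends on the levels `1, …, p` on the simplex and on the values
of `y` on `[u,t]`. -/
lemma conv_congr {T : ℝ} {z z' : ℕ → ℝ → ℝ → ℝ → A} {p : ℕ} (hp : 1 ≤ p)
    (hz : ∀ k, 1 ≤ k → k ≤ p → ∀ s t τ, 0 ≤ s → s ≤ t → t ≤ τ → τ ≤ T → z k s t τ = z' k s t τ)
    {y y' : ℝ → A} {u t τ : ℝ} (hu : 0 ≤ u) (ht : t ≤ τ) (hτ : τ ≤ T)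
    (hy : ∀ r, u ≤ r → r ≤ t → y r = y' r) : conv z p y u t τ = conv z' p y' u t τ := by
  induction p using Nat.strong_induction_on generalizing y y' u t τ with
  | _ p ih =>
    rw [conv_eq_meshLimit z hp, conv_eq_meshLimit z' hp]
    refine meshLimit_congr fun a b ha hab hb => ?_
    rw [germ, germ, hz p hp le_rfl a b τ (by linarith) hab (by linarith) hτ,
      hy a ha (by linarith)]
    congr 1
    refine Finset.sum_congr rfl fun j hj => ?_
    rw [Finset.mem_Ico] at hj
    refine ih (p - j) (by omega) (by omega) (fun k h1 h2 => hz k h1 (by omega)) (by linarith)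
      (by linarith) hτ fun r hr1 hr2 => ?_
    exact ih j (by omega) hj.1 (fun k h1 h2 => hz k h1 (by omega)) hu hr1 (by linarith)
      fun r' h1 h2 => hy r' h1 (by linarith)

lemma conv_congr_right (z : ℕ → ℝ → ℝ → ℝ → A) {p : ℕ} (hp : 1 ≤ p)
    {y y' : ℝ → A} {u t τ : ℝ} (hu : 0 ≤ u) (ht : t ≤ τ)
    (hy : ∀ r, u ≤ r → r ≤ t → y r = y' r) : conv z p y u t τ = conv z p y' u t τ :=
  conv_congr hp (fun _ _ _ _ _ _ _ _ _ _ => rfl) hu ht le_rfl hy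

lemma conv_mem {T : ℝ} {z : ℕ → ℝ → ℝ → ℝ → A} {S : ℕ → AddSubmonoid A}
    (hS : ∀ k, IsClosed (S k : Set A)) (hmul : ∀ k l x y, x ∈ S k → y ∈ S l → x * y ∈ S (k + l))
    {p i : ℕ} (hp : 1 ≤ p)
    (hz : ∀ k, 1 ≤ k → k ≤ p → ∀ s t τ, 0 ≤ s → s ≤ t → t ≤ τ → τ ≤ T → z k s t τ ∈ S k)
    {y : ℝ → A} {u t τ : ℝ} (hu : 0 ≤ u) (hut : u ≤ t) (ht : t ≤ τ) (hτ : τ ≤ T)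
    (hy : ∀ r, u ≤ r → r ≤ t → y r ∈ S i) : conv z p y u t τ ∈ S (p + i) := by
  induction p using Nat.strong_induction_on generalizing i y u t τ with
  | _ p ih =>
    rw [conv_eq_meshLimit z hp]
    refine meshLimit_mem hut (hS _) fun a b ha hab hb => ?_
    refine add_mem (hmul _ _ _ _ (hz p hp le_rfl a b τ (by linarith) hab (by linarith) hτ)
      (hy a ha (by linarith))) (sum_mem fun j hj => ?_)
    rw [Finset.mem_Ico] at hj
    rw [show p + i = p - j + (j + i) by omega]
    refine ih (p - j) (by omega) (by omega) (fun k h1 h2 => hz k h1 (by omega)) (by linarith) hab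
      (by linarith) hτ fun r hr1 hr2 => ?_
    exact ih j (by omega) hj.1 (fun k h1 h2 => hz k h1 (by omega)) hu ha hr1 (by linarith)
      fun r' h1 h2 => hy r' h1 (by linarith)

/-! ### Controlled functions of the upper variable -/

/-- `y` is bounded by `Y` on `[u,t]`, and its increment over `[q,r]` by `Y (r-q)/(r-u)`. -/
structure Controlled (u t : ℝ) (y : ℝ → A) (Y : ℝ) : Prop where
  norm_le : ∀ r, u ≤ r → r ≤ t → ‖y r‖ ≤ Y
  norm_sub_le : ∀ q r, u ≤ q → q ≤ r → r ≤ t → ‖y r - y q‖ ≤ Y * ((r - q) / (r - u))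

lemma Controlled.nonneg {u t : ℝ} {y : ℝ → A} {Y : ℝ} (h : Controlled u t y Y) (hut : u ≤ t) :
    0 ≤ Y := (norm_nonneg _).trans (h.norm_le u le_rfl hut)

lemma ratio_nonneg {q r u : ℝ} (hu : u ≤ q) (hq : q ≤ r) : 0 ≤ (r - q) / (r - u) :=
  div_nonneg (by linarith) (by linarith)

lemma ratio_mono {q r u a : ℝ} (hua : u ≤ a) (ha : a ≤ q) (hq : q ≤ r) :
    (r - q) / (r - u) ≤ (r - q) / (r - a) := by
  rcases (ha.trans hq).eq_or_lt with rfl | h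
  · obtain rfl : a = q := le_antisymm ha hq
    simp
  · exact div_le_div_of_nonneg_left (by linarith) (by linarith) (by linarith)

lemma ratio_mono_right {a r c u : ℝ} (hua : u ≤ a) (har : a ≤ r) (hrc : r ≤ c) :
    (r - a) / (r - u) ≤ (c - a) / (c - u) := by
  rcases (hua.trans har).eq_or_lt with rfl | h
  · simpa using div_nonneg (show 0 ≤ c - a by linarith) (show 0 ≤ c - u by linarith)
  · rw [div_le_div_iff₀ (by linarith) (by linarith)]
    nlinarith

/-- The ratio `(r-q)/(r-u)` grows as `u` moves to the right, so the same constant serves on every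
subinterval. -/
lemma Controlled.mono {u t a b : ℝ} {y : ℝ → A} {Y : ℝ} (h : Controlled u t y Y) (hua : u ≤ a)
    (hab : a ≤ b) (hbt : b ≤ t) : Controlled a b y Y := by
  have hY := h.nonneg ((hua.trans hab).trans hbt)
  refine ⟨fun r h1 h2 => h.norm_le r (by linarith) (by linarith), fun q r h1 h2 h3 => ?_⟩
  exact (h.norm_sub_le q r (by linarith) h2 (by linarith)).trans
    (mul_le_mul_of_nonneg_left (ratio_mono hua h1 h2) hY)

lemma Controlled.add {u t : ℝ} {y y' : ℝ → A} {Y Y' : ℝ} (h : Controlled u t y Y)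
    (h' : Controlled u t y' Y') : Controlled u t (fun r => y r + y' r) (Y + Y') := by
  refine ⟨fun r h1 h2 => (norm_add_le _ _).trans
    (add_le_add (h.norm_le r h1 h2) (h'.norm_le r h1 h2)), fun q r h1 h2 h3 => ?_⟩
  rw [add_sub_add_comm, add_mul]
  exact (norm_add_le _ _).trans
    (add_le_add (h.norm_sub_le q r h1 h2 h3) (h'.norm_sub_le q r h1 h2 h3))

lemma Controlled.mul_const {u t : ℝ} {y : ℝ → A} {Y : ℝ} (h : Controlled u t y Y) (w : A) :
    Controlled u t (fun r => y r * w) (Y * ‖w‖) := by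
  refine ⟨fun r h1 h2 => (norm_mul_le _ _).trans
    (mul_le_mul_of_nonneg_right (h.norm_le r h1 h2) (norm_nonneg _)), fun q r h1 h2 h3 => ?_⟩
  rw [← sub_mul, mul_right_comm]
  exact (norm_mul_le _ _).trans
    (mul_le_mul_of_nonneg_right (h.norm_sub_le q r h1 h2 h3) (norm_nonneg _))

lemma controlled_const (u t : ℝ) (w : A) : Controlled u t (fun _ => w) ‖w‖ :=
  ⟨fun _ _ _ => le_rfl, fun q r h1 h2 _ => by
    simpa using mul_nonneg (norm_nonneg w) (ratio_nonneg h1 h2)⟩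

lemma Controlled.sum {ι : Type*} {u t : ℝ} {y : ι → ℝ → A} (S : Finset ι)
    (h : ∀ i ∈ S, ∃ Y, Controlled u t (y i) Y) :
    ∃ Y, Controlled u t (fun r => ∑ i ∈ S, y i r) Y := by
  classical
  induction S using Finset.induction_on with
  | empty => exact ⟨_, by simpa using controlled_const u t (0 : A)⟩
  | insert i S hi ih =>
    obtain ⟨Y, hY⟩ := h i (Finset.mem_insert_self i S)
    obtain ⟨Y', hY'⟩ := ih fun j hj => h j (Finset.mem_insert_of_mem hj)
    exact ⟨Y + Y', by simpa only [Finset.sum_insert hi] using hY.add hY'⟩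

lemma Controlled.congr {u t : ℝ} {y y' : ℝ → A} {Y : ℝ} (h : Controlled u t y Y)
    (hy : ∀ r, u ≤ r → r ≤ t → y r = y' r) : Controlled u t y' Y := by
  refine ⟨fun r h1 h2 => hy r h1 h2 ▸ h.norm_le r h1 h2, fun q r h1 h2 h3 => ?_⟩
  rw [← hy r (by linarith) h3, ← hy q h1 (by linarith)]
  exact h.norm_sub_le q r h1 h2 h3

/-- Away from the singularity the oscillation of a controlled function is small. -/
lemma Controlled.sub_left {u t a c : ℝ} {y : ℝ → A} {Y : ℝ} (h : Controlled u t y Y) (hua : u ≤ a)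
    (hac : a ≤ c) (hct : c ≤ t) :
    Controlled a c (fun r => y r - y a) (Y * ((c - a) / (c - u))) := by
  have hY := h.nonneg ((hua.trans hac).trans hct)
  refine ⟨fun r h1 h2 => ?_, fun q r h1 h2 h3 => ?_⟩
  · exact (h.norm_sub_le a r hua h1 (by linarith)).trans
      (mul_le_mul_of_nonneg_left (ratio_mono_right hua h1 h2) hY)
  · rw [sub_sub_sub_cancel_right]
    refine (h.norm_sub_le q r (by linarith) h2 (by linarith)).trans ?_
    rw [mul_assoc]
    refine mul_le_mul_of_nonneg_left ?_ hY
    -- The first factor increases with `r` and supplies the small constant `(c-a)/(c-u)`; the second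
    -- is the ratio based at `a`.
    have h4 : (r - q) / (r - u) = (r - a) / (r - u) * ((r - q) / (r - a)) := by
      rcases (h1.trans h2).eq_or_lt with rfl | h5
      · obtain rfl : a = q := le_antisymm h1 h2
        simp
      · have : r - a ≠ 0 := by linarith
        have : r - u ≠ 0 := by linarith
        field_simp
    rw [h4]
    exact mul_le_mul_of_nonneg_right (ratio_mono_right hua (h1.trans h2) h3) (ratio_nonneg h1 h2)

/-! ### The algebra of convolution products -/

/-- At level `p`, the convolution product with a controlled function is a genuine limit, it is
linear, it takes controlled functions to controlled functions, and it satisfies Chen's relation. -/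
structure ConvRegular (T : ℝ) (z : ℕ → ℝ → ℝ → ℝ → A) (p : ℕ) : Prop where
  exists_limit : ∀ {u t τ y Y}, 0 ≤ u → u ≤ t → t ≤ τ → τ ≤ T → Controlled u t y Y →
    ∃ L, IsMeshLimit u t (germ z p y u τ) L
  conv_add : ∀ {u t τ y y' Y Y'}, 0 ≤ u → u ≤ t → t ≤ τ → τ ≤ T → Controlled u t y Y →
    Controlled u t y' Y' →
    conv z p (fun r => y r + y' r) u t τ = conv z p y u t τ + conv z p y' u t τ
  conv_mul_const : ∀ {u t τ y Y} (w : A), 0 ≤ u → u ≤ t → t ≤ τ → τ ≤ T → Controlled u t y Y →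
    conv z p (fun r => y r * w) u t τ = conv z p y u t τ * w
  controlled : ∀ {u t b y Y}, 0 ≤ u → u ≤ t → t ≤ b → b ≤ T → Controlled u t y Y →
    ∃ Y', Controlled t b (conv z p y u t) Y'
  chen : ∀ {u v t τ y Y}, 0 ≤ u → u ≤ v → v ≤ t → t ≤ τ → τ ≤ T → Controlled u t y Y →
    conv z p y u t τ = conv z p y v t τ + conv z p y u v τ +
      ∑ i ∈ Finset.Ico 1 p, conv z (p - i) (conv z i y u v) v t τ

variable {T : ℝ} {z : ℕ → ℝ → ℝ → ℝ → A}

lemma ConvRegular.conv_zero {p : ℕ} (h : ConvRegular T z p) {u t τ : ℝ} (hu : 0 ≤ u)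
    (hut : u ≤ t) (ht : t ≤ τ) (hτ : τ ≤ T) : conv z p (fun _ => 0) u t τ = 0 := by
  simpa using h.conv_mul_const 0 hu hut ht hτ (controlled_const u t (0 : A))

lemma ConvRegular.conv_sub {p : ℕ} (hp : 1 ≤ p) (h : ConvRegular T z p) {u t τ Y Y' : ℝ}
    {y y' : ℝ → A} (hu : 0 ≤ u) (hut : u ≤ t) (ht : t ≤ τ) (hτ : τ ≤ T)
    (hy : Controlled u t y Y) (hy' : Controlled u t y' Y') :
    conv z p (fun r => y r - y' r) u t τ = conv z p y u t τ - conv z p y' u t τ := by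
  have hn := hy'.mul_const (-1)
  have := h.conv_add hu hut ht hτ hy hn
  rw [h.conv_mul_const (-1) hu hut ht hτ hy', mul_neg_one, ← sub_eq_add_neg] at this
  rw [← this]
  exact conv_congr_right z hp hu ht fun r _ _ => by simp [sub_eq_add_neg]

lemma ConvRegular.conv_sum {ι : Type*} {p : ℕ} (h : ConvRegular T z p) {u t τ : ℝ}
    (hu : 0 ≤ u) (hut : u ≤ t) (ht : t ≤ τ) (hτ : τ ≤ T) {y : ι → ℝ → A} (S : Finset ι)
    (hy : ∀ i ∈ S, ∃ Y, Controlled u t (y i) Y) :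
    conv z p (fun r => ∑ i ∈ S, y i r) u t τ = ∑ i ∈ S, conv z p (y i) u t τ := by
  classical
  induction S using Finset.induction_on with
  | empty => simpa using h.conv_zero hu hut ht hτ
  | insert i S hi ih =>
    obtain ⟨Y, hY⟩ := hy i (Finset.mem_insert_self i S)
    obtain ⟨Y', hY'⟩ := Controlled.sum S fun j hj => hy j (Finset.mem_insert_of_mem hj)
    have := h.conv_add hu hut ht hτ hY hY'
    simp only [Finset.sum_insert hi]
    rw [this, ih fun j hj => hy j (Finset.mem_insert_of_mem hj)]

/-- Both sides run over the positive `i, j` with `i + j < p`. This matches the double sum from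
Chen's relation for a family `Y` with the one from Chen's relation for the convolution product. -/
lemma sum_Ico_sum_Ico_comm (p : ℕ) (f : ℕ → ℕ → A) :
    ∑ k ∈ Finset.Ico 1 p, ∑ j ∈ Finset.Ico 1 k, f j (k - j) =
      ∑ j ∈ Finset.Ico 1 p, ∑ i ∈ Finset.Ico 1 (p - j), f j i := by
  rw [Finset.sum_sigma', Finset.sum_sigma']
  refine Finset.sum_bij' (fun x _ => ⟨x.2, x.1 - x.2⟩) (fun x _ => ⟨x.1 + x.2, x.1⟩) ?_ ?_ ?_ ?_ ?_
  · rintro ⟨k, j⟩ h; simp only [Finset.mem_sigma, Finset.mem_Ico] at h ⊢; omega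
  · rintro ⟨k, j⟩ h; simp only [Finset.mem_sigma, Finset.mem_Ico] at h ⊢; omega
  · rintro ⟨k, j⟩ h
    simp only [Finset.mem_sigma, Finset.mem_Ico] at h
    simp only [Sigma.mk.injEq, heq_eq_eq, and_true]
    omega
  · rintro ⟨k, j⟩ h; simp
  · rintro ⟨k, j⟩ h; rfl

/-- Change of base point: for a family `Y` satisfying Chen's relation, moving the base point of
`∑ z^{p-j}_{ba} ∗ Y^j_{as}` from `s` to `u` costs an exact increment. -/
lemma sum_conv_change_base {p : ℕ} (hreg : ∀ k, 1 ≤ k → k < p → ConvRegular T z k)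
    {Y : ℕ → ℝ → ℝ → ℝ → A} {s u a b τ : ℝ} (hs : 0 ≤ s) (hsu : s ≤ u) (hua : u ≤ a) (hab : a ≤ b)
    (hbτ : b ≤ τ) (hτ : τ ≤ T)
    (hchen : ∀ j, 1 ≤ j → j < p → ∀ r, a ≤ r → r ≤ b → Y j s a r = Y j u a r + Y j s u r +
      ∑ i ∈ Finset.Ico 1 j, conv z (j - i) (Y i s u) u a r)
    (hY₁ : ∀ j, 1 ≤ j → j < p → ∃ W, Controlled a b (Y j u a) W)
    (hY₂ : ∀ j, 1 ≤ j → j < p → ∃ W, Controlled u b (Y j s u) W) :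
    ∑ j ∈ Finset.Ico 1 p, conv z (p - j) (Y j s a) a b τ =
      ∑ j ∈ Finset.Ico 1 p, conv z (p - j) (Y j u a) a b τ +
        (∑ j ∈ Finset.Ico 1 p, conv z (p - j) (Y j s u) u b τ -
          ∑ j ∈ Finset.Ico 1 p, conv z (p - j) (Y j s u) u a τ) := by
  have hu : 0 ≤ u := hs.trans hsu
  have ha : 0 ≤ a := hu.trans hua
  have hin : ∀ j, 1 ≤ j → j < p → ∀ i ∈ Finset.Ico 1 j,
      ∃ W, Controlled a b (conv z (j - i) (Y i s u) u a) W := by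
    intro j hj1 hj2 i hi
    rw [Finset.mem_Ico] at hi
    obtain ⟨W, hW⟩ := hY₂ i hi.1 (by omega)
    exact (hreg (j - i) (by omega) (by omega)).controlled hu hua hab (by linarith)
      (hW.mono le_rfl hua hab)
  -- Chen's relation for `Y` is inserted in the upper variable and expanded by linearity.
  have h1 : ∀ j ∈ Finset.Ico 1 p, conv z (p - j) (Y j s a) a b τ =
      conv z (p - j) (Y j u a) a b τ + conv z (p - j) (Y j s u) a b τ +
        ∑ i ∈ Finset.Ico 1 j, conv z (p - j) (conv z (j - i) (Y i s u) u a) a b τ := by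
    intro j hj
    rw [Finset.mem_Ico] at hj
    obtain ⟨W, hW⟩ := hY₁ j hj.1 hj.2
    obtain ⟨W', hW'⟩ := hY₂ j hj.1 hj.2
    have hW' := hW'.mono hua hab le_rfl
    obtain ⟨W'', hW''⟩ := Controlled.sum _ (hin j hj.1 hj.2)
    have hr := hreg (p - j) (by omega) (by omega)
    rw [conv_congr_right z (by omega) ha hbτ (hchen j hj.1 hj.2),
      hr.conv_add ha hab hbτ hτ (hW.add hW') hW'', hr.conv_add ha hab hbτ hτ hW hW',
      hr.conv_sum ha hab hbτ hτ _ (hin j hj.1 hj.2)]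
  -- Chen's relation for the outer convolution over `u ≤ a ≤ b`. Its double sum is that of `h1`
  -- after reindexing, so the two cancel and leave an increment from `a` to `b`.
  have h2 : ∀ j ∈ Finset.Ico 1 p, conv z (p - j) (Y j s u) u b τ =
      conv z (p - j) (Y j s u) a b τ + conv z (p - j) (Y j s u) u a τ +
        ∑ i ∈ Finset.Ico 1 (p - j), conv z (p - j - i) (conv z i (Y j s u) u a) a b τ := by
    intro j hj
    rw [Finset.mem_Ico] at hj
    obtain ⟨W, hW⟩ := hY₂ j hj.1 hj.2
    exact (hreg (p - j) (by omega) (by omega)).chen hu hua hab hbτ hτ hW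
  have h3 := sum_Ico_sum_Ico_comm p
    fun j i => conv z (p - j - i) (conv z i (Y j s u) u a) a b τ
  have h4 : ∑ k ∈ Finset.Ico 1 p, ∑ j ∈ Finset.Ico 1 k,
      conv z (p - j - (k - j)) (conv z (k - j) (Y j s u) u a) a b τ =
      ∑ k ∈ Finset.Ico 1 p, ∑ j ∈ Finset.Ico 1 k,
        conv z (p - k) (conv z (k - j) (Y j s u) u a) a b τ := by
    refine Finset.sum_congr rfl fun k hk => Finset.sum_congr rfl fun j hj => ?_
    rw [Finset.mem_Ico] at hk hj
    rw [show p - j - (k - j) = p - k by omega]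
  rw [h4] at h3
  rw [Finset.sum_congr rfl h1, Finset.sum_congr rfl h2]
  simp only [Finset.sum_add_distrib]
  rw [h3]
  abel

/-- Chen's relation at level `p` for a family `Z` that is the mesh limit of germs with a common
`s`-independent part. -/
lemma chen_of_isMeshLimit {p : ℕ} (hreg : ∀ k, 1 ≤ k → k < p → ConvRegular T z k)
    {Y : ℕ → ℝ → ℝ → ℝ → A} {X : ℝ → ℝ → A} {s u t τ : ℝ} (hs : 0 ≤ s) (hsu : s ≤ u) (hut : u ≤ t)
    (htτ : t ≤ τ) (hτ : τ ≤ T)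
    (hchen : ∀ j, 1 ≤ j → j < p → ∀ a r, u ≤ a → a ≤ r → r ≤ t →
      Y j s a r = Y j u a r + Y j s u r + ∑ i ∈ Finset.Ico 1 j, conv z (j - i) (Y i s u) u a r)
    (hY₁ : ∀ j, 1 ≤ j → j < p → ∀ a, u ≤ a → a ≤ t → ∃ W, Controlled a t (Y j u a) W)
    (hY₂ : ∀ j, 1 ≤ j → j < p → ∃ W, Controlled u t (Y j s u) W) {L L₁ L₂ : A}
    (hL : IsMeshLimit s t
      (fun a b => X a b + ∑ j ∈ Finset.Ico 1 p, conv z (p - j) (Y j s a) a b τ) L)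
    (hL₁ : IsMeshLimit s u
      (fun a b => X a b + ∑ j ∈ Finset.Ico 1 p, conv z (p - j) (Y j s a) a b τ) L₁)
    (hL₂ : IsMeshLimit u t
      (fun a b => X a b + ∑ j ∈ Finset.Ico 1 p, conv z (p - j) (Y j u a) a b τ) L₂) :
    L = L₂ + L₁ + ∑ j ∈ Finset.Ico 1 p, conv z (p - j) (Y j s u) u t τ := by
  -- On `[u,t]` the germ based at `s` is the germ based at `u` plus an exact increment. Its mesh
  -- limit is thus `L₂` plus the total increment, and the limits over `[s,u]` and `[u,t]` add up to
  -- `L`.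
  have h := hL₂.add (isMeshLimit_increment u t
    fun a => ∑ j ∈ Finset.Ico 1 p, conv z (p - j) (Y j s u) u a τ)
  have h0 : ∑ j ∈ Finset.Ico 1 p, conv z (p - j) (Y j s u) u u τ = 0 :=
    Finset.sum_eq_zero fun j hj => conv_self z (by rw [Finset.mem_Ico] at hj; omega) _ _ _
  have h' := h.congr (F' := fun a b => X a b + ∑ j ∈ Finset.Ico 1 p, conv z (p - j) (Y j s a) a b τ)
    fun a b ha hab hb => by
      have := sum_conv_change_base hreg hs hsu ha hab (hb.trans htτ) hτ
        (fun j h1 h2 r hr1 hr2 => hchen j h1 h2 a r ha hr1 (hr2.trans hb))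
        (fun j h1 h2 => by
          obtain ⟨W, hW⟩ := hY₁ j h1 h2 a ha (hab.trans hb)
          exact ⟨W, hW.mono le_rfl hab hb⟩)
        (fun j h1 h2 => by
          obtain ⟨W, hW⟩ := hY₂ j h1 h2
          exact ⟨W, hW.mono le_rfl (ha.trans hab) hb⟩)
      rw [this]
      abel
  rw [h0, sub_zero] at h'
  rw [hL.eq_add hsu hut hL₁ h']
  abel

end ConvAlgebra

section Estimates

variable {A : Type*} [NormedRing A]

/-! ### Dyadic estimates -/

/-- The summands `(k+1) 2^{-kρ}` that control dyadic sums with one singular end point. -/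
noncomputable def dyadicTerm (ρ : ℝ) (k : ℕ) : ℝ := (k + 1) * ((2 : ℝ) ^ (-ρ)) ^ k

lemma dyadicTerm_nonneg (ρ : ℝ) (k : ℕ) : 0 ≤ dyadicTerm ρ k := by
  unfold dyadicTerm; positivity

lemma summable_dyadicTerm {ρ : ℝ} (hρ : 0 < ρ) : Summable (dyadicTerm ρ) := by
  have h1 : ‖(2 : ℝ) ^ (-ρ)‖ < 1 := by
    rw [Real.norm_of_nonneg (by positivity)]
    exact Real.rpow_lt_one_of_one_lt_of_neg one_lt_two (by linarith)
  have h2 := summable_pow_mul_geometric_of_norm_lt_one 1 h1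
  have h3 := summable_geometric_of_norm_lt_one h1
  refine (h2.add h3).congr fun k => ?_
  rw [dyadicTerm, pow_one]; ring

/-- The ratio `(d-a)/(d-u)` at the midpoint `d` of the `i`-th dyadic interval is `1/(2i+1)`. Each
doubling of the range adds `2^k` terms of size at most `2^{-k}`, whence the logarithmic growth. -/
lemma sum_one_div_odd_le (k : ℕ) :
    ∑ i ∈ Finset.range (2 ^ k), (1 : ℝ) / (2 * i + 1) ≤ k + 1 := by
  induction k with
  | zero => simp
  | succ k ih =>
    rw [pow_succ, mul_two, Finset.sum_range_add]
    have h : ∑ x ∈ Finset.range (2 ^ k), (1 : ℝ) / (2 * ((2 ^ k + x : ℕ) : ℝ) + 1) ≤ 1 := by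
      have hle : ∀ x ∈ Finset.range (2 ^ k),
          (1 : ℝ) / (2 * ((2 ^ k + x : ℕ) : ℝ) + 1) ≤ 1 / 2 ^ k := fun x _ => by
        refine one_div_le_one_div_of_le (by positivity) ?_
        push_cast
        have : (0 : ℝ) < 2 ^ k := by positivity
        have : (0 : ℝ) ≤ x := Nat.cast_nonneg x
        linarith
      refine (Finset.sum_le_sum hle).trans (le_of_eq ?_)
      rw [Finset.sum_const, Finset.card_range, nsmul_eq_mul]
      push_cast
      field_simp
    push_cast at h ⊢
    linarith

/-- The rate is weakened from `σ` to `ρ`, so that one and the same series serves all the exponents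
`pρ`. -/
lemma div_two_pow_rpow_le {x σ ρ : ℝ} (hx : 0 ≤ x) (hρσ : ρ ≤ σ) (k : ℕ) :
    (x / 2 ^ k) ^ σ ≤ x ^ σ * ((2 : ℝ) ^ (-ρ)) ^ k := by
  rw [Real.div_rpow hx (by positivity), div_eq_mul_inv]
  refine mul_le_mul_of_nonneg_left ?_ (by positivity)
  rw [← Real.rpow_neg (by positivity), ← Real.rpow_natCast 2 k, ← Real.rpow_natCast (2 ^ (-ρ)) k,
    ← Real.rpow_mul (by norm_num), ← Real.rpow_mul (by norm_num)]
  refine Real.rpow_le_rpow_of_exponent_le one_le_two ?_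
  have : (0 : ℝ) ≤ k := Nat.cast_nonneg k
  nlinarith

lemma dyadic_points {u t : ℝ} (hut : u ≤ t) {k i : ℕ} (hi : i < 2 ^ k) :
    u ≤ u + i * ((t - u) / 2 ^ k) ∧
    u + i * ((t - u) / 2 ^ k) ≤ u + (i + 1 / 2) * ((t - u) / 2 ^ k) ∧
    u + (i + 1 / 2) * ((t - u) / 2 ^ k) ≤ u + (i + 1) * ((t - u) / 2 ^ k) ∧
    u + (i + 1) * ((t - u) / 2 ^ k) ≤ t := by
  have h1 : 0 ≤ (t - u) / 2 ^ k := div_nonneg (by linarith) (by positivity)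
  have h2 : (0 : ℝ) ≤ i := Nat.cast_nonneg i
  have h3 : (i : ℝ) + 1 ≤ 2 ^ k := by exact_mod_cast hi
  refine ⟨by nlinarith, by nlinarith, by nlinarith, ?_⟩
  have : ((i : ℝ) + 1) * ((t - u) / 2 ^ k) ≤ 2 ^ k * ((t - u) / 2 ^ k) :=
    mul_le_mul_of_nonneg_right h3 h1
  have h4 : (2 : ℝ) ^ k * ((t - u) / 2 ^ k) = t - u := by field_simp
  linarith

/-- Dyadic approximation of a mesh limit whose germ is singular at the left end point. -/
lemma IsMeshLimit.norm_sub_dyadicSum_le_of_singular {u t V σ ρ : ℝ} (hut : u ≤ t) (hρ : 0 < ρ)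
    (hρσ : ρ ≤ σ) (hV : 0 ≤ V) {F : ℝ → ℝ → A} {L : A} (hL : IsMeshLimit u t F L)
    (h0 : F u u = 0)
    (hF : ∀ a c b, u ≤ a → a ≤ c → c ≤ b → b ≤ t → c - a = (b - a) / 2 → b - c = (b - a) / 2 →
      ‖F a b - F a c - F c b‖ ≤ V * (b - a) ^ σ * ((c - a) / (c - u))) (k : ℕ) :
    ‖L - dyadicSum F u t k‖ ≤ V * (t - u) ^ σ * ∑' j, dyadicTerm ρ (j + k) := by
  have htu : 0 ≤ t - u := sub_nonneg.2 hut
  rw [← tsum_mul_left]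
  refine hL.norm_sub_dyadicSum_le hut h0 (D := fun j => V * (t - u) ^ σ * dyadicTerm ρ j)
    ((summable_dyadicTerm hρ).mul_left _) (fun k => ?_) k
  have hstep : ∀ i ∈ Finset.range (2 ^ k), ‖dyadicDefect F u t k i‖ ≤
      V * (t - u) ^ σ * ((2 : ℝ) ^ (-ρ)) ^ k * (1 / (2 * i + 1)) := by
    intro i hi
    obtain ⟨h1, h2, h3, h4⟩ := dyadic_points hut (Finset.mem_range.1 hi)
    refine (hF _ _ _ h1 h2 h3 h4 (by ring) (by ring)).trans ?_
    have e1 : u + (i + 1) * ((t - u) / 2 ^ k) - (u + i * ((t - u) / 2 ^ k)) = (t - u) / 2 ^ k := by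
      ring
    have e2 : (u + (i + 1 / 2) * ((t - u) / 2 ^ k) - (u + i * ((t - u) / 2 ^ k))) /
        (u + (i + 1 / 2) * ((t - u) / 2 ^ k) - u) ≤ 1 / (2 * i + 1) := by
      rcases htu.eq_or_lt with h | h
      · rw [← h]; simp; positivity
      · have : (0 : ℝ) < (t - u) / 2 ^ k := by positivity
        apply le_of_eq
        have h5 : u + (i + 1 / 2) * ((t - u) / 2 ^ k) - u = (i + 1 / 2) * ((t - u) / 2 ^ k) := by
          ring
        have h6 : u + (i + 1 / 2) * ((t - u) / 2 ^ k) - (u + i * ((t - u) / 2 ^ k)) =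
          (1 / 2) * ((t - u) / 2 ^ k) := by ring
        rw [h5, h6, mul_div_mul_right _ _ this.ne']
        field_simp
    rw [e1, mul_assoc V ((t - u) ^ σ)]
    refine mul_le_mul (mul_le_mul_of_nonneg_left (div_two_pow_rpow_le htu hρσ k) hV) e2
      (div_nonneg (by linarith) (by linarith)) (by positivity)
  refine (Finset.sum_le_sum hstep).trans ?_
  rw [← Finset.mul_sum]
  calc V * (t - u) ^ σ * ((2 : ℝ) ^ (-ρ)) ^ k * ∑ i ∈ Finset.range (2 ^ k), (1 : ℝ) / (2 * i + 1)
      ≤ V * (t - u) ^ σ * ((2 : ℝ) ^ (-ρ)) ^ k * (k + 1) :=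
        mul_le_mul_of_nonneg_left (sum_one_div_odd_le k) (by positivity)
    _ = _ := by rw [dyadicTerm]; ring

/-- Dyadic approximation of a mesh limit whose germ has a defect of order at least `1 + σ`. -/
lemma IsMeshLimit.norm_sub_dyadicSum_le_of_regular {u t V σ ν : ℝ} (hut : u ≤ t) (hσ : 0 < σ)
    (hν : 1 + σ ≤ ν)
    (hV : 0 ≤ V) {F : ℝ → ℝ → A} {L : A} (hL : IsMeshLimit u t F L)
    (h0 : F u u = 0)
    (hF : ∀ a c b, u ≤ a → a ≤ c → c ≤ b → b ≤ t → c - a = (b - a) / 2 → b - c = (b - a) / 2 →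
      ‖F a b - F a c - F c b‖ ≤ V * (b - a) ^ ν) (k : ℕ) :
    ‖L - dyadicSum F u t k‖ ≤ V * (t - u) ^ ν * ∑' j, dyadicTerm σ (j + k) := by
  have htu : 0 ≤ t - u := sub_nonneg.2 hut
  rw [← tsum_mul_left]
  refine hL.norm_sub_dyadicSum_le hut h0 (D := fun j => V * (t - u) ^ ν * dyadicTerm σ j)
    ((summable_dyadicTerm hσ).mul_left _) (fun k => ?_) k
  have hstep : ∀ i ∈ Finset.range (2 ^ k), ‖dyadicDefect F u t k i‖ ≤
      V * ((t - u) ^ ν * ((2 : ℝ) ^ (-(1 + σ))) ^ k) := by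
    intro i hi
    obtain ⟨h1, h2, h3, h4⟩ := dyadic_points hut (Finset.mem_range.1 hi)
    refine (hF _ _ _ h1 h2 h3 h4 (by ring) (by ring)).trans ?_
    have e1 : u + (i + 1) * ((t - u) / 2 ^ k) - (u + i * ((t - u) / 2 ^ k)) = (t - u) / 2 ^ k := by
      ring
    rw [e1]
    exact mul_le_mul_of_nonneg_left (div_two_pow_rpow_le htu hν k) hV
  refine (Finset.sum_le_sum hstep).trans ?_
  rw [Finset.sum_const, Finset.card_range, nsmul_eq_mul]
  have h2 : ((2 ^ k : ℕ) : ℝ) * ((2 : ℝ) ^ (-(1 + σ))) ^ k = ((2 : ℝ) ^ (-σ)) ^ k := by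
    push_cast
    rw [← mul_pow]
    congr 1
    rw [neg_add, Real.rpow_add (by norm_num), Real.rpow_neg_one]
    ring
  calc ((2 ^ k : ℕ) : ℝ) * (V * ((t - u) ^ ν * ((2 : ℝ) ^ (-(1 + σ))) ^ k))
      = V * (t - u) ^ ν * (1 * ((2 : ℝ) ^ (-σ)) ^ k) := by rw [← h2]; ring
    -- The factor `k + 1` is given away to keep a single kind of series.
    _ ≤ V * (t - u) ^ ν * ((k + 1) * ((2 : ℝ) ^ (-σ)) ^ k) := by
        refine mul_le_mul_of_nonneg_left ?_ (by positivity)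
        refine mul_le_mul_of_nonneg_right ?_ (by positivity)
        have : (0 : ℝ) ≤ k := Nat.cast_nonneg k
        linarith

/-! ### Weights -/

/-- `((t-s)/(θ-s))^γ`, which turns `(t-s)^{mρ}` into `(t-s)^{mρ+γ} (θ-s)^{-γ}`. -/
noncomputable def ratioPow (γ s t θ : ℝ) : ℝ := ((t - s) / (θ - s)) ^ γ

lemma ratioPow_nonneg {γ s t θ : ℝ} (hst : s ≤ t) (htθ : t ≤ θ) : 0 ≤ ratioPow γ s t θ :=
  Real.rpow_nonneg (div_nonneg (by linarith) (by linarith)) _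

/-- The base is `1 - (θ-t)/(θ-s)`, and shrinking the interval to `[c,b]` enlarges the subtracted
quotient. All the subintervals of a partition thus share the weight of the whole interval. -/
lemma ratioPow_mono {γ s t θ c b : ℝ} (hγ : 0 ≤ γ) (hsc : s ≤ c) (hcb : c ≤ b) (hbt : b ≤ t)
    (htθ : t ≤ θ) : ratioPow γ c b θ ≤ ratioPow γ s t θ := by
  refine Real.rpow_le_rpow (div_nonneg (by linarith) (by linarith)) ?_ hγ
  rcases ((hcb.trans hbt).trans htθ).eq_or_lt with rfl | h
  · simpa using div_nonneg (show 0 ≤ t - s by linarith) (show 0 ≤ c - s by linarith)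
  · rw [div_le_div_iff₀ (by linarith) (by linarith)]
    nlinarith [mul_nonneg (sub_nonneg.2 hsc) (sub_nonneg.2 htθ),
      mul_nonneg (sub_nonneg.2 hbt) (show 0 ≤ θ - s by linarith)]

lemma ratioPow_le_one {γ s t θ : ℝ} (hγ : 0 ≤ γ) (hst : s ≤ t) (htθ : t ≤ θ) :
    ratioPow γ s t θ ≤ 1 :=
  Real.rpow_le_one (div_nonneg (by linarith) (by linarith))
    (div_le_one_of_le₀ (by linarith) (by linarith)) hγ

/-- The estimates and Chen's relation for the levels `1, …, L` of `z`. -/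
structure LevelBounds (T ρ γ : ℝ) (c : ℕ → ℝ) (L : ℕ) (z : ℕ → ℝ → ℝ → ℝ → A) : Prop where
  bound : ∀ {p}, 1 ≤ p → p ≤ L → ∀ {s t τ}, 0 ≤ s → s ≤ t → t ≤ τ → τ ≤ T →
    ‖z p s t τ‖ ≤ c p * (t - s) ^ (p * ρ) * ratioPow γ s t τ
  incr : ∀ {p}, 1 ≤ p → p ≤ L → ∀ {s t q τ}, 0 ≤ s → s ≤ t → t ≤ q → q ≤ τ → τ ≤ T →
    ‖z p s t τ - z p s t q‖ ≤ c p * (t - s) ^ (p * ρ) * ((τ - q) / (τ - t) * ratioPow γ s t q)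
  chen : ∀ {p}, 1 ≤ p → p ≤ L → ∀ {s u t τ}, 0 ≤ s → s ≤ u → u ≤ t → t ≤ τ → τ ≤ T →
    z p s t τ = z p u t τ + z p s u τ + ∑ i ∈ Finset.Ico 1 p, conv z (p - i) (z i s u) u t τ

/-- The estimates for the convolution product with `z^p`. -/
structure ConvBounds (T ρ γ B : ℝ) (c : ℕ → ℝ) (z : ℕ → ℝ → ℝ → ℝ → A) (p : ℕ) : Prop where
  bound : ∀ {u t τ y Y}, 0 ≤ u → u ≤ t → t ≤ τ → τ ≤ T → Controlled u t y Y →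
    ‖conv z p y u t τ‖ ≤ B * c p * Y * (t - u) ^ (p * ρ) * ratioPow γ u t τ
  incr : ∀ {u t q τ y Y}, 0 ≤ u → u ≤ t → t ≤ q → q ≤ τ → τ ≤ T → Controlled u t y Y →
    ‖conv z p y u t τ - conv z p y u t q‖ ≤
      B * c p * Y * (t - u) ^ (p * ρ) * ((τ - q) / (τ - t) * ratioPow γ u t q)

/-- The conditions on the constants under which the estimates propagate. -/
structure Admissible (ρ γ β B : ℝ) (c : ℕ → ℝ) : Prop where
  rho_pos : 0 < ρ
  gamma_pos : 0 < γ
  c_nonneg : ∀ p, 0 ≤ c p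
  sum_le : ∀ p, 1 ≤ p → ∑ i ∈ Finset.Ico 1 p, c i * c (p - i) ≤ β * 2 ^ (p * ρ) * c p
  le_B : 1 + 2 * ∑' k, dyadicTerm ρ k ≤ B
  mul_le_one : B ^ 2 * β ≤ 1

lemma controlled_of_bounds {γ t b Q : ℝ} (hγ : 0 ≤ γ) (hQ : 0 ≤ Q) {s : ℝ} (hst : s ≤ t)
    {f : ℝ → A} (h1 : ∀ r, t ≤ r → r ≤ b → ‖f r‖ ≤ Q * ratioPow γ s t r)
    (h2 : ∀ q r, t ≤ q → q ≤ r → r ≤ b →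
      ‖f r - f q‖ ≤ Q * ((r - q) / (r - t) * ratioPow γ s t q)) : Controlled t b f Q := by
  refine ⟨fun r hr hb => (h1 r hr hb).trans ?_, fun q r hq hr hb => (h2 q r hq hr hb).trans ?_⟩
  · exact mul_le_of_le_one_right hQ (ratioPow_le_one hγ hst hr)
  · exact mul_le_mul_of_nonneg_left
      (mul_le_of_le_one_right (ratio_nonneg hq hr) (ratioPow_le_one hγ hst hq)) hQ

variable {T ρ γ β B : ℝ} {c : ℕ → ℝ} {L : ℕ} {z : ℕ → ℝ → ℝ → ℝ → A}

lemma LevelBounds.controlled (h : LevelBounds T ρ γ c L z) (hc : Admissible ρ γ β B c)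
    {p : ℕ} (hp : 1 ≤ p) (hpL : p ≤ L) {s t b : ℝ} (hs : 0 ≤ s) (hst : s ≤ t) (hb : b ≤ T) :
    Controlled t b (z p s t) (c p * (t - s) ^ (p * ρ)) :=
  controlled_of_bounds hc.gamma_pos.le
    (mul_nonneg (hc.c_nonneg p) (Real.rpow_nonneg (by linarith) _)) hst
    (fun _ h1 h2 => h.bound hp hpL hs hst h1 (h2.trans hb))
    (fun _ _ h1 h2 h3 => h.incr hp hpL hs hst h1 h2 (h3.trans hb))

lemma LevelBounds.self (h : LevelBounds T ρ γ c L z) (hc : Admissible ρ γ β B c)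
    {p : ℕ} (hp : 1 ≤ p) (hpL : p ≤ L) {s τ : ℝ} (hs : 0 ≤ s) (hst : s ≤ τ) (hτ : τ ≤ T) :
    z p s s τ = 0 := by
  have h1 := h.bound hp hpL hs le_rfl hst hτ
  have hp' : (0 : ℝ) < p := by exact_mod_cast hp
  rw [sub_self, Real.zero_rpow (mul_pos hp' hc.rho_pos).ne', mul_zero, zero_mul] at h1
  exact norm_le_zero_iff.1 h1

lemma ConvBounds.controlled {p : ℕ} (h : ConvBounds T ρ γ B c z p) (hc : Admissible ρ γ β B c)
    (hB : 0 ≤ B) {u t b Y : ℝ} {y : ℝ → A} (hu : 0 ≤ u) (hut : u ≤ t) (hb : b ≤ T)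
    (hy : Controlled u t y Y) :
    Controlled t b (conv z p y u t) (B * c p * Y * (t - u) ^ (p * ρ)) :=
  controlled_of_bounds hc.gamma_pos.le
    (mul_nonneg (mul_nonneg (mul_nonneg hB (hc.c_nonneg p)) (hy.nonneg hut))
      (Real.rpow_nonneg (by linarith) _)) hut
    (fun _ h1 h2 => h.bound hu hut h1 (h2.trans hb) hy)
    (fun _ _ h1 h2 h3 => h.incr hu hut h1 h2 (h3.trans hb) hy)

lemma Admissible.B_nonneg (hc : Admissible ρ γ β B c) : 0 ≤ B := by
  have := hc.le_B
  have h2 : 0 ≤ ∑' k, dyadicTerm ρ k := tsum_nonneg fun k => dyadicTerm_nonneg ρ k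
  linarith

/-! ### The defect of the convolution germ -/

/-- `z^p ∗ w = z^p w` for a constant `w`. -/
lemma conv_const (h : LevelBounds T ρ γ c L z) (hc : Admissible ρ γ β B c) {p : ℕ} (hp : 1 ≤ p)
    (hpL : p ≤ L) (hreg : ∀ k, 1 ≤ k → k < p → ConvRegular T z k) {u t τ : ℝ} (hu : 0 ≤ u)
    (hut : u ≤ t) (ht : t ≤ τ) (hτ : τ ≤ T) (w : A) :
    conv z p (fun _ => w) u t τ = z p u t τ * w := by
  induction p using Nat.strong_induction_on generalizing u t τ with
  | _ p ih =>
    -- For a constant `w`, Chen's relation identifies the germ with the exact increment of `a ↦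
    -- z^p_{au} w`.
    have h1 := isMeshLimit_increment u t fun a => z p u a τ * w
    rw [h.self hc hp hpL hu (hut.trans ht) hτ, zero_mul, sub_zero] at h1
    rw [conv_eq_meshLimit z hp]
    refine (h1.congr fun a b ha hab hb => ?_).meshLimit_eq hut
    rw [germ, h.chen hp hpL hu ha hab (hb.trans ht) hτ, add_mul, add_mul, Finset.sum_mul,
      add_sub_right_comm, add_sub_cancel_right]
    congr 1
    refine Finset.sum_congr rfl fun j hj => ?_
    rw [Finset.mem_Ico] at hj
    rw [← (hreg (p - j) (by omega) (by omega)).conv_mul_const w (hu.trans ha) hab (hb.trans ht) hτ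
      (h.controlled hc hj.1 (by omega) hu ha ((hb.trans ht).trans hτ))]
    refine conv_congr_right z (by omega) (hu.trans ha) (hb.trans ht) fun r hr1 hr2 => ?_
    exact (ih j (by omega) hj.1 (by omega) (fun k h1 h2 => hreg k h1 (by omega)) hu ha hr1
      (by linarith)).symm

/-- Moving the base point of the inner sum on `[d,b]` from `u` to `a` produces an exact increment,
which drops out of the defect. What is left vanishes for the constant `y(a)`, by Chen's relation for
`z^p` and `conv_const`, so only `y - y(a)` on `[a,d]` survives. Its smallness is what makes the germ
sewable. -/
lemma germ_defect (h : LevelBounds T ρ γ c L z) (hc : Admissible ρ γ β B c) {p : ℕ} (hp : 1 ≤ p)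
    (hpL : p ≤ L) (hreg : ∀ k, 1 ≤ k → k < p → ConvRegular T z k) {u t τ Y : ℝ} {y : ℝ → A}
    (hu : 0 ≤ u) (ht : t ≤ τ) (hτ : τ ≤ T) (hy : Controlled u t y Y) {a d b : ℝ} (hua : u ≤ a)
    (had : a ≤ d) (hdb : d ≤ b) (hbt : b ≤ t) :
    germ z p y u τ a b - germ z p y u τ a d - germ z p y u τ d b =
      -(z p d b τ * (y d - y a) + ∑ i ∈ Finset.Ico 1 p,
        conv z (p - i) (conv z i (fun r => y r - y a) a d) d b τ) := by
  have ha : 0 ≤ a := hu.trans hua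
  have hd : 0 ≤ d := ha.trans had
  have hbτ : b ≤ τ := hbt.trans ht
  have hyad := hy.mono hua had (hdb.trans hbt)
  have h1 := sum_conv_change_base (p := p) hreg (Y := fun j s a r => conv z j y s a r) hu hua had
    hdb hbτ hτ
    (fun j hj1 hj2 r hr1 hr2 => (hreg j hj1 hj2).chen hu hua had hr1 (by linarith)
      (hy.mono le_rfl (hua.trans had) (by linarith)))
    (fun j hj1 hj2 => (hreg j hj1 hj2).controlled ha had hdb (by linarith) hyad)
    (fun j hj1 hj2 => (hreg j hj1 hj2).controlled hu hua (had.trans hdb) (by linarith)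
      (hy.mono le_rfl hua (by linarith)))
  have h2 : ∀ i ∈ Finset.Ico 1 p,
      conv z (p - i) (conv z i (fun r => y r - y a) a d) d b τ =
        conv z (p - i) (conv z i y a d) d b τ - conv z (p - i) (z i a d) d b τ * y a := by
    intro i hi
    rw [Finset.mem_Ico] at hi
    have hr := hreg (p - i) (by omega) (by omega)
    have hri := hreg i hi.1 hi.2
    obtain ⟨W, hW⟩ := hri.controlled ha had hdb (show b ≤ T by linarith) hyad
    have hz := h.controlled hc hi.1 (by omega) ha had (show b ≤ T by linarith)
    rw [← hr.conv_mul_const (y a) hd hdb hbτ hτ hz,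
      ← hr.conv_sub (by omega) hd hdb hbτ hτ hW (hz.mul_const (y a))]
    refine conv_congr_right z (by omega) hd hbτ fun r hr1 hr2 => ?_
    rw [hri.conv_sub hi.1 ha had hr1 (by linarith) hyad (controlled_const a d (y a)),
      conv_const h hc hi.1 (by omega) (fun k h1 h2 => hreg k h1 (by omega)) ha had hr1
        (by linarith)]
  rw [Finset.sum_congr rfl h2, Finset.sum_sub_distrib, ← Finset.sum_mul]
  have h3 := h.chen hp hpL ha had hdb hbτ hτ
  have h4 : ∑ i ∈ Finset.Ico 1 p, conv z (p - i) (z i a d) d b τ =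
      z p a b τ - z p d b τ - z p a d τ := by rw [h3]; abel
  rw [h4]
  simp only [germ]
  rw [h1]
  noncomm_ring

end Estimates

section Induction

variable {A : Type*} [NormedRing A]
variable {T ρ γ β B : ℝ} {c : ℕ → ℝ} {L : ℕ} {z : ℕ → ℝ → ℝ → ℝ → A}

/-! ### Propagation of the estimates through the convolution product -/

lemma rpow_mul_rpow_level {p i : ℕ} (hi : i ≤ p) (hρ : 0 ≤ ρ) {d : ℝ} (hd : 0 ≤ d) :
    d ^ (i * ρ) * d ^ (((p - i : ℕ) : ℝ) * ρ) = d ^ (p * ρ) := by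
  rw [← Real.rpow_add_of_nonneg hd (by positivity) (by positivity), Nat.cast_sub hi]
  congr 1
  ring

/-- The weight `ω` is left free: it is `ratioPow` for the values and `(τ-q)/(τ-t)` times `ratioPow`
for the increments in the upper variable. -/
lemma norm_defect_le (hc : ∀ p, 0 ≤ c p) {p : ℕ} {zz dy : A} {cc : ℕ → A} {Ya ω d₁ d₂ : ℝ}
    (hω : 0 ≤ ω) (hd₂ : 0 ≤ d₂)
    (hzz : ‖zz‖ ≤ c p * d₂ ^ (p * ρ) * ω) (hdy : ‖dy‖ ≤ Ya)
    (hcc : ∀ i ∈ Finset.Ico 1 p, ‖cc i‖ ≤ B * c (p - i) * (B * c i * Ya * d₁ ^ (i * ρ)) *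
      d₂ ^ (((p - i : ℕ) : ℝ) * ρ) * ω) :
    ‖-(zz * dy + ∑ i ∈ Finset.Ico 1 p, cc i)‖ ≤ Ya * ω * (c p * d₂ ^ (p * ρ) +
      B ^ 2 * ∑ i ∈ Finset.Ico 1 p,
        c i * c (p - i) * (d₁ ^ (i * ρ) * d₂ ^ (((p - i : ℕ) : ℝ) * ρ))) := by
  rw [norm_neg]
  refine (norm_add_le _ _).trans ?_
  rw [mul_add]
  refine add_le_add ?_ ?_
  · refine (norm_mul_le _ _).trans ?_
    refine (mul_le_mul hzz hdy (norm_nonneg _) ?_).trans (le_of_eq (by ring))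
    have := hc p
    positivity
  · refine (norm_sum_le _ _).trans ((Finset.sum_le_sum hcc).trans (le_of_eq ?_))
    rw [Finset.mul_sum, Finset.mul_sum]
    exact Finset.sum_congr rfl fun i _ => by ring

/-- At a midpoint the powers combine to `(h/2)^{pρ}`, and the gain `2^{-pρ}` cancels the loss
`2^{pρ}` in `Admissible.sum_le`. The sum then costs `B² β c_p ≤ c_p`, no more than the leading term.
This is why the constants are estimated along dyadic partitions. -/
lemma defect_midpoint_le (hc : Admissible ρ γ β B c) {p : ℕ} (hp : 1 ≤ p) {h : ℝ} (hh : 0 ≤ h) :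
    c p * (h / 2) ^ (p * ρ) + B ^ 2 * ∑ i ∈ Finset.Ico 1 p,
      c i * c (p - i) * ((h / 2) ^ (i * ρ) * (h / 2) ^ (((p - i : ℕ) : ℝ) * ρ)) ≤
      2 * c p * h ^ (p * ρ) := by
  have hρ := hc.rho_pos
  have hh2 : 0 ≤ h / 2 := by positivity
  have e1 : ∑ i ∈ Finset.Ico 1 p,
      c i * c (p - i) * ((h / 2) ^ (i * ρ) * (h / 2) ^ (((p - i : ℕ) : ℝ) * ρ)) =
      (∑ i ∈ Finset.Ico 1 p, c i * c (p - i)) * (h / 2) ^ (p * ρ) := by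
    rw [Finset.sum_mul]
    refine Finset.sum_congr rfl fun i hi => ?_
    rw [rpow_mul_rpow_level (by rw [Finset.mem_Ico] at hi; omega) hρ.le hh2]
  have e2 : (2 : ℝ) ^ (p * ρ) * (h / 2) ^ (p * ρ) = h ^ (p * ρ) := by
    rw [← Real.mul_rpow (by norm_num) hh2]
    congr 1
    ring
  have e3 : (h / 2) ^ (p * ρ) ≤ h ^ (p * ρ) :=
    Real.rpow_le_rpow hh2 (by linarith) (by positivity)
  have hcp := hc.c_nonneg p
  rw [e1]
  have e4 : (∑ i ∈ Finset.Ico 1 p, c i * c (p - i)) * (h / 2) ^ (p * ρ) ≤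
      β * c p * h ^ (p * ρ) := by
    refine (mul_le_mul_of_nonneg_right (hc.sum_le p hp) (by positivity)).trans (le_of_eq ?_)
    rw [← e2]; ring
  calc c p * (h / 2) ^ (p * ρ) + B ^ 2 *
        ((∑ i ∈ Finset.Ico 1 p, c i * c (p - i)) * (h / 2) ^ (p * ρ))
      ≤ c p * h ^ (p * ρ) + B ^ 2 * (β * c p * h ^ (p * ρ)) := by gcongr
    _ = c p * h ^ (p * ρ) + (B ^ 2 * β) * (c p * h ^ (p * ρ)) := by ring
    _ ≤ c p * h ^ (p * ρ) + 1 * (c p * h ^ (p * ρ)) := by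
        have := hc.mul_le_one
        gcongr
    _ = _ := by ring

/-- The version for arbitrary cut points. The constant is not sharp, which is harmless because it
serves only the existence of the limit. -/
lemma defect_le (hc : ∀ p, 0 ≤ c p) (hρ : 0 ≤ ρ) {p : ℕ} {d₁ d₂ h : ℝ} (hd₁ : 0 ≤ d₁)
    (hd₂ : 0 ≤ d₂) (h1 : d₁ ≤ h) (h2 : d₂ ≤ h) :
    c p * d₂ ^ (p * ρ) + B ^ 2 * ∑ i ∈ Finset.Ico 1 p,
      c i * c (p - i) * (d₁ ^ (i * ρ) * d₂ ^ (((p - i : ℕ) : ℝ) * ρ)) ≤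
      (c p + B ^ 2 * ∑ i ∈ Finset.Ico 1 p, c i * c (p - i)) * h ^ (p * ρ) := by
  have hh : 0 ≤ h := hd₁.trans h1
  have hcp := hc p
  have e : ∑ i ∈ Finset.Ico 1 p,
      c i * c (p - i) * (d₁ ^ (i * ρ) * d₂ ^ (((p - i : ℕ) : ℝ) * ρ)) ≤
      (∑ i ∈ Finset.Ico 1 p, c i * c (p - i)) * h ^ (p * ρ) := by
    rw [Finset.sum_mul]
    refine Finset.sum_le_sum fun i hi => ?_
    rw [← rpow_mul_rpow_level (by rw [Finset.mem_Ico] at hi; omega : i ≤ p) hρ hh]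
    have := hc i
    have := hc (p - i)
    gcongr
  rw [add_mul, mul_assoc (B ^ 2)]
  gcongr

/-- The inner factors `z^j_{uu} ∗ y` vanish. This gives the zeroth dyadic sum, from which the limit
is estimated. -/
lemma germ_left {p : ℕ} (hreg : ∀ k, 1 ≤ k → k < p → ConvRegular T z k)
    {u t τ : ℝ} {y : ℝ → A} (hu : 0 ≤ u) (hut : u ≤ t) (ht : t ≤ τ) (hτ : τ ≤ T) :
    germ z p y u τ u t = z p u t τ * y u := by
  rw [germ, Finset.sum_eq_zero, add_zero]
  intro j hj
  rw [Finset.mem_Ico] at hj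
  rw [conv_congr_right z (by omega) hu ht fun r _ _ => conv_self z hj.1 y u r]
  exact (hreg (p - j) (by omega) (by omega)).conv_zero hu hut ht hτ

lemma norm_germ_defect_le (hz : LevelBounds T ρ γ c L z) (hc : Admissible ρ γ β B c)
    {p : ℕ} (hp : 1 ≤ p)
    (hpL : p ≤ L) (hreg : ∀ k, 1 ≤ k → k < p → ConvRegular T z k)
    (hbd : ∀ k, 1 ≤ k → k < p → ConvBounds T ρ γ B c z k) {u t τ Y : ℝ} {y : ℝ → A}
    (hu : 0 ≤ u) (ht : t ≤ τ) (hτ : τ ≤ T) (hy : Controlled u t y Y) {a d b : ℝ} (hua : u ≤ a)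
    (had : a ≤ d) (hdb : d ≤ b) (hbt : b ≤ t) :
    ‖germ z p y u τ a b - germ z p y u τ a d - germ z p y u τ d b‖ ≤
      Y * ((d - a) / (d - u)) * ratioPow γ u t τ * (c p * (b - d) ^ (p * ρ) +
      B ^ 2 * ∑ i ∈ Finset.Ico 1 p,
        c i * c (p - i) * ((d - a) ^ (i * ρ) * (b - d) ^ (((p - i : ℕ) : ℝ) * ρ))) := by
  have hu' := hua.trans had
  have hmono : ratioPow γ d b τ ≤ ratioPow γ u t τ :=
    ratioPow_mono hc.gamma_pos.le hu' hdb hbt ht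
  have hB := hc.B_nonneg
  have hbd0 : 0 ≤ b - d := sub_nonneg.2 hdb
  have hcn := hc.c_nonneg
  have hys := hy.sub_left hua had (hdb.trans hbt)
  have hYa := hys.nonneg had
  have hda0 : 0 ≤ d - a := sub_nonneg.2 had
  rw [germ_defect hz hc hp hpL hreg hu ht hτ hy hua had hdb hbt]
  refine norm_defect_le hcn
    (ratioPow_nonneg ((hu'.trans hdb).trans hbt) ht) hbd0 ?_ (hys.norm_le d had le_rfl) ?_
  · refine (hz.bound hp hpL (hu.trans hu') hdb (hbt.trans ht) hτ).trans ?_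
    have := hcn p
    gcongr
  · intro i hi
    rw [Finset.mem_Ico] at hi
    have h1 := (hbd i hi.1 hi.2).controlled hc hB (hu.trans hua) had (show b ≤ T by linarith) hys
    refine ((hbd (p - i) (by omega) (by omega)).bound (hu.trans hu') hdb (hbt.trans ht) hτ
      h1).trans ?_
    have := hcn i
    have := hcn (p - i)
    gcongr

/-- In the defect the upper variable enters only through the outermost factors on `[d,b]`, so their
increment bounds replace their size bounds. The ratio `(τ-q)/(τ-b)` that results is at most
`(τ-q)/(τ-t)`. -/
lemma norm_germ_sub_defect_le (hz : LevelBounds T ρ γ c L z) (hc : Admissible ρ γ β B c)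
    {p : ℕ} (hp : 1 ≤ p)
    (hpL : p ≤ L) (hreg : ∀ k, 1 ≤ k → k < p → ConvRegular T z k)
    (hbd : ∀ k, 1 ≤ k → k < p → ConvBounds T ρ γ B c z k) {u t q τ Y : ℝ} {y : ℝ → A}
    (hu : 0 ≤ u) (ht : t ≤ q) (hq : q ≤ τ) (hτ : τ ≤ T) (hy : Controlled u t y Y) {a d b : ℝ}
    (hua : u ≤ a) (had : a ≤ d) (hdb : d ≤ b) (hbt : b ≤ t) :
    ‖(germ z p y u τ a b - germ z p y u q a b) - (germ z p y u τ a d - germ z p y u q a d) -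
      (germ z p y u τ d b - germ z p y u q d b)‖ ≤
      Y * ((d - a) / (d - u)) * ((τ - q) / (τ - t) * ratioPow γ u t q) *
      (c p * (b - d) ^ (p * ρ) + B ^ 2 * ∑ i ∈ Finset.Ico 1 p,
        c i * c (p - i) * ((d - a) ^ (i * ρ) * (b - d) ^ (((p - i : ℕ) : ℝ) * ρ))) := by
  have hu' := hua.trans had
  have hmono : ratioPow γ d b q ≤ ratioPow γ u t q :=
    ratioPow_mono hc.gamma_pos.le hu' hdb hbt ht
  have hκ : (τ - q) / (τ - b) ≤ (τ - q) / (τ - t) := ratio_mono hbt ht hq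
  have hκ0 : 0 ≤ (τ - q) / (τ - b) := ratio_nonneg (hbt.trans ht) hq
  have hκ1 : 0 ≤ (τ - q) / (τ - t) := ratio_nonneg ht hq
  have hB := hc.B_nonneg
  have hbd0 : 0 ≤ b - d := sub_nonneg.2 hdb
  have hcn := hc.c_nonneg
  have hys := hy.sub_left hua had (hdb.trans hbt)
  have hYa := hys.nonneg had
  have hda0 : 0 ≤ d - a := sub_nonneg.2 had
  have hr0 : 0 ≤ ratioPow γ d b q := ratioPow_nonneg hdb (hbt.trans ht)
  have hr1 : 0 ≤ ratioPow γ u t q := ratioPow_nonneg ((hu'.trans hdb).trans hbt) ht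
  have e1 : (germ z p y u τ a b - germ z p y u q a b) -
      (germ z p y u τ a d - germ z p y u q a d) - (germ z p y u τ d b - germ z p y u q d b) =
      (germ z p y u τ a b - germ z p y u τ a d - germ z p y u τ d b) -
        (germ z p y u q a b - germ z p y u q a d - germ z p y u q d b) := by abel
  have e2 : ∀ (x x' w : A) (f f' : ℕ → A), -(x * w + ∑ i ∈ Finset.Ico 1 p, f i) -
      -(x' * w + ∑ i ∈ Finset.Ico 1 p, f' i) =
      -((x - x') * w + ∑ i ∈ Finset.Ico 1 p, (f i - f' i)) := fun x x' w f f' => by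
    rw [Finset.sum_sub_distrib, sub_mul]; abel
  rw [e1, germ_defect hz hc hp hpL hreg hu (ht.trans hq) hτ hy hua had hdb hbt,
    germ_defect hz hc hp hpL hreg hu ht (hq.trans hτ) hy hua had hdb hbt, e2]
  refine norm_defect_le hcn (mul_nonneg hκ1 hr1) hbd0 ?_ (hys.norm_le d had le_rfl) ?_
  · refine (hz.incr hp hpL (hu.trans hu') hdb (hbt.trans ht) hq hτ).trans ?_
    have := hcn p
    gcongr
  · intro i hi
    rw [Finset.mem_Ico] at hi
    have h1 := (hbd i hi.1 hi.2).controlled hc hB (hu.trans hua) had (show b ≤ T by linarith) hys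
    refine ((hbd (p - i) (by omega) (by omega)).incr (hu.trans hu') hdb (hbt.trans ht) hq hτ
      h1).trans ?_
    have := hcn i
    have := hcn (p - i)
    gcongr

lemma germ_self (hz : LevelBounds T ρ γ c L z) (hc : Admissible ρ γ β B c)
    {p : ℕ} (hp : 1 ≤ p) (hpL : p ≤ L)
    {u τ : ℝ} {y : ℝ → A} (hu : 0 ≤ u) (ht : u ≤ τ) (hτ : τ ≤ T) :
    germ z p y u τ u u = 0 := by
  rw [germ, Finset.sum_eq_zero, add_zero, hz.self hc hp hpL hu ht hτ, zero_mul]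
  intro j hj
  rw [Finset.mem_Ico] at hj
  exact conv_self z (by omega) _ _ _

/-- The dyadic sums of the convolution germ converge with a uniform rate. -/
lemma norm_conv_sub_dyadicSum_le (hz : LevelBounds T ρ γ c L z) (hc : Admissible ρ γ β B c)
    {p : ℕ} (hp : 1 ≤ p)
    (hpL : p ≤ L) (hreg : ∀ k, 1 ≤ k → k < p → ConvRegular T z k)
    (hbd : ∀ k, 1 ≤ k → k < p → ConvBounds T ρ γ B c z k) {u t τ Y : ℝ} {y : ℝ → A}
    (hu : 0 ≤ u) (hut : u ≤ t) (ht : t ≤ τ) (hτ : τ ≤ T) (hy : Controlled u t y Y) {l : A}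
    (hl : IsMeshLimit u t (germ z p y u τ) l) (k : ℕ) :
    ‖l - dyadicSum (germ z p y u τ) u t k‖ ≤
      2 * c p * Y * ratioPow γ u t τ * (t - u) ^ (p * ρ) * ∑' j, dyadicTerm ρ (j + k) := by
  have hp' : (1 : ℝ) ≤ p := by exact_mod_cast hp
  have hcp := hc.c_nonneg p
  have hY := hy.nonneg hut
  have hr := ratioPow_nonneg (γ := γ) hut ht
  refine hl.norm_sub_dyadicSum_le_of_singular hut hc.rho_pos
    (by nlinarith [hc.rho_pos]) (by positivity) (germ_self hz hc hp hpL hu (hut.trans ht) hτ)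
    (fun a d b hua had hdb hbt h1 h2 => ?_) k
  have h := norm_germ_defect_le hz hc hp hpL hreg hbd hu ht hτ hy hua had hdb hbt
  have h3 := defect_midpoint_le hc hp (show 0 ≤ b - a by linarith)
  have h4 := ratio_nonneg hua had
  refine h.trans ?_
  conv_lhs => enter [2]; rw [h1, h2]
  refine (mul_le_mul_of_nonneg_left h3 (by positivity)).trans (le_of_eq (by ring))

/-- The zeroth dyadic sum `z^p_{tu} y(u)` contributes `c_p Y`, and the dyadic corrections contribute
`2 c_p Y` times the series. The total is at most `B c_p Y`, with the same `B` at every level. -/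
lemma convBounds_step (hz : LevelBounds T ρ γ c L z) (hc : Admissible ρ γ β B c)
    {p : ℕ} (hp : 1 ≤ p)
    (hpL : p ≤ L) (hreg : ∀ k, 1 ≤ k → k < p → ConvRegular T z k)
    (hbd : ∀ k, 1 ≤ k → k < p → ConvBounds T ρ γ B c z k)
    (hex : ∀ {u t τ y Y}, 0 ≤ u → u ≤ t → t ≤ τ → τ ≤ T → Controlled u t y Y →
      ∃ L, IsMeshLimit u t (germ z p y u τ) L) : ConvBounds T ρ γ B c z p := by
  have hp' : (1 : ℝ) ≤ p := by exact_mod_cast hp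
  have hcp := hc.c_nonneg p
  have key : ∀ {l F : A} {ω Y x : ℝ}, 0 ≤ ω → 0 ≤ Y → 0 ≤ x →
      ‖l - F‖ ≤ 2 * c p * Y * ω * x * ∑' j, dyadicTerm ρ (j + 0) → ‖F‖ ≤ c p * x * ω * Y →
      ‖l‖ ≤ B * c p * Y * x * ω := by
    intro l F ω Y x hω hY hx h1 h2
    have h3 : ‖l‖ ≤ ‖l - F‖ + ‖F‖ := by simpa using norm_add_le (l - F) F
    simp only [add_zero] at h1
    calc ‖l‖ ≤ c p * Y * x * ω * (1 + 2 * ∑' j, dyadicTerm ρ j) := by linarith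
      _ ≤ c p * Y * x * ω * B := mul_le_mul_of_nonneg_left hc.le_B (by positivity)
      _ = _ := by ring
  refine ⟨fun {u t τ y Y} hu hut ht hτ hy => ?_, fun {u t q τ y Y} hu hut ht hq hτ hy => ?_⟩
  · have hY := hy.nonneg hut
    have hr := ratioPow_nonneg (γ := γ) hut ht
    have htu : 0 ≤ t - u := by linarith
    rw [conv_eq_meshLimit z hp]
    have h := norm_conv_sub_dyadicSum_le hz hc hp hpL hreg hbd hu hut ht hτ hy
      (isMeshLimit_meshLimit (hex hu hut ht hτ hy)) 0
    refine key hr hY (by positivity) h ?_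
    rw [dyadicSum_zero, germ_left hreg hu hut ht hτ]
    exact (norm_mul_le _ _).trans (mul_le_mul (hz.bound hp hpL hu hut ht hτ)
      (hy.norm_le u le_rfl hut) (norm_nonneg _) (by positivity))
  · have hY := hy.nonneg hut
    have hr : 0 ≤ (τ - q) / (τ - t) * ratioPow γ u t q :=
      mul_nonneg (ratio_nonneg ht hq) (ratioPow_nonneg hut ht)
    have htu : 0 ≤ t - u := by linarith
    rw [conv_eq_meshLimit z hp, conv_eq_meshLimit z hp]
    have hl := (isMeshLimit_meshLimit (hex hu hut (ht.trans hq) hτ hy)).sub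
      (isMeshLimit_meshLimit (hex hu hut ht (hq.trans hτ) hy))
    have h := hl.norm_sub_dyadicSum_le_of_singular (σ := p * ρ)
      (V := 2 * c p * Y * ((τ - q) / (τ - t) * ratioPow γ u t q)) hut hc.rho_pos
      (by nlinarith [hc.rho_pos]) (by positivity) (by
        rw [germ_self hz hc hp hpL hu (by linarith) hτ,
          germ_self hz hc hp hpL hu (by linarith) (by linarith), sub_zero])
      (fun a d b hua had hdb hbt h1 h2 => ?_) 0
    · refine key hr hY (by positivity) h ?_
      rw [dyadicSum_zero, germ_left hreg hu hut (ht.trans hq) hτ,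
        germ_left hreg hu hut ht (hq.trans hτ), ← sub_mul]
      exact (norm_mul_le _ _).trans (mul_le_mul (hz.incr hp hpL hu hut ht hq hτ)
        (hy.norm_le u le_rfl hut) (norm_nonneg _) (by positivity))
    · have h := norm_germ_sub_defect_le hz hc hp hpL hreg hbd hu ht hq hτ hy hua had hdb hbt
      have h3 := defect_midpoint_le hc hp (show 0 ≤ b - a by linarith)
      have h4 := ratio_nonneg hua had
      refine h.trans ?_
      conv_lhs => enter [2]; rw [h1, h2]
      refine (mul_le_mul_of_nonneg_left h3 (by positivity)).trans (le_of_eq (by ring))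

/-- Convergence is required along all partitions, not only the dyadic ones, hence the sewing lemma.
Its form of the singularity is reached through `(d-a)/(d-u) ≤ (b-a)/(b-u)`. -/
lemma exists_limit_step (hz : LevelBounds T ρ γ c L z) (hc : Admissible ρ γ β B c)
    [CompleteSpace A] {p : ℕ} (hp : 1 ≤ p)
    (hpL : p ≤ L) (hreg : ∀ k, 1 ≤ k → k < p → ConvRegular T z k)
    (hbd : ∀ k, 1 ≤ k → k < p → ConvBounds T ρ γ B c z k) {u t τ Y : ℝ} {y : ℝ → A}
    (hu : 0 ≤ u) (hut : u ≤ t) (ht : t ≤ τ) (hτ : τ ≤ T) (hy : Controlled u t y Y) :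
    ∃ l, IsMeshLimit u t (germ z p y u τ) l := by
  have hp' : (0 : ℝ) < p := by exact_mod_cast hp
  have hcn := hc.c_nonneg
  have hY := hy.nonneg hut
  have hr := ratioPow_nonneg (γ := γ) hut ht
  have hs : 0 ≤ c p + B ^ 2 * ∑ i ∈ Finset.Ico 1 p, c i * c (p - i) :=
    add_nonneg (hcn p) (mul_nonneg (sq_nonneg B)
      (Finset.sum_nonneg fun i _ => mul_nonneg (hcn _) (hcn _)))
  refine exists_isMeshLimit_of_defect_le (σ := p * ρ)
    (K := Y * ratioPow γ u t τ * (c p + B ^ 2 * ∑ i ∈ Finset.Ico 1 p, c i * c (p - i))) hut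
    (by positivity) (mul_pos hp' hc.rho_pos) fun a d b hua had hdb hbt => ?_
  refine (norm_germ_defect_le hz hc hp hpL hreg hbd hu ht hτ hy hua had hdb hbt).trans ?_
  have h1 := defect_le (B := B) (p := p) (h := b - a) hcn hc.rho_pos.le (sub_nonneg.2 had)
    (sub_nonneg.2 hdb) (by linarith) (by linarith)
  have h2 := ratio_mono_right hua had hdb
  have h3 := ratio_nonneg hua had
  have h4 : (0:ℝ) ≤ (b - a) ^ (p * ρ) := Real.rpow_nonneg (by linarith) _
  calc _ ≤ Y * ((b - a) / (b - u)) * ratioPow γ u t τ *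
        ((c p + B ^ 2 * ∑ i ∈ Finset.Ico 1 p, c i * c (p - i)) * (b - a) ^ (p * ρ)) := by
        refine mul_le_mul (by gcongr) h1 ?_ (mul_nonneg (mul_nonneg hY (h3.trans h2)) hr)
        refine add_nonneg (mul_nonneg (hcn p) (Real.rpow_nonneg (by linarith) _))
          (mul_nonneg (sq_nonneg B) (Finset.sum_nonneg fun i _ => ?_))
        exact mul_nonneg (mul_nonneg (hcn _) (hcn _)) (mul_nonneg
          (Real.rpow_nonneg (by linarith) _) (Real.rpow_nonneg (by linarith) _))
    _ = _ := by ring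

/-- The convolution product with a level satisfying the estimates is regular. -/
theorem convRegular_and_convBounds (hz : LevelBounds T ρ γ c L z) (hc : Admissible ρ γ β B c)
    [CompleteSpace A] {p : ℕ} (hp : 1 ≤ p) (hpL : p ≤ L) :
    ConvRegular T z p ∧ ConvBounds T ρ γ B c z p := by
  induction p using Nat.strong_induction_on with
  | _ p ih =>
    have hreg : ∀ k, 1 ≤ k → k < p → ConvRegular T z k :=
      fun k h1 h2 => (ih k h2 h1 (by omega)).1
    have hbd : ∀ k, 1 ≤ k → k < p → ConvBounds T ρ γ B c z k :=
      fun k h1 h2 => (ih k h2 h1 (by omega)).2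
    have hex : ∀ {u t τ y Y}, 0 ≤ u → u ≤ t → t ≤ τ → τ ≤ T → Controlled u t y Y →
        ∃ L, IsMeshLimit u t (germ z p y u τ) L :=
      fun hu hut ht hτ hy => exists_limit_step hz hc hp hpL hreg hbd hu hut ht hτ hy
    have hb := convBounds_step hz hc hp hpL hreg hbd hex
    have hlim : ∀ {u t τ y Y}, 0 ≤ u → u ≤ t → t ≤ τ → τ ≤ T → Controlled u t y Y →
        IsMeshLimit u t (germ z p y u τ) (conv z p y u t τ) := fun {u t τ y Y} hu hut ht hτ hy => by
      rw [conv_eq_meshLimit z hp]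
      exact isMeshLimit_meshLimit (hex hu hut ht hτ hy)
    refine ⟨⟨hex, ?_, ?_, ?_, ?_⟩, hb⟩
    · intro u t τ y y' Y Y' hu hut ht hτ hy hy'
      rw [conv_eq_meshLimit z hp]
      refine (((hlim hu hut ht hτ hy).add (hlim hu hut ht hτ hy')).congr
        fun a b ha hab hb => ?_).meshLimit_eq hut
      rw [germ, germ, germ, mul_add, add_add_add_comm, ← Finset.sum_add_distrib]
      congr 1
      refine Finset.sum_congr rfl fun j hj => ?_
      rw [Finset.mem_Ico] at hj
      have hyj := hy.mono le_rfl ha (hab.trans hb)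
      have hyj' := hy'.mono le_rfl ha (hab.trans hb)
      obtain ⟨W, hW⟩ := (hreg j hj.1 hj.2).controlled hu ha hab (show b ≤ T by linarith) hyj
      obtain ⟨W', hW'⟩ := (hreg j hj.1 hj.2).controlled hu ha hab (show b ≤ T by linarith) hyj'
      rw [← (hreg (p - j) (by omega) (by omega)).conv_add (hu.trans ha) hab (hb.trans ht) hτ hW hW']
      exact conv_congr_right z (by omega) (hu.trans ha) (hb.trans ht) fun r hr1 hr2 =>
        ((hreg j hj.1 hj.2).conv_add hu ha hr1 (by linarith) hyj hyj').symm
    · intro u t τ y Y w hu hut ht hτ hy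
      rw [conv_eq_meshLimit z hp]
      refine (((hlim hu hut ht hτ hy).mul_const w).congr
        fun a b ha hab hb => ?_).meshLimit_eq hut
      rw [germ, germ, add_mul, mul_assoc, Finset.sum_mul]
      congr 1
      refine Finset.sum_congr rfl fun j hj => ?_
      rw [Finset.mem_Ico] at hj
      have hyj := hy.mono le_rfl ha (hab.trans hb)
      obtain ⟨W, hW⟩ := (hreg j hj.1 hj.2).controlled hu ha hab (show b ≤ T by linarith) hyj
      rw [← (hreg (p - j) (by omega) (by omega)).conv_mul_const w (hu.trans ha) hab (hb.trans ht)
        hτ hW]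
      exact conv_congr_right z (by omega) (hu.trans ha) (hb.trans ht) fun r hr1 hr2 =>
        ((hreg j hj.1 hj.2).conv_mul_const w hu ha hr1 (by linarith) hyj).symm
    · intro u t b y Y hu hut ht hτ hy
      exact ⟨_, hb.controlled hc hc.B_nonneg hu hut hτ hy⟩
    · intro u v t τ y Y hu huv hvt ht hτ hy
      -- The family `z^j ∗ y` satisfies Chen's relation for `j < p` by induction, and the remaining
      -- part `z^p_{ba} y(a)` of the germ does not involve the base point.
      exact chen_of_isMeshLimit hreg (Y := fun j s a r => conv z j y s a r)
        (X := fun a b => z p a b τ * y a) hu huv hvt ht hτ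
        (fun j hj1 hj2 a r ha hr1 hr2 => (hreg j hj1 hj2).chen hu huv ha hr1 (by linarith)
          (hy.mono le_rfl (huv.trans ha) (by linarith)))
        (fun j hj1 hj2 a ha hat => (hreg j hj1 hj2).controlled (hu.trans huv) ha hat
          (by linarith) (hy.mono huv ha hat))
        (fun j hj1 hj2 => (hreg j hj1 hj2).controlled hu huv hvt (by linarith)
          (hy.mono le_rfl huv hvt))
        (hlim hu (huv.trans hvt) ht hτ hy)
        (hlim hu huv (hvt.trans ht) hτ (hy.mono le_rfl huv hvt))
        (hlim (hu.trans huv) hvt ht hτ (hy.mono huv hvt le_rfl))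

lemma convExists_of_bounds (hz : LevelBounds T ρ γ c L z) (hc : Admissible ρ γ β B c)
    [CompleteSpace A] {p : ℕ} (hpL : p ≤ L) {u t τ Y : ℝ} {y : ℝ → A}
    (hu : 0 ≤ u) (hut : u ≤ t) (ht : t ≤ τ) (hτ : τ ≤ T) (hy : Controlled u t y Y) :
    ConvExists z p y u t τ := by
  induction p using Nat.strong_induction_on generalizing u t τ y Y with
  | _ p ih =>
    rcases Nat.eq_zero_or_pos p with rfl | hp
    · rw [ConvExists]; trivial
    rw [convExists_iff z hp]
    refine ⟨(convRegular_and_convBounds hz hc hp hpL).1.exists_limit hu hut ht hτ hy,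
      fun a b ha hab hb j hj1 hj2 => ⟨fun r hr1 hr2 => ?_, ?_⟩⟩
    · exact ih j hj2 (by omega) hu ha hr1 (by linarith) (hy.mono le_rfl ha (hab.trans hb))
    · obtain ⟨W, hW⟩ := (convRegular_and_convBounds hz hc hj1 (by omega)).1.controlled hu ha hab
        (show b ≤ T by linarith) (hy.mono le_rfl ha (hab.trans hb))
      exact ih (p - j) (by omega) (by omega) (hu.trans ha) hab (hb.trans ht) hτ hW

end Induction

section Extension

variable {A : Type*} [NormedRing A]
variable {T ρ γ β B σ : ℝ} {c : ℕ → ℝ} {L : ℕ} {z : ℕ → ℝ → ℝ → ℝ → A}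

/-! ### The next level -/

/-- The germ whose mesh limit over `[s,t]` is the level `m` determined by the lower ones. -/
noncomputable def levelGerm (z : ℕ → ℝ → ℝ → ℝ → A) (m : ℕ) (s τ a b : ℝ) : A :=
  ∑ j ∈ Finset.Ico 1 m, conv z (m - j) (z j s a) a b τ

/-- The level `m` determined by the lower ones. -/
noncomputable def nextLevel (z : ℕ → ℝ → ℝ → ℝ → A) (m : ℕ) (s t τ : ℝ) : A :=
  meshLimit s t (levelGerm z m s τ)

lemma levelGerm_self (z : ℕ → ℝ → ℝ → ℝ → A) (m : ℕ) (s τ : ℝ) : levelGerm z m s τ s s = 0 :=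
  Finset.sum_eq_zero fun j hj => by
    rw [Finset.mem_Ico] at hj
    exact conv_self z (by omega) _ _ _

lemma nextLevel_congr {z' : ℕ → ℝ → ℝ → ℝ → A} {m : ℕ}
    (hz : ∀ k, 1 ≤ k → k < m → ∀ s t τ, 0 ≤ s → s ≤ t → t ≤ τ → τ ≤ T → z k s t τ = z' k s t τ)
    {s t τ : ℝ} (hs : 0 ≤ s) (ht : t ≤ τ) (hτ : τ ≤ T) :
    nextLevel z m s t τ = nextLevel z' m s t τ := by
  refine meshLimit_congr fun a b ha hab hb => Finset.sum_congr rfl fun j hj => ?_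
  rw [Finset.mem_Ico] at hj
  exact conv_congr (T := T) (by omega) (fun k h1 h2 => hz k h1 (by omega)) (hs.trans ha)
    (hb.trans ht) hτ fun r h1 h2 => hz j hj.1 hj.2 s a r hs ha h1 (by linarith)

lemma LevelBounds.congr {z' : ℕ → ℝ → ℝ → ℝ → A} (h : LevelBounds T ρ γ c L z)
    (hz : ∀ k, 1 ≤ k → k ≤ L → ∀ s t τ, 0 ≤ s → s ≤ t → t ≤ τ → τ ≤ T → z k s t τ = z' k s t τ) :
    LevelBounds T ρ γ c L z' := by
  refine ⟨fun {p} hp hpL {s t τ} h1 h2 h3 h4 => ?_,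
    fun {p} hp hpL {s t q τ} h1 h2 h3 h4 h5 => ?_,
    fun {p} hp hpL {s u t τ} h1 h2 h3 h4 h5 => ?_⟩
  · rw [← hz p hp hpL s t τ h1 h2 h3 h4]
    exact h.bound hp hpL h1 h2 h3 h4
  · rw [← hz p hp hpL s t τ h1 h2 (h3.trans h4) h5, ← hz p hp hpL s t q h1 h2 h3 (h4.trans h5)]
    exact h.incr hp hpL h1 h2 h3 h4 h5
  · rw [← hz p hp hpL s t τ h1 (h2.trans h3) h4 h5, ← hz p hp hpL u t τ (h1.trans h2) h3 h4 h5,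
      ← hz p hp hpL s u τ h1 h2 (h3.trans h4) h5, h.chen hp hpL h1 h2 h3 h4 h5]
    congr 1
    refine Finset.sum_congr rfl fun i hi => ?_
    rw [Finset.mem_Ico] at hi
    exact conv_congr (T := T) (by omega) (fun k h6 h7 => hz k h6 (by omega)) (h1.trans h2) h4 h5
      fun r h8 h9 => hz i hi.1 (by omega) s u r h1 h2 h8 (by linarith)

lemma Controlled.weaken {u t Y Y' : ℝ} {y : ℝ → A} (h : Controlled u t y Y) (hY : Y ≤ Y') :
    Controlled u t y Y' :=
  ⟨fun r h1 h2 => (h.norm_le r h1 h2).trans hY, fun q r h1 h2 h3 =>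
    (h.norm_sub_le q r h1 h2 h3).trans (mul_le_mul_of_nonneg_right hY (ratio_nonneg h1 h2))⟩

/-- The midpoint cancellation again. Only one factor `B` occurs, because the inner function is a
level `z^i` of size `c_i` and not a convolution product. -/
lemma norm_sum_conv_midpoint_le (hc : Admissible ρ γ β B c) {m : ℕ} (hm : 1 ≤ m) {cc : ℕ → A}
    {ω h : ℝ} (hω : 0 ≤ ω) (hh : 0 ≤ h)
    (hcc : ∀ i ∈ Finset.Ico 1 m, ‖cc i‖ ≤ B * c (m - i) * (c i * (h / 2) ^ (i * ρ)) *
      (h / 2) ^ (((m - i : ℕ) : ℝ) * ρ) * ω) :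
    ‖-∑ i ∈ Finset.Ico 1 m, cc i‖ ≤ B * β * c m * ω * h ^ (m * ρ) := by
  have hρ := hc.rho_pos
  have hB := hc.B_nonneg
  have hh2 : 0 ≤ h / 2 := by positivity
  rw [norm_neg]
  refine (norm_sum_le _ _).trans ((Finset.sum_le_sum hcc).trans ?_)
  have e1 : ∑ i ∈ Finset.Ico 1 m, B * c (m - i) * (c i * (h / 2) ^ (i * ρ)) *
      (h / 2) ^ (((m - i : ℕ) : ℝ) * ρ) * ω =
      B * ω * (h / 2) ^ (m * ρ) * ∑ i ∈ Finset.Ico 1 m, c i * c (m - i) := by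
    rw [Finset.mul_sum]
    refine Finset.sum_congr rfl fun i hi => ?_
    rw [← rpow_mul_rpow_level (by rw [Finset.mem_Ico] at hi; omega : i ≤ m) hρ.le hh2]
    ring
  have e2 : (2 : ℝ) ^ (m * ρ) * (h / 2) ^ (m * ρ) = h ^ (m * ρ) := by
    rw [← Real.mul_rpow (by norm_num) hh2]
    congr 1
    ring
  rw [e1]
  refine (mul_le_mul_of_nonneg_left (hc.sum_le m hm) (by positivity)).trans (le_of_eq ?_)
  rw [← e2]
  ring

variable [CompleteSpace A]

/-- This is the change of base point from `s` to `a` for the family `z` itself; the exact increment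
drops out. -/
lemma levelGerm_defect (hz : LevelBounds T ρ γ c L z) (hc : Admissible ρ γ β B c)
    {m : ℕ} (hm : m ≤ L + 1) {s τ a d b : ℝ} (hs : 0 ≤ s) (hsa : s ≤ a)
    (had : a ≤ d) (hdb : d ≤ b) (hbτ : b ≤ τ) (hτ : τ ≤ T) :
    levelGerm z m s τ a b - levelGerm z m s τ a d - levelGerm z m s τ d b =
      -∑ j ∈ Finset.Ico 1 m, conv z (m - j) (z j a d) d b τ := by
  have h := sum_conv_change_base (p := m) (Y := z)
    (fun k h1 h2 => (convRegular_and_convBounds hz hc h1 (by omega)).1) hs hsa had hdb hbτ hτ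
    (fun j hj1 hj2 r hr1 hr2 => hz.chen hj1 (by omega) hs hsa had hr1 (by linarith))
    (fun j hj1 hj2 => ⟨_, hz.controlled hc hj1 (by omega) (hs.trans hsa) had (by linarith)⟩)
    (fun j hj1 hj2 => ⟨_, hz.controlled hc hj1 (by omega) hs hsa (by linarith)⟩)
  simp only [levelGerm]
  rw [h]
  abel

lemma norm_levelGerm_defect_le (hz : LevelBounds T ρ γ c L z) (hc : Admissible ρ γ β B c)
    {m : ℕ} (hm1 : 1 ≤ m) (hm : m ≤ L + 1) {s t τ a d b : ℝ}
    (hs : 0 ≤ s) (hsa : s ≤ a) (had : a ≤ d) (hdb : d ≤ b) (hbt : b ≤ t) (ht : t ≤ τ)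
    (hτ : τ ≤ T) (h1 : d - a = (b - a) / 2) (h2 : b - d = (b - a) / 2) :
    ‖levelGerm z m s τ a b - levelGerm z m s τ a d - levelGerm z m s τ d b‖ ≤
      B * β * c m * ratioPow γ s t τ * (b - a) ^ (m * ρ) := by
  have hst : s ≤ t := by linarith
  rw [levelGerm_defect hz hc hm hs hsa had hdb (hbt.trans ht) hτ]
  refine norm_sum_conv_midpoint_le hc hm1 (ratioPow_nonneg hst ht) (by linarith) fun i hi => ?_
  rw [Finset.mem_Ico] at hi
  have h3 := hz.controlled hc hi.1 (by omega) (hs.trans hsa) had (show b ≤ T by linarith)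
  refine ((convRegular_and_convBounds hz hc (show 1 ≤ m - i by omega) (by omega)).2.bound
    (by linarith) hdb (hbt.trans ht) hτ h3).trans ?_
  rw [h1, h2]
  have hB := hc.B_nonneg
  have := hc.c_nonneg i
  have := hc.c_nonneg (m - i)
  have h5 : 0 ≤ (b - a) / 2 := by linarith
  refine mul_le_mul_of_nonneg_left ?_ (by positivity)
  exact ratioPow_mono hc.gamma_pos.le (hsa.trans had) hdb hbt ht

lemma norm_levelGerm_sub_defect_le (hz : LevelBounds T ρ γ c L z) (hc : Admissible ρ γ β B c)
    {m : ℕ} (hm1 : 1 ≤ m) (hm : m ≤ L + 1) {s t q τ a d b : ℝ}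
    (hs : 0 ≤ s) (hsa : s ≤ a) (had : a ≤ d) (hdb : d ≤ b) (hbt : b ≤ t) (ht : t ≤ q) (hq : q ≤ τ)
    (hτ : τ ≤ T) (h1 : d - a = (b - a) / 2) (h2 : b - d = (b - a) / 2) :
    ‖(levelGerm z m s τ a b - levelGerm z m s q a b) -
      (levelGerm z m s τ a d - levelGerm z m s q a d) -
      (levelGerm z m s τ d b - levelGerm z m s q d b)‖ ≤
      B * β * c m * ((τ - q) / (τ - t) * ratioPow γ s t q) * (b - a) ^ (m * ρ) := by
  have hst : s ≤ t := by linarith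
  have e1 : (levelGerm z m s τ a b - levelGerm z m s q a b) -
      (levelGerm z m s τ a d - levelGerm z m s q a d) -
      (levelGerm z m s τ d b - levelGerm z m s q d b) =
      (levelGerm z m s τ a b - levelGerm z m s τ a d - levelGerm z m s τ d b) -
      (levelGerm z m s q a b - levelGerm z m s q a d - levelGerm z m s q d b) := by abel
  rw [e1, levelGerm_defect hz hc hm hs hsa had hdb (by linarith) hτ,
    levelGerm_defect hz hc hm hs hsa had hdb (by linarith) (hq.trans hτ), ← neg_sub',
    ← Finset.sum_sub_distrib]
  refine norm_sum_conv_midpoint_le hc hm1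
    (mul_nonneg (ratio_nonneg ht hq) (ratioPow_nonneg hst ht)) (by linarith) fun i hi => ?_
  rw [Finset.mem_Ico] at hi
  have h3 := hz.controlled hc hi.1 (by omega) (hs.trans hsa) had (show b ≤ T by linarith)
  refine ((convRegular_and_convBounds hz hc (show 1 ≤ m - i by omega) (by omega)).2.incr
    (by linarith) hdb (hbt.trans ht) hq hτ h3).trans ?_
  rw [h1, h2]
  have hB := hc.B_nonneg
  have := hc.c_nonneg i
  have := hc.c_nonneg (m - i)
  have h5 : 0 ≤ (b - a) / 2 := by linarith
  refine mul_le_mul_of_nonneg_left ?_ (by positivity)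
  exact mul_le_mul (ratio_mono hbt ht hq)
    (ratioPow_mono hc.gamma_pos.le (hsa.trans had) hdb hbt ht)
    (ratioPow_nonneg hdb (hbt.trans ht)) (ratio_nonneg ht hq)

/-- The lower levels vanish on the diagonal `s = t`. The zeroth dyadic sum is thus zero, the new
level consists of sewing corrections only, and a small `β` makes them as small as needed. -/
lemma levelGerm_left (hz : LevelBounds T ρ γ c L z) (hc : Admissible ρ γ β B c)
    {m : ℕ} (hm : m ≤ L + 1) {s t τ : ℝ} (hs : 0 ≤ s) (hst : s ≤ t) (ht : t ≤ τ)
    (hτ : τ ≤ T) : levelGerm z m s τ s t = 0 := by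
  refine Finset.sum_eq_zero fun j hj => ?_
  rw [Finset.mem_Ico] at hj
  rw [conv_congr_right z (by omega) hs ht fun r hr1 hr2 =>
    hz.self hc hj.1 (by omega) hs hr1 (by linarith)]
  exact (convRegular_and_convBounds hz hc (show 1 ≤ m - j by omega) (by omega)).1.conv_zero
    hs hst ht hτ

/-- The defect has order `mρ > 1` without any singularity. It is put in the singular form of the
sewing lemma by `b - a ≤ (t-s) (b-a)/(b-s)`. -/
lemma exists_isMeshLimit_levelGerm (hz : LevelBounds T ρ γ c L z) (hc : Admissible ρ γ β B c)
    {m : ℕ} (hm : m ≤ L + 1) (hm1 : 1 < m * ρ)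
    {s t τ : ℝ} (hs : 0 ≤ s) (hst : s ≤ t) (ht : t ≤ τ) (hτ : τ ≤ T) :
    ∃ l, IsMeshLimit s t (levelGerm z m s τ) l := by
  have hB := hc.B_nonneg
  have hcn := hc.c_nonneg
  have hρ := hc.rho_pos
  have hts : 0 ≤ t - s := sub_nonneg.2 hst
  have hsum : 0 ≤ ∑ i ∈ Finset.Ico 1 m, c i * c (m - i) :=
    Finset.sum_nonneg fun i _ => mul_nonneg (hcn _) (hcn _)
  refine exists_isMeshLimit_of_defect_le (σ := m * ρ - 1)
    (K := B * (∑ i ∈ Finset.Ico 1 m, c i * c (m - i)) * (t - s)) hst (by positivity) (by linarith)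
    fun a d b hsa had hdb hbt => ?_
  rw [levelGerm_defect hz hc hm hs hsa had hdb (hbt.trans ht) hτ, norm_neg]
  have hba : 0 ≤ b - a := by linarith
  have h1 : ∀ i ∈ Finset.Ico 1 m, ‖conv z (m - i) (z i a d) d b τ‖ ≤
      B * (c i * c (m - i)) * (b - a) ^ (m * ρ) := by
    intro i hi
    rw [Finset.mem_Ico] at hi
    have h3 := hz.controlled hc hi.1 (by omega) (hs.trans hsa) had (show b ≤ T by linarith)
    refine ((convRegular_and_convBounds hz hc (show 1 ≤ m - i by omega) (by omega)).2.bound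
      (by linarith) hdb (hbt.trans ht) hτ h3).trans ?_
    have := hcn i
    have := hcn (m - i)
    have hda : 0 ≤ d - a := sub_nonneg.2 had
    have hbd : 0 ≤ b - d := sub_nonneg.2 hdb
    have h4 : (d - a) ^ (i * ρ) * (b - d) ^ (((m - i : ℕ) : ℝ) * ρ) ≤ (b - a) ^ (m * ρ) := by
      rw [← rpow_mul_rpow_level hi.2.le hρ.le hba]
      exact mul_le_mul (Real.rpow_le_rpow hda (by linarith) (by positivity))
        (Real.rpow_le_rpow hbd (by linarith) (by positivity)) (by positivity) (by positivity)
    calc B * c (m - i) * (c i * (d - a) ^ (i * ρ)) * (b - d) ^ (((m - i : ℕ) : ℝ) * ρ) *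
          ratioPow γ d b τ
        ≤ B * c (m - i) * (c i * (d - a) ^ (i * ρ)) * (b - d) ^ (((m - i : ℕ) : ℝ) * ρ) * 1 := by
          refine mul_le_mul_of_nonneg_left ?_ (by positivity)
          exact ratioPow_le_one hc.gamma_pos.le hdb (hbt.trans ht)
      _ = B * (c i * c (m - i)) * ((d - a) ^ (i * ρ) * (b - d) ^ (((m - i : ℕ) : ℝ) * ρ)) := by
          ring
      _ ≤ _ := mul_le_mul_of_nonneg_left h4 (by positivity)
  refine (norm_sum_le _ _).trans ((Finset.sum_le_sum h1).trans ?_)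
  rw [← Finset.sum_mul, ← Finset.mul_sum]
  have h5 : (b - a) ^ (m * ρ) = (b - a) ^ (m * ρ - 1) * (b - a) := by
    conv_rhs => rw [← Real.rpow_one (b - a), ← Real.rpow_mul hba, one_mul]
    rw [← Real.rpow_add_of_nonneg hba (by linarith) zero_le_one, sub_add_cancel]
  have h6 : b - a ≤ (t - s) * ((b - a) / (b - s)) := by
    rcases hba.eq_or_lt with h | h
    · rw [← h]; simp
    · rw [mul_div_assoc', le_div_iff₀ (by linarith)]
      nlinarith
  calc B * (∑ i ∈ Finset.Ico 1 m, c i * c (m - i)) * (b - a) ^ (m * ρ)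
      = B * (∑ i ∈ Finset.Ico 1 m, c i * c (m - i)) * (b - a) ^ (m * ρ - 1) * (b - a) := by
        rw [h5]; ring
    _ ≤ B * (∑ i ∈ Finset.Ico 1 m, c i * c (m - i)) * (b - a) ^ (m * ρ - 1) *
        ((t - s) * ((b - a) / (b - s))) := mul_le_mul_of_nonneg_left h6 (by positivity)
    _ = _ := by ring

lemma norm_nextLevel_sub_dyadicSum_le (hz : LevelBounds T ρ γ c L z) (hc : Admissible ρ γ β B c)
    {m : ℕ} (hm1 : 1 ≤ m) (hm : m ≤ L + 1) (hσ : 0 < σ)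
    (hmσ : 1 + σ ≤ m * ρ) (hβ : 0 ≤ β)
    {s t τ : ℝ} (hs : 0 ≤ s) (hst : s ≤ t) (ht : t ≤ τ) (hτ : τ ≤ T) (k : ℕ) :
    ‖nextLevel z m s t τ - dyadicSum (levelGerm z m s τ) s t k‖ ≤
      B * β * c m * ratioPow γ s t τ * (t - s) ^ (m * ρ) * ∑' j, dyadicTerm σ (j + k) := by
  have hB := hc.B_nonneg
  have hcm := hc.c_nonneg m
  have hr := ratioPow_nonneg (γ := γ) hst ht
  exact (isMeshLimit_meshLimit (exists_isMeshLimit_levelGerm hz hc hm (by linarith) hs hst ht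
    hτ)).norm_sub_dyadicSum_le_of_regular hst hσ hmσ (by positivity) (levelGerm_self z m s τ)
    (fun a d b hsa had hdb hbt h1 h2 =>
      norm_levelGerm_defect_le hz hc hm1 hm hs hsa had hdb hbt ht hτ h1 h2) k

/-- The estimates pass to the next level. -/
theorem LevelBounds.update (hz : LevelBounds T ρ γ c L z) (hc : Admissible ρ γ β B c)
    {m : ℕ} (hm : m = L + 1) (hσ : 0 < σ) (hmσ : 1 + σ ≤ m * ρ)
    (hβ : 0 ≤ β) (hβB : B * β * ∑' j, dyadicTerm σ j ≤ 1) :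
    LevelBounds T ρ γ c (L + 1) (Function.update z m (nextLevel z m)) := by
  have hB := hc.B_nonneg
  have hcm := hc.c_nonneg m
  have hlow : ∀ k, k ≤ L → Function.update z m (nextLevel z m) k = z k := fun k hk =>
    Function.update_of_ne (by omega) _ _
  have htop : Function.update z m (nextLevel z m) m = nextLevel z m := Function.update_self _ _ _
  have hz' := hz.congr (z' := Function.update z m (nextLevel z m))
    fun k _ hk s t τ _ _ _ _ => by rw [hlow k hk]
  -- The condition `hβB` returns exactly the constant `c m`, so nothing is lost from one level to
  -- the next.
  have key : ∀ {l : A} {ω x : ℝ}, 0 ≤ ω → 0 ≤ x →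
      ‖l‖ ≤ B * β * c m * ω * x * ∑' j, dyadicTerm σ (j + 0) → ‖l‖ ≤ c m * x * ω := by
    intro l ω x hω hx h
    simp only [add_zero] at h
    calc ‖l‖ ≤ c m * x * ω * (B * β * ∑' j, dyadicTerm σ j) := by linarith
      _ ≤ c m * x * ω * 1 := mul_le_mul_of_nonneg_left hβB (by positivity)
      _ = _ := by ring
  refine ⟨fun {p} hp hpL {s t τ} hs hst ht hτ => ?_,
    fun {p} hp hpL {s t q τ} hs hst ht hq hτ => ?_,
    fun {p} hp hpL {s u t τ} hs hsu hut ht hτ => ?_⟩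
  · rcases Nat.lt_or_ge L p with h | h
    · obtain rfl : p = m := by omega
      rw [htop]
      have h1 := norm_nextLevel_sub_dyadicSum_le hz hc hp hpL hσ hmσ hβ hs hst ht hτ 0
      rw [dyadicSum_zero, levelGerm_left hz hc hpL hs hst ht hτ, sub_zero] at h1
      exact key (ratioPow_nonneg hst ht) (Real.rpow_nonneg (by linarith) _) h1
    · exact hz'.bound hp h hs hst ht hτ
  · rcases Nat.lt_or_ge L p with h | h
    · obtain rfl : p = m := by omega
      rw [htop]
      have hex := fun {τ} => exists_isMeshLimit_levelGerm (t := t) (τ := τ) hz hc hpL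
        (show 1 < p * ρ by linarith) hs hst
      have hκ := ratio_nonneg ht hq
      have hr := ratioPow_nonneg (γ := γ) hst ht
      have h1 := ((isMeshLimit_meshLimit (hex (ht.trans hq) hτ)).sub
        (isMeshLimit_meshLimit (hex ht (hq.trans hτ)))).norm_sub_dyadicSum_le_of_regular hst hσ hmσ
        (V := B * β * c p * ((τ - q) / (τ - t) * ratioPow γ s t q))
        (by positivity) (by rw [levelGerm_self, levelGerm_self, sub_zero])
        (fun a d b hsa had hdb hbt h1 h2 =>
          norm_levelGerm_sub_defect_le hz hc hp hpL hs hsa had hdb hbt ht hq hτ h1 h2) 0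
      rw [dyadicSum_zero, levelGerm_left hz hc hpL hs hst (ht.trans hq) hτ,
        levelGerm_left hz hc hpL hs hst ht (hq.trans hτ), sub_zero, sub_zero] at h1
      exact key (by positivity) (Real.rpow_nonneg (by linarith) _) h1
    · exact hz'.incr hp h hs hst ht hq hτ
  · rcases Nat.lt_or_ge L p with h | h
    · obtain rfl : p = m := by omega
      rw [htop]
      have hlim : ∀ {s t}, 0 ≤ s → s ≤ t → t ≤ τ → IsMeshLimit s t
          (fun a b => 0 + ∑ j ∈ Finset.Ico 1 p, conv z (p - j) (z j s a) a b τ)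
          (nextLevel z p s t τ) := fun {s t} hs hst ht => by
        simp only [zero_add]
        exact isMeshLimit_meshLimit (exists_isMeshLimit_levelGerm hz hc hpL (by linarith) hs hst
          ht hτ)
      have h1 := chen_of_isMeshLimit (p := p) (Y := z) (X := fun _ _ => 0)
        (fun k h1 h2 => (convRegular_and_convBounds hz hc h1 (by omega)).1) hs hsu hut ht hτ
        (fun j hj1 hj2 a r ha hr1 hr2 => hz.chen hj1 (by omega) hs hsu ha hr1 (by linarith))
        (fun j hj1 hj2 a ha hat =>
          ⟨_, hz.controlled hc hj1 (by omega) (hs.trans hsu) ha (by linarith)⟩)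
        (fun j hj1 hj2 => ⟨_, hz.controlled hc hj1 (by omega) hs hsu (by linarith)⟩)
        (hlim hs (hsu.trans hut) ht) (hlim hs hsu (hut.trans ht)) (hlim (hs.trans hsu) hut ht)
      rw [h1]
      congr 1
      refine Finset.sum_congr rfl fun i hi => ?_
      rw [Finset.mem_Ico] at hi
      rw [hlow i (by omega)]
      exact conv_congr (T := T) (by omega) (fun k h1 h2 s t τ _ _ _ _ => by rw [hlow k (by omega)])
        (hs.trans hsu) ht hτ fun _ _ _ => rfl
    · exact hz'.chen hp h hs hsu hut ht hτ

end Extension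

section Continuity

variable {A : Type*} [NormedRing A]
variable {T ρ γ β B σ : ℝ} {c : ℕ → ℝ} {L : ℕ} {z : ℕ → ℝ → ℝ → ℝ → A}

/-! ### Continuity -/

/-- The tail of the series does not depend on `x`, so the continuous approximations converge
uniformly. -/
lemma continuous_of_dyadic_approx {X : Type*} [TopologicalSpace X] {f : X → A} {S : ℕ → X → A}
    {V : ℝ} (h : ∀ k x, ‖f x - S k x‖ ≤ V * ∑' j, dyadicTerm ρ (j + k))
    (hS : ∀ k, Continuous (S k)) : Continuous f := by
  have hlim : Filter.Tendsto (fun k => V * ∑' j, dyadicTerm ρ (j + k)) Filter.atTop (nhds 0) := by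
    simpa using (tendsto_sum_nat_add (dyadicTerm ρ)).const_mul V
  have hu : TendstoUniformly S f Filter.atTop := by
    refine Metric.tendstoUniformly_iff.2 fun ε hε => ?_
    filter_upwards [hlim.eventually (gt_mem_nhds hε)] with k hk x
    rw [dist_eq_norm]
    exact (h k x).trans_lt hk
  exact hu.continuous (Filter.Frequently.of_forall hS)

lemma continuous_level (hcont : ContinuousOn (fun x : ℝ × ℝ × ℝ => z L x.1 x.2.1 x.2.2) (simplex T))
    {X : Type*} [TopologicalSpace X] {s t τ : X → ℝ} (hs : Continuous s) (ht : Continuous t)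
    (hτ : Continuous τ) (h0 : ∀ x, 0 ≤ s x) (hst : ∀ x, s x ≤ t x) (htτ : ∀ x, t x ≤ τ x)
    (hT : ∀ x, τ x ≤ T) : Continuous fun x => z L (s x) (t x) (τ x) :=
  hcont.comp_continuous (hs.prodMk (ht.prodMk hτ)) fun x => ⟨h0 x, hst x, htτ x, hT x⟩

variable [CompleteSpace A]

/-- The convolution product depends continuously on parameters. -/
theorem continuous_conv (hz : LevelBounds T ρ γ c L z) (hc : Admissible ρ γ β B c)
    (hcont : ∀ k, 1 ≤ k → k ≤ L →
      ContinuousOn (fun x : ℝ × ℝ × ℝ => z k x.1 x.2.1 x.2.2) (simplex T)) :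
    ∀ p, 1 ≤ p → p ≤ L → ∀ (X : Type) [TopologicalSpace X] (u t τ : X → ℝ) (y : X → ℝ → A) (Y : ℝ),
      Continuous u → Continuous t → Continuous τ → (∀ x, 0 ≤ u x) → (∀ x, u x ≤ t x) →
      (∀ x, t x ≤ τ x) → (∀ x, τ x ≤ T) →
      Continuous (fun w : {w : X × ℝ // u w.1 ≤ w.2 ∧ w.2 ≤ t w.1} => y w.1.1 w.1.2) →
      (∀ x, Controlled (u x) (t x) (y x) Y) →
      Continuous fun x => conv z p (y x) (u x) (t x) (τ x) := by
  intro p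
  -- The parameter space stays general in the induction: in a nested convolution the upper variable
  -- `r` of the inner factor becomes a parameter too, and the hypothesis is applied on a space of
  -- pairs `(x, r)`.
  induction p using Nat.strong_induction_on with
  | _ p ih =>
    intro hp hpL X _ u t τ y Y hu ht hτ h0 hut htτ hT hyc hy
    have hB := hc.B_nonneg
    have hcn := hc.c_nonneg
    have hρ := hc.rho_pos
    refine continuous_of_dyadic_approx (ρ := ρ) (V := 2 * c p * Y * T ^ (p * ρ))
      (S := fun k x => dyadicSum (germ z p (y x) (u x) (τ x)) (u x) (t x) k) (fun k x => ?_)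
      fun k => ?_
    · have hlim : IsMeshLimit (u x) (t x) (germ z p (y x) (u x) (τ x))
          (conv z p (y x) (u x) (t x) (τ x)) := by
        rw [conv_eq_meshLimit z hp]
        exact isMeshLimit_meshLimit ((convRegular_and_convBounds hz hc hp hpL).1.exists_limit
          (h0 x) (hut x) (htτ x) (hT x) (hy x))
      have h1 := norm_conv_sub_dyadicSum_le hz hc hp hpL
        (fun k h1 h2 => (convRegular_and_convBounds hz hc h1 (by omega)).1)
        (fun k h1 h2 => (convRegular_and_convBounds hz hc h1 (by omega)).2)
        (h0 x) (hut x) (htτ x) (hT x) (hy x) hlim k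
      refine h1.trans (mul_le_mul_of_nonneg_right ?_ (tsum_nonneg fun j => dyadicTerm_nonneg _ _))
      have hY := (hy x).nonneg (hut x)
      have hcp := hcn p
      have h2 := ratioPow_le_one hc.gamma_pos.le (hut x) (htτ x)
      have h3 : (t x - u x) ^ (p * ρ) ≤ T ^ (p * ρ) :=
        Real.rpow_le_rpow (sub_nonneg.2 (hut x)) (by linarith [h0 x, htτ x, hT x]) (by positivity)
      calc 2 * c p * Y * ratioPow γ (u x) (t x) (τ x) * (t x - u x) ^ (p * ρ)
          ≤ 2 * c p * Y * 1 * T ^ (p * ρ) := by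
            refine mul_le_mul (by gcongr) h3 (Real.rpow_nonneg (sub_nonneg.2 (hut x)) _)
              (by positivity)
        _ = _ := by ring
    · simp only [dyadicSum, germ]
      refine continuous_finsetSum _ fun i hi => ?_
      have hpts := fun x => dyadic_points (hut x) (Finset.mem_range.1 hi)
      set a : X → ℝ := fun x => u x + i * ((t x - u x) / 2 ^ k) with ha
      set b : X → ℝ := fun x => u x + (i + 1) * ((t x - u x) / 2 ^ k) with hb
      have hac : Continuous a := by fun_prop
      have hbc : Continuous b := by fun_prop
      have hua : ∀ x, u x ≤ a x := fun x => (hpts x).1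
      have hab : ∀ x, a x ≤ b x := fun x => (hpts x).2.1.trans (hpts x).2.2.1
      have hbt : ∀ x, b x ≤ t x := fun x => (hpts x).2.2.2
      refine Continuous.add (Continuous.mul ?_ ?_) (continuous_finsetSum _ fun j hj => ?_)
      · exact continuous_level (hcont p hp hpL) hac hbc hτ (fun x => (h0 x).trans (hua x)) hab
          (fun x => (hbt x).trans (htτ x)) hT
      · exact hyc.comp (f := fun x => (⟨(x, a x), hua x, (hab x).trans (hbt x)⟩ :
          {w : X × ℝ // u w.1 ≤ w.2 ∧ w.2 ≤ t w.1}))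
          ((continuous_id.prodMk hac).subtype_mk _)
      · rw [Finset.mem_Ico] at hj
        refine ih (p - j) (by omega) (by omega) (by omega) X a b τ
          (fun x r => conv z j (y x) (u x) (a x) r) (B * c j * Y * T ^ (j * ρ)) hac hbc hτ
          (fun x => (h0 x).trans (hua x)) hab (fun x => (hbt x).trans (htτ x)) hT ?_ fun x => ?_
        · refine ih j hj.2 hj.1 (by omega) {w : X × ℝ // a w.1 ≤ w.2 ∧ w.2 ≤ b w.1}
            (fun w => u w.1.1) (fun w => a w.1.1) (fun w => w.1.2) (fun w => y w.1.1) Y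
            (by fun_prop) (by fun_prop) (by fun_prop) (fun w => h0 _) (fun w => hua _)
            (fun w => w.2.1) (fun w => (w.2.2.trans (hbt _)).trans ((htτ _).trans (hT _))) ?_
            fun w => (hy _).mono le_rfl (hua _) ((hab _).trans (hbt _))
          refine hyc.comp (f := fun v : {v : {w : X × ℝ // a w.1 ≤ w.2 ∧ w.2 ≤ b w.1} × ℝ //
            u v.1.1.1 ≤ v.2 ∧ v.2 ≤ a v.1.1.1} => (⟨(v.1.1.1.1, v.1.2), v.2.1,
              v.2.2.trans ((hab _).trans (hbt _))⟩ :
            {w : X × ℝ // u w.1 ≤ w.2 ∧ w.2 ≤ t w.1})) ?_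
          exact Continuous.subtype_mk (by fun_prop) _
        · have hyx := (hy x).mono le_rfl (hua x) ((hab x).trans (hbt x))
          refine ((convRegular_and_convBounds hz hc hj.1 (by omega)).2.controlled hc hB (h0 x)
            (hua x) ((hbt x).trans ((htτ x).trans (hT x))) hyx).weaken ?_
          have hY := (hy x).nonneg (hut x)
          have := hcn j
          have h6 : 0 ≤ a x - u x := sub_nonneg.2 (hua x)
          refine mul_le_mul_of_nonneg_left (Real.rpow_le_rpow h6 ?_ (by positivity))
            (by positivity)
          linarith [h0 x, hab x, hbt x, htτ x, hT x]

lemma continuousOn_nextLevel (hz : LevelBounds T ρ γ c L z) (hc : Admissible ρ γ β B c)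
    {m : ℕ} (hm1 : 1 ≤ m) (hm : m ≤ L + 1) (hσ : 0 < σ)
    (hmσ : 1 + σ ≤ m * ρ) (hβ : 0 ≤ β)
    (hcont : ∀ k, 1 ≤ k → k ≤ L →
      ContinuousOn (fun x : ℝ × ℝ × ℝ => z k x.1 x.2.1 x.2.2) (simplex T)) :
    ContinuousOn (fun x : ℝ × ℝ × ℝ => nextLevel z m x.1 x.2.1 x.2.2) (simplex T) := by
  have hB := hc.B_nonneg
  have hcn := hc.c_nonneg
  have hρ := hc.rho_pos
  rw [continuousOn_iff_continuous_domRestrict]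
  set s : simplex T → ℝ := fun x => x.1.1 with hs
  set t : simplex T → ℝ := fun x => x.1.2.1 with ht
  set τ : simplex T → ℝ := fun x => x.1.2.2 with hτ
  have hsc : Continuous s := by fun_prop
  have htc : Continuous t := by fun_prop
  have hτc : Continuous τ := by fun_prop
  have h0 : ∀ x, 0 ≤ s x := fun x => x.2.1
  have hst : ∀ x, s x ≤ t x := fun x => x.2.2.1
  have htτ : ∀ x, t x ≤ τ x := fun x => x.2.2.2.1
  have hT : ∀ x, τ x ≤ T := fun x => x.2.2.2.2
  change Continuous fun x => nextLevel z m (s x) (t x) (τ x)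
  refine continuous_of_dyadic_approx (ρ := σ) (V := B * β * c m * T ^ (m * ρ))
    (S := fun k x => dyadicSum (levelGerm z m (s x) (τ x)) (s x) (t x) k) (fun k x => ?_)
    fun k => ?_
  · refine (norm_nextLevel_sub_dyadicSum_le hz hc hm1 hm hσ hmσ hβ (h0 x) (hst x) (htτ x) (hT x)
      k).trans (mul_le_mul_of_nonneg_right ?_ (tsum_nonneg fun j => dyadicTerm_nonneg _ _))
    have hcm := hcn m
    have h2 := ratioPow_le_one hc.gamma_pos.le (hst x) (htτ x)
    have h3 : (t x - s x) ^ (m * ρ) ≤ T ^ (m * ρ) :=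
      Real.rpow_le_rpow (sub_nonneg.2 (hst x)) (by linarith [h0 x, htτ x, hT x]) (by positivity)
    calc B * β * c m * ratioPow γ (s x) (t x) (τ x) * (t x - s x) ^ (m * ρ)
        ≤ B * β * c m * 1 * T ^ (m * ρ) := by
          refine mul_le_mul (by gcongr) h3 (Real.rpow_nonneg (sub_nonneg.2 (hst x)) _)
            (by positivity)
      _ = _ := by ring
  · simp only [dyadicSum, levelGerm]
    refine continuous_finsetSum _ fun i hi => continuous_finsetSum _ fun j hj => ?_
    have hpts := fun x => dyadic_points (hst x) (Finset.mem_range.1 hi)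
    set a : simplex T → ℝ := fun x => s x + i * ((t x - s x) / 2 ^ k) with ha
    set b : simplex T → ℝ := fun x => s x + (i + 1) * ((t x - s x) / 2 ^ k) with hb
    have hac : Continuous a := by fun_prop
    have hbc : Continuous b := by fun_prop
    have hua : ∀ x, s x ≤ a x := fun x => (hpts x).1
    have hab : ∀ x, a x ≤ b x := fun x => (hpts x).2.1.trans (hpts x).2.2.1
    have hbt : ∀ x, b x ≤ t x := fun x => (hpts x).2.2.2
    rw [Finset.mem_Ico] at hj
    refine continuous_conv hz hc hcont (m - j) (by omega) (by omega) (simplex T) a b τ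
      (fun x => z j (s x) (a x)) (c j * T ^ (j * ρ)) hac hbc hτc
      (fun x => (h0 x).trans (hua x)) hab (fun x => (hbt x).trans (htτ x)) hT ?_ fun x => ?_
    · exact continuous_level (hcont j hj.1 (by omega)) (by fun_prop) (by fun_prop) (by fun_prop)
        (fun w => h0 _) (fun w => hua _) (fun w => w.2.1)
        (fun w => (w.2.2.trans (hbt _)).trans ((htτ _).trans (hT _)))
    · refine (hz.controlled hc hj.1 (by omega) (h0 x) (hua x)
        ((hbt x).trans ((htτ x).trans (hT x)))).weaken ?_
      have := hcn j
      have h6 : 0 ≤ a x - s x := sub_nonneg.2 (hua x)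
      refine mul_le_mul_of_nonneg_left (Real.rpow_le_rpow h6 ?_ (by positivity)) this
      linarith [h0 x, hab x, hbt x, htτ x, hT x]

end Continuity

section Tower

variable {A : Type*} [NormedRing A]
variable {T ρ γ β B σ : ℝ} {c : ℕ → ℝ} {n : ℕ} {z : ℕ → ℝ → ℝ → ℝ → A}

/-! ### The extension to all levels -/

/-- `z` with the levels `n+1, …, n+k` replaced by those determined by the lower ones. -/
noncomputable def tower (z : ℕ → ℝ → ℝ → ℝ → A) (n : ℕ) : ℕ → ℕ → ℝ → ℝ → ℝ → A
  | 0 => z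
  | k + 1 => Function.update (tower z n k) (n + k + 1) (nextLevel (tower z n k) (n + k + 1))

/-- `z` with all the levels above `n` replaced by those determined by the lower ones. -/
noncomputable def extension (z : ℕ → ℝ → ℝ → ℝ → A) (n m : ℕ) : ℝ → ℝ → ℝ → A :=
  tower z n (m - n) m

lemma tower_add_eq (z : ℕ → ℝ → ℝ → ℝ → A) {n k m : ℕ} (hm : m ≤ n + k) (l : ℕ) :
    tower z n (k + l) m = tower z n k m := by
  induction l with
  | zero => rfl
  | succ l ih =>
    rw [← add_assoc, tower, Function.update_of_ne (by omega), ih]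

lemma extension_eq_tower (z : ℕ → ℝ → ℝ → ℝ → A) {n k m : ℕ} (hm : m ≤ n + k) :
    extension z n m = tower z n k m := by
  obtain ⟨l, rfl⟩ := Nat.exists_eq_add_of_le (show m - n ≤ k by omega)
  exact (tower_add_eq z (by omega) l).symm

lemma extension_of_le (z : ℕ → ℝ → ℝ → ℝ → A) {n m : ℕ} (hm : m ≤ n) : extension z n m = z m :=
  extension_eq_tower z (k := 0) hm

/-- The stage of the construction disappears from the recursion, because `nextLevel` sees only
levels below `m`, which no longer change. -/
lemma extension_of_lt (z : ℕ → ℝ → ℝ → ℝ → A) {n m : ℕ} (hm : n < m) {s t τ : ℝ} (hs : 0 ≤ s)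
    (ht : t ≤ τ) : extension z n m s t τ = nextLevel (extension z n) m s t τ := by
  obtain ⟨k, rfl⟩ := Nat.exists_eq_add_of_lt hm
  rw [extension_eq_tower z (k := k + 1) (by omega), tower, Function.update_self]
  exact nextLevel_congr (T := τ) (fun j _ hj s t τ _ _ _ _ => by
    rw [extension_eq_tower z (k := k) (by omega)]) hs ht le_rfl

lemma LevelBounds.mono {L L' : ℕ} (h : LevelBounds T ρ γ c L' z) (hL : L ≤ L') :
    LevelBounds T ρ γ c L z :=
  ⟨fun hp hpL => h.bound hp (hpL.trans hL), fun hp hpL => h.incr hp (hpL.trans hL),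
    fun hp hpL => h.chen hp (hpL.trans hL)⟩

theorem LevelBounds.extension [CompleteSpace A] (hz : LevelBounds T ρ γ c n z)
    (hc : Admissible ρ γ β B c) (hσ : 0 < σ) (hnσ : 1 + σ ≤ (n + 1) * ρ)
    (hβ : 0 ≤ β) (hβB : B * β * ∑' j, dyadicTerm σ j ≤ 1) (L : ℕ) :
    LevelBounds T ρ γ c L (extension z n) := by
  have h : ∀ k, LevelBounds T ρ γ c (n + k) (tower z n k) := by
    intro k
    induction k with
    | zero => exact hz
    | succ k ih =>
      refine ih.update hc rfl hσ (hnσ.trans (mul_le_mul_of_nonneg_right ?_ hc.rho_pos.le)) hβ hβB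
      push_cast
      have : (0 : ℝ) ≤ k := Nat.cast_nonneg k
      linarith
  refine LevelBounds.mono ((h L).congr fun k _ hk s t τ _ _ _ _ => ?_) (Nat.le_add_left L n)
  rw [extension_eq_tower z hk]

theorem continuousOn_extension [CompleteSpace A] (hz : LevelBounds T ρ γ c n z)
    (hc : Admissible ρ γ β B c) (hσ : 0 < σ) (hnσ : 1 + σ ≤ (n + 1) * ρ)
    (hβ : 0 ≤ β) (hβB : B * β * ∑' j, dyadicTerm σ j ≤ 1)
    (hcont : ∀ k, k ≤ n →
      ContinuousOn (fun x : ℝ × ℝ × ℝ => z k x.1 x.2.1 x.2.2) (simplex T)) (m : ℕ) :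
    ContinuousOn (fun x : ℝ × ℝ × ℝ => extension z n m x.1 x.2.1 x.2.2) (simplex T) := by
  induction m using Nat.strong_induction_on with
  | _ m ih =>
    rcases Nat.lt_or_ge n m with h | h
    · refine (continuousOn_nextLevel (L := m - 1) (hz.extension hc hσ hnσ hβ hβB _) hc
        (show 1 ≤ m by omega) (by omega) hσ ?_ hβ fun k _ h2 => ih k (by omega)).congr
        fun x hx => extension_of_lt z h hx.1 hx.2.2.1
      refine hnσ.trans (mul_le_mul_of_nonneg_right ?_ hc.rho_pos.le)
      exact_mod_cast h
    · rw [extension_of_le z h]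
      exact hcont m h

theorem extension_mem {S : ℕ → AddSubmonoid A}
    (hS : ∀ k, IsClosed (S k : Set A)) (hmul : ∀ k l x y, x ∈ S k → y ∈ S l → x * y ∈ S (k + l))
    (hz : ∀ k ≤ n, ∀ s t τ, 0 ≤ s → s ≤ t → t ≤ τ → τ ≤ T → z k s t τ ∈ S k) (m : ℕ) {s t τ : ℝ}
    (hs : 0 ≤ s) (hst : s ≤ t) (ht : t ≤ τ) (hτ : τ ≤ T) : extension z n m s t τ ∈ S m := by
  induction m using Nat.strong_induction_on generalizing s t τ with
  | _ m ih =>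
    rcases Nat.lt_or_ge n m with h | h
    · rw [extension_of_lt z h hs ht]
      refine meshLimit_mem hst (hS m) fun a b ha hab hb => sum_mem fun j hj => ?_
      rw [Finset.mem_Ico] at hj
      rw [show m = m - j + j by omega]
      conv => enter [2, 2]; rw [show m - j + j - j = m - j by omega]
      exact conv_mem (T := T) hS hmul (by omega)
        (fun k h1 h2 s t τ hs hst ht hτ => ih k (by omega) hs hst ht hτ) (hs.trans ha) hab
        (hb.trans ht) hτ fun r h1 h2 => ih j hj.2 hs ha h1 (by linarith)
    · rw [extension_of_le z h]
      exact hz m h s t τ hs hst ht hτ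

/-! ### Uniqueness -/

lemma isMeshLimit_zero {s t K σ : ℝ} (hσ : 0 < σ) (hK : 0 ≤ K) {F : ℝ → ℝ → A}
    (hF : ∀ a b, s ≤ a → a ≤ b → b ≤ t → ‖F a b‖ ≤ K * (b - a) ^ (1 + σ)) :
    IsMeshLimit s t F 0 := by
  intro ε hε
  have hlim : Filter.Tendsto (fun δ : ℝ => K * (δ ^ σ * (t - s)))
      (nhdsWithin 0 (Set.Ioi 0)) (nhds 0) := by
    have h1 : Filter.Tendsto (fun δ : ℝ => K * (δ ^ σ * (t - s))) (nhds 0)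
        (nhds (K * ((0 : ℝ) ^ σ * (t - s)))) :=
      ((Real.continuousAt_rpow_const 0 σ (Or.inr hσ.le)).tendsto.mul_const _).const_mul _
    rw [Real.zero_rpow hσ.ne', zero_mul, mul_zero] at h1
    exact h1.mono_left nhdsWithin_le_nhds
  obtain ⟨δ, hδ1, hδ⟩ := ((hlim.eventually (gt_mem_nhds hε)).and self_mem_nhdsWithin).exists
  refine ⟨δ, hδ, fun N x hx hm => ?_⟩
  rw [sub_zero]
  refine ((norm_sum_le _ _).trans (Finset.sum_le_sum fun k hk => ?_)).trans_lt
    (b := ∑ k ∈ Finset.range N, K * (δ ^ σ * (x (k + 1) - x k))) ?_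
  · have hk := Finset.mem_range.1 hk
    have h0 : 0 ≤ x (k + 1) - x k := sub_nonneg.2 (hx.lt k hk).le
    refine (hF _ _ (hx.left_le hk.le) (hx.lt k hk).le (hx.le_right hk)).trans ?_
    rw [add_comm 1 σ, Real.rpow_add_of_nonneg h0 hσ.le zero_le_one, Real.rpow_one]
    exact mul_le_mul_of_nonneg_left (mul_le_mul_of_nonneg_right
      (Real.rpow_le_rpow h0 (hm k hk).le hσ.le) h0) hK
  · rw [← Finset.mul_sum, ← Finset.mul_sum, Finset.sum_range_sub x, hx.left, hx.right]
    exact hδ1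

/-- A level above `1/ρ` is determined by the lower ones and a bound of order `mρ`. -/
lemma level_unique {z' : ℕ → ℝ → ℝ → ℝ → A} {m : ℕ} {K K' ν : ℝ} (hν : 1 < ν)
    (hK : 0 ≤ K) (hK' : 0 ≤ K')
    (hlow : ∀ k, 1 ≤ k → k < m → ∀ s t τ, 0 ≤ s → s ≤ t → t ≤ τ → τ ≤ T →
      z k s t τ = z' k s t τ)
    (hchen : ∀ {s u t τ}, 0 ≤ s → s ≤ u → u ≤ t → t ≤ τ → τ ≤ T →
      z m s t τ = z m u t τ + z m s u τ + ∑ i ∈ Finset.Ico 1 m, conv z (m - i) (z i s u) u t τ)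
    (hchen' : ∀ {s u t τ}, 0 ≤ s → s ≤ u → u ≤ t → t ≤ τ → τ ≤ T →
      z' m s t τ = z' m u t τ + z' m s u τ +
        ∑ i ∈ Finset.Ico 1 m, conv z' (m - i) (z' i s u) u t τ)
    (hb : ∀ {s t τ}, 0 ≤ s → s ≤ t → t ≤ τ → τ ≤ T → ‖z m s t τ‖ ≤ K * (t - s) ^ ν)
    (hb' : ∀ {s t τ}, 0 ≤ s → s ≤ t → t ≤ τ → τ ≤ T → ‖z' m s t τ‖ ≤ K' * (t - s) ^ ν)
    {s t τ : ℝ} (hs : 0 ≤ s) (hst : s ≤ t) (ht : t ≤ τ) (hτ : τ ≤ T) : z m s t τ = z' m s t τ := by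
  have hsum : ∀ {u t}, s ≤ u → u ≤ t → t ≤ τ →
      ∑ i ∈ Finset.Ico 1 m, conv z (m - i) (z i s u) u t τ =
        ∑ i ∈ Finset.Ico 1 m, conv z' (m - i) (z' i s u) u t τ := fun {u t} hsu hut ht =>
    Finset.sum_congr rfl fun i hi => by
      rw [Finset.mem_Ico] at hi
      exact conv_congr (T := T) (by omega) (fun k h1 h2 => hlow k h1 (by omega)) (hs.trans hsu) ht
        hτ fun r h1 h2 => hlow i hi.1 hi.2 s u r hs hsu h1 (by linarith)
  -- By Chen's relation and the agreement of the lower levels, the increment over `[a,b]` of this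
  -- difference is the difference at `(a,b)`, of order `ν > 1`. The mesh limit is therefore both the
  -- total increment and zero.
  have h1 := isMeshLimit_increment s t fun a => z m s a τ - z' m s a τ
  have h2 : IsMeshLimit s t
      (fun a b => (z m s b τ - z' m s b τ) - (z m s a τ - z' m s a τ)) 0 := by
    refine isMeshLimit_zero (σ := ν - 1) (by linarith) (add_nonneg hK hK')
      fun a b ha hab hb1 => ?_
    have e : (z m s b τ - z' m s b τ) - (z m s a τ - z' m s a τ) = z m a b τ - z' m a b τ := by
      rw [hchen hs ha hab (hb1.trans ht) hτ, hchen' hs ha hab (hb1.trans ht) hτ,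
        hsum ha hab (hb1.trans ht)]
      abel
    rw [e, add_mul, add_sub_cancel]
    exact (norm_sub_le _ _).trans (add_le_add (hb (hs.trans ha) hab (hb1.trans ht) hτ)
      (hb' (hs.trans ha) hab (hb1.trans ht) hτ))
  have h3 := h1.unique hst h2
  have h4 : z m s s τ = 0 := by
    have := hb hs le_rfl (hst.trans ht) hτ
    rw [sub_self, Real.zero_rpow (by linarith), mul_zero] at this
    exact norm_le_zero_iff.1 this
  have h5 : z' m s s τ = 0 := by
    have := hb' hs le_rfl (hst.trans ht) hτ
    rw [sub_self, Real.zero_rpow (by linarith), mul_zero] at this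
    exact norm_le_zero_iff.1 this
  rw [h4, h5, sub_zero, sub_zero] at h3
  exact sub_eq_zero.1 h3

/-- The sum in Chen's relation without the conventions for the extreme terms. -/
lemma sum_chenTerm (z : ℕ → ℝ → ℝ → ℝ → A) {m : ℕ} (hm : 1 ≤ m) (s u t τ : ℝ) :
    ∑ i ∈ Finset.range (m + 1), chenTerm z m i s u t τ =
      z m u t τ + z m s u τ + ∑ i ∈ Finset.Ico 1 m, conv z (m - i) (z i s u) u t τ := by
  rw [Finset.sum_range_succ, Finset.range_eq_Ico, Finset.sum_eq_sum_Ico_succ_bot (by omega)]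
  have h1 : chenTerm z m 0 s u t τ = z m u t τ := by simp [chenTerm]
  have h2 : chenTerm z m m s u t τ = z m s u τ := by
    rw [chenTerm, if_neg (by omega), Nat.sub_self, conv]
  have h3 : ∑ i ∈ Finset.Ico (0 + 1) m, chenTerm z m i s u t τ =
      ∑ i ∈ Finset.Ico 1 m, conv z (m - i) (z i s u) u t τ :=
    Finset.sum_congr rfl fun i hi => by
      rw [Finset.mem_Ico] at hi
      rw [chenTerm, if_neg (by omega)]
  rw [h1, h2, h3]
  abel

end Tower

section Weights

/-! ### Seminorms and pointwise bounds -/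

variable {A : Type*} [NormedRing A]

lemma rpow_mul_ratioPow {ν γ s t τ : ℝ} (hst : s < t) (htτ : t ≤ τ) :
    (t - s) ^ ν * ratioPow γ s t τ = (t - s) ^ (ν + γ) * (τ - s) ^ (-γ) := by
  have h1 : 0 < t - s := sub_pos.2 hst
  have h2 : 0 < τ - s := by linarith
  rw [ratioPow, Real.div_rpow h1.le h2.le, Real.rpow_add h1, Real.rpow_neg h2.le]
  ring

lemma weight_pos {ν γ s t τ : ℝ} (hst : s < t) (htτ : t < τ) : 0 < weight ν γ s t τ := by
  have h1 : 0 < t - s := sub_pos.2 hst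
  have h2 : 0 < τ - t := sub_pos.2 htτ
  have h3 : 0 < τ - s := by linarith
  exact lt_min (by positivity) (by positivity)

lemma le_weight {ν γ s t τ : ℝ} (hν : 0 ≤ ν) (hγ : 0 ≤ γ) (hst : s < t) (htτ : t < τ) :
    (t - s) ^ ν * ratioPow γ s t τ ≤ weight (ν + γ) γ s t τ := by
  have h1 : 0 < t - s := sub_pos.2 hst
  have h2 : 0 < τ - t := sub_pos.2 htτ
  refine le_min ?_ ?_
  · rw [rpow_mul_ratioPow hst htτ.le, mul_comm]
    refine mul_le_mul_of_nonneg_right ?_ (by positivity)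
    exact Real.rpow_le_rpow_of_nonpos h2 (by linarith) (by linarith)
  · rw [add_sub_cancel_right]
    exact (mul_le_of_le_one_right (by positivity) (ratioPow_le_one hγ hst.le htτ.le)).trans
      (Real.rpow_le_rpow h1.le (by linarith) hν)

/-- One of `τ - t` and `t - s` is at least half of `τ - s`; the first case uses the first entry of
the minimum, the second case the other one. The factor `2^{ν+γ}` is lost only in reading the
hypotheses, since `le_weight` has constant `1`. -/
lemma weight_le {ν γ s t τ : ℝ} (hν : 0 ≤ ν) (hγ : 0 ≤ γ) (hst : s < t) (htτ : t < τ) :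
    weight (ν + γ) γ s t τ ≤ 2 ^ (ν + γ) * ((t - s) ^ ν * ratioPow γ s t τ) := by
  have h1 : 0 < t - s := sub_pos.2 hst
  have h2 : 0 < τ - t := sub_pos.2 htτ
  have h3 : 0 < τ - s := by linarith
  rw [rpow_mul_ratioPow hst htτ.le]
  rcases le_total (t - s) (τ - t) with h | h
  · refine (min_le_left _ _).trans ?_
    have h4 : (τ - t) ^ (-γ) ≤ 2 ^ (ν + γ) * (τ - s) ^ (-γ) := by
      calc (τ - t) ^ (-γ) ≤ ((τ - s) / 2) ^ (-γ) :=
            Real.rpow_le_rpow_of_nonpos (by linarith) (by linarith) (by linarith)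
        _ = 2 ^ γ * (τ - s) ^ (-γ) := by
            rw [Real.div_rpow h3.le (by norm_num), Real.rpow_neg (by norm_num : (0:ℝ) ≤ 2),
              div_inv_eq_mul, mul_comm]
        _ ≤ _ := by
            refine mul_le_mul_of_nonneg_right ?_ (by positivity)
            exact Real.rpow_le_rpow_of_exponent_le one_le_two (by linarith)
    calc (τ - t) ^ (-γ) * (t - s) ^ (ν + γ)
        ≤ 2 ^ (ν + γ) * (τ - s) ^ (-γ) * (t - s) ^ (ν + γ) :=
          mul_le_mul_of_nonneg_right h4 (by positivity)
      _ = _ := by ring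
  · refine (min_le_right _ _).trans ?_
    calc (τ - s) ^ (ν + γ - γ) = (τ - s) ^ (ν + γ) * (τ - s) ^ (-γ) := by
          rw [← Real.rpow_add h3, ← sub_eq_add_neg]
      _ ≤ (2 * (t - s)) ^ (ν + γ) * (τ - s) ^ (-γ) := by
          refine mul_le_mul_of_nonneg_right ?_ (by positivity)
          exact Real.rpow_le_rpow h3.le (by linarith) (by linarith)
      _ = _ := by rw [Real.mul_rpow (by norm_num) h1.le]; ring

lemma norm_le_of_enorm_div_le {x : A} {w Q : ℝ} (hw : 0 < w) (hQ : 0 ≤ Q)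
    (h : ‖x‖ₑ / ENNReal.ofReal w ≤ ENNReal.ofReal Q) : ‖x‖ ≤ Q * w := by
  rw [ENNReal.div_le_iff (by simpa using hw) ENNReal.ofReal_ne_top, ← ENNReal.ofReal_mul hQ,
    ← ofReal_norm, ENNReal.ofReal_le_ofReal_iff (by positivity)] at h
  exact h

lemma enorm_div_le_of_norm_le {x : A} {w Q : ℝ} (hw : 0 < w) (hQ : 0 ≤ Q) (h : ‖x‖ ≤ Q * w) :
    ‖x‖ₑ / ENNReal.ofReal w ≤ ENNReal.ofReal Q := by
  rw [ENNReal.div_le_iff (by simpa using hw) ENNReal.ofReal_ne_top, ← ENNReal.ofReal_mul hQ,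
    ← ofReal_norm]
  exact ENNReal.ofReal_le_ofReal h

variable {T ν γ Q : ℝ} {f : ℝ → ℝ → ℝ → A}

lemma norm_le_of_norm1_le (hν : 0 ≤ ν) (hγ : 0 ≤ γ) (hQ : 0 ≤ Q)
    (h : norm1 T (ν + γ) γ f ≤ ENNReal.ofReal Q) {s t τ : ℝ} (hs : 0 ≤ s) (hst : s < t)
    (htτ : t < τ) (hτ : τ ≤ T) :
    ‖f s t τ‖ ≤ Q * 2 ^ (ν + γ) * (t - s) ^ ν * ratioPow γ s t τ := by
  have h1 : ‖f s t τ‖ₑ / ENNReal.ofReal (weight (ν + γ) γ s t τ) ≤ ENNReal.ofReal Q := by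
    refine le_trans ?_ h
    refine le_iSup_of_le s (le_iSup_of_le t (le_iSup_of_le τ (le_iSup_of_le ?_ le_rfl)))
    exact ⟨hs, hst, htτ, hτ⟩
  refine (norm_le_of_enorm_div_le (weight_pos hst htτ) hQ h1).trans ?_
  refine (mul_le_mul_of_nonneg_left (weight_le hν hγ hst htτ) hQ).trans (le_of_eq (by ring))

lemma norm1_le_of_norm_le (hν : 0 ≤ ν) (hγ : 0 ≤ γ) (hQ : 0 ≤ Q)
    (h : ∀ {s t τ : ℝ}, 0 ≤ s → s ≤ t → t ≤ τ → τ ≤ T →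
      ‖f s t τ‖ ≤ Q * (t - s) ^ ν * ratioPow γ s t τ) :
    norm1 T (ν + γ) γ f ≤ ENNReal.ofReal Q := by
  refine iSup₂_le fun s t => iSup₂_le fun τ ⟨hs, hst, htτ, hτ⟩ => ?_
  refine enorm_div_le_of_norm_le (weight_pos hst htτ) hQ ((h hs hst.le htτ.le hτ).trans ?_)
  rw [mul_assoc]
  exact mul_le_mul_of_nonneg_left (le_weight hν hγ hst htτ) hQ

/-- The exponents `η = 0` and `η = 1` suffice, as the minimum of `1` and `(τ-q)/(q-t)` is at most `2
(τ-q)/(τ-t)`. -/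
lemma norm_sub_le_of_norm12_le (hν : 0 ≤ ν) (hγ : 0 ≤ γ) (hQ : 0 ≤ Q)
    (h : norm12 T (ν + γ) γ f ≤ ENNReal.ofReal Q) {s t q τ : ℝ} (hs : 0 ≤ s) (hst : s < t)
    (htq : t < q) (hqτ : q < τ) (hτ : τ ≤ T) :
    ‖f s t τ - f s t q‖ ≤ 2 * Q * 2 ^ (ν + γ) * (t - s) ^ ν *
      ((τ - q) / (τ - t) * ratioPow γ s t q) := by
  have hw := weight_pos (ν := ν + γ) (γ := γ) hst htq
  have h1 : 0 < τ - q := sub_pos.2 hqτ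
  have h2 : 0 < q - t := sub_pos.2 htq
  have h3 : 0 < τ - t := by linarith
  have key : ∀ η : ℝ, 0 ≤ η → η ≤ 1 →
      ‖f s t τ - f s t q‖ ≤ Q * ((τ - q) ^ η * (q - t) ^ (-η) * weight (ν + γ) γ s t q) := by
    intro η hη0 hη1
    refine norm_le_of_enorm_div_le (by positivity) hQ (le_trans ?_ h)
    refine le_iSup_of_le s (le_iSup_of_le t (le_iSup_of_le q (le_iSup_of_le τ
      (le_iSup_of_le η (le_iSup_of_le ?_ le_rfl)))))
    exact ⟨hs, hst, htq, hqτ, hτ, hη0, hη1⟩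
  have hκ : ‖f s t τ - f s t q‖ ≤ Q * (2 * ((τ - q) / (τ - t)) * weight (ν + γ) γ s t q) := by
    rcases le_total (τ - q) (q - t) with h4 | h4
    · refine (key 1 zero_le_one le_rfl).trans ?_
      rw [Real.rpow_one, Real.rpow_neg_one, ← div_eq_mul_inv]
      refine mul_le_mul_of_nonneg_left (mul_le_mul_of_nonneg_right ?_ hw.le) hQ
      rw [mul_div_assoc', div_le_div_iff₀ h2 h3]
      nlinarith
    · refine (key 0 le_rfl zero_le_one).trans ?_
      rw [Real.rpow_zero, neg_zero, Real.rpow_zero, mul_one]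
      refine mul_le_mul_of_nonneg_left (mul_le_mul_of_nonneg_right ?_ hw.le) hQ
      rw [mul_div_assoc', le_div_iff₀ h3]
      linarith
  refine hκ.trans ?_
  have h5 := weight_le hν hγ hst htq
  calc Q * (2 * ((τ - q) / (τ - t)) * weight (ν + γ) γ s t q)
      ≤ Q * (2 * ((τ - q) / (τ - t)) * (2 ^ (ν + γ) * ((t - s) ^ ν * ratioPow γ s t q))) := by
        gcongr
    _ = _ := by ring

lemma norm12_le_of_norm_sub_le (hν : 0 ≤ ν) (hγ : 0 ≤ γ) (hQ : 0 ≤ Q)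
    (h : ∀ {s t q τ : ℝ}, 0 ≤ s → s ≤ t → t ≤ q → q ≤ τ → τ ≤ T →
      ‖f s t τ - f s t q‖ ≤ Q * (t - s) ^ ν * ((τ - q) / (τ - t) * ratioPow γ s t q)) :
    norm12 T (ν + γ) γ f ≤ ENNReal.ofReal Q := by
  refine iSup₂_le fun s t => iSup₂_le fun q τ => iSup₂_le
    fun η ⟨hs, hst, htq, hqτ, hτ, hη0, hη1⟩ => ?_
  have hw := weight_pos (ν := ν + γ) (γ := γ) hst htq
  have h1 : 0 < τ - q := sub_pos.2 hqτ
  have h2 : 0 < q - t := sub_pos.2 htq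
  have h3 : 0 < τ - t := by linarith
  refine enorm_div_le_of_norm_le (by positivity) hQ ((h hs hst.le htq.le hqτ.le hτ).trans ?_)
  have hκ0 : 0 ≤ (τ - q) / (τ - t) := by positivity
  -- The ratio is at most `1`, so it is bounded by its power `η`, and `q - t ≤ τ - t`.
  have h4 : (τ - q) / (τ - t) ≤ (τ - q) ^ η * (q - t) ^ (-η) := by
    calc (τ - q) / (τ - t) ≤ ((τ - q) / (τ - t)) ^ η := by
          simpa using Real.rpow_le_rpow_of_exponent_ge' hκ0
            (div_le_one_of_le₀ (by linarith) h3.le) hη0 hη1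
      _ ≤ ((τ - q) / (q - t)) ^ η := by
          refine Real.rpow_le_rpow hκ0 ?_ hη0
          exact div_le_div_of_nonneg_left h1.le h2 (by linarith)
      _ = _ := by rw [Real.div_rpow h1.le h2.le, Real.rpow_neg h2.le, div_eq_mul_inv]
  calc Q * (t - s) ^ ν * ((τ - q) / (τ - t) * ratioPow γ s t q)
      = Q * ((τ - q) / (τ - t) * ((t - s) ^ ν * ratioPow γ s t q)) := by ring
    _ ≤ Q * ((τ - q) ^ η * (q - t) ^ (-η) * weight (ν + γ) γ s t q) := by
        refine mul_le_mul_of_nonneg_left ?_ hQ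
        refine mul_le_mul h4 (le_weight hν hγ hst htq) ?_ (by positivity)
        exact mul_nonneg (Real.rpow_nonneg (by linarith) _) (ratioPow_nonneg hst.le htq.le)

lemma ContinuousOn.tendsto_of_curve
    (hf : ContinuousOn (fun x : ℝ × ℝ × ℝ => f x.1 x.2.1 x.2.2) (simplex T))
    {l : Filter ℝ} {s t τ : ℝ → ℝ} {s₀ t₀ τ₀ : ℝ} (hs : Filter.Tendsto s l (nhds s₀))
    (ht : Filter.Tendsto t l (nhds t₀)) (hτ : Filter.Tendsto τ l (nhds τ₀))
    (h0 : (s₀, t₀, τ₀) ∈ simplex T) (h : ∀ᶠ x in l, (s x, t x, τ x) ∈ simplex T) :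
    Filter.Tendsto (fun x => f (s x) (t x) (τ x)) l (nhds (f s₀ t₀ τ₀)) :=
  (hf _ h0).tendsto.comp
    (tendsto_nhdsWithin_iff.2 ⟨hs.prodMk_nhds (ht.prodMk_nhds hτ), h⟩)

/-- A bound in the interior of the simplex extends to the diagonal `t = τ`. -/
lemma norm_le_of_norm_le_interior
    (hf : ContinuousOn (fun x : ℝ × ℝ × ℝ => f x.1 x.2.1 x.2.2) (simplex T))
    (hself : ∀ s τ, 0 ≤ s → s ≤ τ → τ ≤ T → f s s τ = 0) (hQ : 0 ≤ Q)
    (h : ∀ {s t τ : ℝ}, 0 ≤ s → s < t → t < τ → τ ≤ T →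
      ‖f s t τ‖ ≤ Q * (t - s) ^ ν * ratioPow γ s t τ) {s t τ : ℝ}
    (hs : 0 ≤ s) (hst : s ≤ t) (htτ : t ≤ τ) (hτ : τ ≤ T) :
    ‖f s t τ‖ ≤ Q * (t - s) ^ ν * ratioPow γ s t τ := by
  rcases hst.eq_or_lt with rfl | hst'
  · rw [hself s τ hs htτ hτ, norm_zero]
    have := ratioPow_nonneg (γ := γ) (le_refl s) htτ
    have : (0 : ℝ) ≤ (s - s) ^ ν := Real.rpow_nonneg (by simp) _
    positivity
  rcases htτ.eq_or_lt with rfl | htτ'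
  · have hmem : ∀ᶠ x in nhdsWithin t (Set.Iio t), s < x ∧ x < t :=
      Filter.eventually_of_mem (Ioo_mem_nhdsLT hst') fun x hx => hx
    have hid : Filter.Tendsto (fun x : ℝ => x) (nhdsWithin t (Set.Iio t)) (nhds t) :=
      nhdsWithin_le_nhds
    have h1 := (ContinuousOn.tendsto_of_curve hf
      (tendsto_const_nhds (x := s)) hid (tendsto_const_nhds (x := t)) ⟨hs, hst, le_rfl, hτ⟩
      (hmem.mono fun x hx => ⟨hs, hx.1.le, hx.2.le, hτ⟩)).norm
    have hts : t - s ≠ 0 := by linarith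
    have h2 : Filter.Tendsto (fun x => Q * (x - s) ^ ν * ratioPow γ s x t)
        (nhdsWithin t (Set.Iio t)) (nhds (Q * (t - s) ^ ν * ratioPow γ s t t)) := by
      refine ((((hid.sub_const s).rpow_const (Or.inl hts)).const_mul Q).mul ?_)
      exact ((hid.sub_const s).div_const (t - s)).rpow_const (Or.inl (div_ne_zero hts hts))
    exact le_of_tendsto_of_tendsto h1 h2 (hmem.mono fun x hx => h hs hx.1 hx.2 hτ)
  · exact h hs hst' htτ' hτ

/-- The seminorms see only the interior, whereas germs also evaluate at `q = t`. That case follows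
by letting `q` decrease to `t`. -/
lemma norm_sub_le_of_norm_sub_le_interior
    (hf : ContinuousOn (fun x : ℝ × ℝ × ℝ => f x.1 x.2.1 x.2.2) (simplex T))
    (hself : ∀ s τ, 0 ≤ s → s ≤ τ → τ ≤ T → f s s τ = 0) (hQ : 0 ≤ Q)
    (h : ∀ {s t q τ : ℝ}, 0 ≤ s → s < t → t < q → q < τ → τ ≤ T →
      ‖f s t τ - f s t q‖ ≤ Q * (t - s) ^ ν * ((τ - q) / (τ - t) * ratioPow γ s t q))
    {s t q τ : ℝ} (hs : 0 ≤ s) (hst : s ≤ t) (htq : t ≤ q) (hqτ : q ≤ τ) (hτ : τ ≤ T) :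
    ‖f s t τ - f s t q‖ ≤ Q * (t - s) ^ ν * ((τ - q) / (τ - t) * ratioPow γ s t q) := by
  have hnn : 0 ≤ Q * (t - s) ^ ν * ((τ - q) / (τ - t) * ratioPow γ s t q) :=
    mul_nonneg (mul_nonneg hQ (Real.rpow_nonneg (by linarith) _))
      (mul_nonneg (ratio_nonneg htq hqτ) (ratioPow_nonneg hst htq))
  rcases hst.eq_or_lt with rfl | hst'
  · rwa [hself s τ hs (htq.trans hqτ) hτ, hself s q hs htq (hqτ.trans hτ), sub_zero, norm_zero]
  rcases hqτ.eq_or_lt with rfl | hqτ'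
  · rwa [sub_self, norm_zero]
  rcases htq.eq_or_lt with rfl | htq'
  · have hmem : ∀ᶠ x in nhdsWithin t (Set.Ioi t), t < x ∧ x < τ :=
      Filter.eventually_of_mem (Ioo_mem_nhdsGT hqτ') fun x hx => hx
    have hid : Filter.Tendsto (fun x : ℝ => x) (nhdsWithin t (Set.Ioi t)) (nhds t) :=
      nhdsWithin_le_nhds
    have h1 := ((tendsto_const_nhds (x := f s t τ)).sub (ContinuousOn.tendsto_of_curve hf
      (tendsto_const_nhds (x := s)) (tendsto_const_nhds (x := t)) hid
      ⟨hs, hst, le_rfl, hqτ.trans hτ⟩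
      (hmem.mono fun x hx => ⟨hs, hst, hx.1.le, hx.2.le.trans hτ⟩))).norm
    have hts : t - s ≠ 0 := by linarith
    have h2 : Filter.Tendsto
        (fun x => Q * (t - s) ^ ν * ((τ - x) / (τ - t) * ratioPow γ s t x))
        (nhdsWithin t (Set.Ioi t))
        (nhds (Q * (t - s) ^ ν * ((τ - t) / (τ - t) * ratioPow γ s t t))) := by
      refine (((hid.const_sub τ).div_const _).mul ?_).const_mul _
      exact ((tendsto_const_nhds (x := t - s)).div (hid.sub_const s) hts).rpow_const
        (Or.inl (div_ne_zero hts hts))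
    exact le_of_tendsto_of_tendsto h1 h2 (hmem.mono fun x hx => h hs hst' hx.1 hx.2 hτ)
  · exact h hs hst' htq' hqτ' hτ

/-- Chen's relation forces the positive levels to vanish on the diagonal. -/
lemma level_self_eq_zero {z : ℕ → ℝ → ℝ → ℝ → A} {m : ℕ}
    {s τ : ℝ} (h : z m s s τ = z m s s τ + z m s s τ +
      ∑ i ∈ Finset.Ico 1 m, conv z (m - i) (z i s s) s s τ) : z m s s τ = 0 := by
  rw [Finset.sum_eq_zero fun i hi => conv_self z (by rw [Finset.mem_Ico] at hi; omega) _ _ _,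
    add_zero] at h
  exact left_eq_add.1 h

end Weights
/-! ### The constants -/

/-- Log-convexity between `x + 1` and `x + 2` gives `Γ(x+3/2) ≤ (x+1)^{1/2} Γ(x+1)`. The left side
is `(x+1/2) Γ(x+1/2)`, and `x + 1 ≤ 2 (x+1/2)`. -/
lemma Gamma_add_half_le {x : ℝ} (hx : 0 ≤ x) :
    Real.Gamma (x + 1 / 2) ≤ 2 * Real.Gamma (x + 1) := by
  have hG : 0 < Real.Gamma (x + 1) := Real.Gamma_pos_of_pos (by linarith)
  have h1 := Real.Gamma_mul_add_mul_le_rpow_Gamma_mul_rpow_Gamma (s := x + 1) (t := x + 1 + 1)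
    (a := 1 / 2) (b := 1 / 2) (by linarith) (by linarith) (by norm_num) (by norm_num) (by norm_num)
  rw [Real.Gamma_add_one (by linarith : x + 1 ≠ 0), Real.mul_rpow (by linarith) hG.le,
    mul_left_comm, ← Real.rpow_add hG, add_halves, Real.rpow_one,
    show 1 / 2 * (x + 1) + 1 / 2 * (x + 1 + 1) = (x + 1 / 2) + 1 by ring,
    Real.Gamma_add_one (by linarith)] at h1
  have h2 : (x + 1) ^ (1 / 2 : ℝ) ≤ x + 1 := by
    simpa using Real.rpow_le_rpow_of_exponent_le (x := x + 1) (y := 1 / 2) (z := 1) (by linarith)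
      (by norm_num)
  have h3 : (x + 1 / 2) * Real.Gamma (x + 1 / 2) ≤ (x + 1 / 2) * (2 * Real.Gamma (x + 1)) := by
    refine h1.trans ((mul_le_mul_of_nonneg_right h2 hG.le).trans ?_)
    nlinarith
  exact le_of_mul_le_mul_left h3 (by linarith)

/-- The binomial-type coefficient `Γ(a+b+1) / (Γ(a+1) Γ(b+1))` is at most `2 · 2^{a+b}`. -/
lemma Gamma_add_le {a b : ℝ} (ha : 0 ≤ a) (hb : 0 ≤ b) :
    Real.Gamma (a + b + 1) ≤
      2 * 2 ^ (a + b) * (Real.Gamma (a + 1) * Real.Gamma (b + 1)) := by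
  have hGa : 0 < Real.Gamma (a + 1) := Real.Gamma_pos_of_pos (by linarith)
  have hGb : 0 < Real.Gamma (b + 1) := Real.Gamma_pos_of_pos (by linarith)
  -- Log-convexity at the mean `x` gives `Γ(x+1)² ≤ Γ(a+1) Γ(b+1)`, and the duplication formula at
  -- `x + 1/2` expresses `Γ(a+b+1)` through `Γ(x+1/2) Γ(x+1)`.
  set x := (a + b) / 2 with hx
  have hx0 : 0 ≤ x := by positivity
  have hGx : 0 < Real.Gamma (x + 1) := Real.Gamma_pos_of_pos (by linarith)
  have h1 := Real.Gamma_mul_add_mul_le_rpow_Gamma_mul_rpow_Gamma (s := a + 1) (t := b + 1)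
    (a := 1 / 2) (b := 1 / 2) (by linarith) (by linarith) (by norm_num) (by norm_num) (by norm_num)
  rw [show 1 / 2 * (a + 1) + 1 / 2 * (b + 1) = x + 1 by rw [hx]; ring,
    ← Real.mul_rpow hGa.le hGb.le, ← Real.sqrt_eq_rpow, Real.le_sqrt hGx.le (by positivity)] at h1
  have h2 := Real.Gamma_mul_Gamma_add_half (x + 1 / 2)
  rw [show x + 1 / 2 + 1 / 2 = x + 1 by ring, show 2 * (x + 1 / 2) = a + b + 1 by rw [hx]; ring,
    show 1 - (a + b + 1) = -(a + b) by ring, Real.rpow_neg (by norm_num)] at h2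
  have h3 : (1 : ℝ) ≤ √Real.pi := Real.one_le_sqrt.2 (by linarith [Real.pi_gt_three])
  have h4 := Gamma_add_half_le hx0
  have hp : (0 : ℝ) < 2 ^ (a + b) := by positivity
  have hG : 0 < Real.Gamma (a + b + 1) := Real.Gamma_pos_of_pos (by linarith)
  have h5 : Real.Gamma (a + b + 1) * (2 ^ (a + b))⁻¹ ≤
      2 * (Real.Gamma (a + 1) * Real.Gamma (b + 1)) := by
    calc Real.Gamma (a + b + 1) * (2 ^ (a + b))⁻¹
        ≤ Real.Gamma (a + b + 1) * (2 ^ (a + b))⁻¹ * √Real.pi :=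
          le_mul_of_one_le_right (by positivity) h3
      _ = Real.Gamma (x + 1 / 2) * Real.Gamma (x + 1) := h2.symm
      _ ≤ 2 * Real.Gamma (x + 1) * Real.Gamma (x + 1) := mul_le_mul_of_nonneg_right h4 hGx.le
      _ = 2 * Real.Gamma (x + 1) ^ 2 := by ring
      _ ≤ _ := by linarith
  rw [← div_eq_mul_inv, div_le_iff₀ hp] at h5
  linarith

lemma sum_Ico_one_div_sq_le (p : ℕ) :
    ∑ i ∈ Finset.Ico 1 p, (1 : ℝ) / ((i : ℝ) + 1) ^ 2 ≤ 1 := by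
  have h : ∀ p : ℕ, ∑ i ∈ Finset.Ico 1 (p + 1), (1 : ℝ) / ((i : ℝ) + 1) ^ 2 ≤
      1 - 1 / ((p : ℝ) + 1) := by
    intro p
    induction p with
    | zero => simp
    | succ p ih =>
      rw [Finset.sum_Ico_succ_top (by omega)]
      have : (1 : ℝ) / (((p + 1 : ℕ) : ℝ) + 1) ^ 2 ≤ 1 / (p + 1) - 1 / (((p + 1 : ℕ) : ℝ) + 1) := by
        push_cast
        rw [div_sub_div _ _ (by positivity) (by positivity),
          div_le_div_iff₀ (by positivity) (by positivity)]
        have : (0 : ℝ) ≤ p := Nat.cast_nonneg p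
        nlinarith
      linarith
  rcases Nat.eq_zero_or_pos p with rfl | hp
  · simp
  · obtain ⟨q, rfl⟩ : ∃ q, p = q + 1 := ⟨p - 1, by omega⟩
    have : (0 : ℝ) ≤ 1 / (q + 1) := by positivity
    linarith [h q]

lemma sum_Ico_reflect_sub (f : ℕ → ℝ) (p : ℕ) :
    ∑ i ∈ Finset.Ico 1 p, f (p - i) = ∑ i ∈ Finset.Ico 1 p, f i :=
  Finset.sum_nbij' (fun i => p - i) (fun i => p - i)
    (fun i hi => by simp only [Finset.mem_Ico] at hi ⊢; omega)
    (fun i hi => by simp only [Finset.mem_Ico] at hi ⊢; omega)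
    (fun i hi => by simp only [Finset.mem_Ico] at hi ⊢; omega)
    (fun i hi => by simp only [Finset.mem_Ico] at hi ⊢; omega) (fun _ _ => rfl)

/-- With `x + y = p`, the inequality `(x+y+1)² ≤ 2 ((x+1)² + (y+1)²)` separates the product into two
inverse squares, and each of their sums is at most `1`. -/
lemma sum_Ico_inv_sq_mul_inv_sq_le (p : ℕ) :
    ∑ i ∈ Finset.Ico 1 p, (1 : ℝ) / (((i : ℝ) + 1) ^ 2 * (((p - i : ℕ) : ℝ) + 1) ^ 2) ≤
      4 / ((p : ℝ) + 1) ^ 2 := by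
  have h1 : ∀ i ∈ Finset.Ico 1 p,
      (1 : ℝ) / (((i : ℝ) + 1) ^ 2 * (((p - i : ℕ) : ℝ) + 1) ^ 2) ≤
      2 / ((p : ℝ) + 1) ^ 2 * (1 / ((i : ℝ) + 1) ^ 2 + 1 / (((p - i : ℕ) : ℝ) + 1) ^ 2) := by
    intro i hi
    rw [Finset.mem_Ico] at hi
    have hp : (p : ℝ) = i + ((p - i : ℕ) : ℝ) := by rw [Nat.cast_sub hi.2.le]; ring
    rw [hp]
    have ha : (0 : ℝ) ≤ i := Nat.cast_nonneg _
    have hb : (0 : ℝ) ≤ ((p - i : ℕ) : ℝ) := Nat.cast_nonneg _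
    generalize ((p - i : ℕ) : ℝ) = y at hb
    generalize (i : ℝ) = x at ha
    rw [div_add_div _ _ (by positivity) (by positivity), div_mul_div_comm,
      div_le_div_iff₀ (by positivity) (by positivity)]
    have h2 : (x + y + 1) ^ 2 ≤ 2 * (1 * (y + 1) ^ 2 + (x + 1) ^ 2 * 1) := by
      nlinarith [sq_nonneg (x - y)]
    have h3 : 0 ≤ (x + 1) ^ 2 * (y + 1) ^ 2 := by positivity
    nlinarith [mul_le_mul_of_nonneg_right h2 h3]
  refine (Finset.sum_le_sum h1).trans ?_
  rw [← Finset.mul_sum, Finset.sum_add_distrib,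
    sum_Ico_reflect_sub (fun i => 1 / ((i : ℝ) + 1) ^ 2) p]
  have h2 := sum_Ico_one_div_sq_le p
  calc 2 / ((p : ℝ) + 1) ^ 2 * (_ + _) ≤ 2 / ((p : ℝ) + 1) ^ 2 * (1 + 1) := by gcongr
    _ = _ := by ring

/-- The constants `b Λ^p / ((p+1)² Γ(pρ+1))`. -/
noncomputable def levelConst (ρ b Λ : ℝ) (p : ℕ) : ℝ :=
  b * Λ ^ p / (((p : ℝ) + 1) ^ 2 * Real.Gamma (p * ρ + 1))

lemma Gamma_level_pos {ρ : ℝ} (hρ : 0 ≤ ρ) (p : ℕ) : 0 < Real.Gamma (p * ρ + 1) :=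
  Real.Gamma_pos_of_pos (by positivity)

lemma levelConst_nonneg {ρ b Λ : ℝ} (hρ : 0 ≤ ρ) (hb : 0 ≤ b) (hΛ : 0 ≤ Λ) (p : ℕ) :
    0 ≤ levelConst ρ b Λ p := by
  have := Gamma_level_pos hρ p
  unfold levelConst
  positivity

/-- The `8` is the `2` of `Gamma_add_le` times the `4` of the inverse squares. A product of two
constants carries `b²`, which leaves one spare factor `b` to be chosen small. -/
lemma sum_levelConst_le {ρ b Λ : ℝ} (hρ : 0 ≤ ρ) (hΛ : 0 ≤ Λ) (p : ℕ) :
    ∑ i ∈ Finset.Ico 1 p, levelConst ρ b Λ i * levelConst ρ b Λ (p - i) ≤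
      8 * b * 2 ^ (p * ρ) * levelConst ρ b Λ p := by
  have hG := Gamma_level_pos hρ p
  have h1 : ∀ i ∈ Finset.Ico 1 p, levelConst ρ b Λ i * levelConst ρ b Λ (p - i) ≤
      b ^ 2 * Λ ^ p * (2 * 2 ^ (p * ρ) / Real.Gamma (p * ρ + 1)) *
        (1 / (((i : ℝ) + 1) ^ 2 * (((p - i : ℕ) : ℝ) + 1) ^ 2)) := by
    intro i hi
    rw [Finset.mem_Ico] at hi
    have hGi := Gamma_level_pos hρ i
    have hGj := Gamma_level_pos hρ (p - i)
    have h2 := Gamma_add_le (a := i * ρ) (b := ((p - i : ℕ) : ℝ) * ρ) (by positivity)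
      (by positivity)
    rw [← add_mul, ← Nat.cast_add, Nat.add_sub_cancel' hi.2.le] at h2
    have h3 : 1 / (Real.Gamma (i * ρ + 1) * Real.Gamma (((p - i : ℕ) : ℝ) * ρ + 1)) ≤
        2 * 2 ^ (p * ρ) / Real.Gamma (p * ρ + 1) := by
      rw [div_le_div_iff₀ (by positivity) hG, one_mul]
      exact h2
    have h4 : Λ ^ i * Λ ^ (p - i) = Λ ^ p := by rw [← pow_add, Nat.add_sub_cancel' hi.2.le]
    calc levelConst ρ b Λ i * levelConst ρ b Λ (p - i)
        = b ^ 2 * (Λ ^ i * Λ ^ (p - i)) *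
          (1 / (Real.Gamma (i * ρ + 1) * Real.Gamma (((p - i : ℕ) : ℝ) * ρ + 1))) *
          (1 / (((i : ℝ) + 1) ^ 2 * (((p - i : ℕ) : ℝ) + 1) ^ 2)) := by
          unfold levelConst
          field_simp
      _ ≤ _ := by rw [h4]; gcongr
  refine (Finset.sum_le_sum h1).trans ?_
  rw [← Finset.mul_sum]
  refine (mul_le_mul_of_nonneg_left (sum_Ico_inv_sq_mul_inv_sq_le p) (by positivity)).trans
    (le_of_eq ?_)
  unfold levelConst
  field_simp
  ring

lemma succ_sq_le_four_pow {j : ℕ} (hj : 1 ≤ j) : ((j : ℝ) + 1) ^ 2 ≤ 4 ^ j := by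
  have h : (j : ℝ) + 1 ≤ 2 ^ j := by exact_mod_cast Nat.lt_two_pow_self (n := j)
  calc ((j : ℝ) + 1) ^ 2 ≤ (2 ^ j) ^ 2 := by gcongr
    _ = 4 ^ j := by rw [← pow_mul, mul_comm, pow_mul]; norm_num

/-- Every loss is absorbed in a `j`-th power, which dictates `K`: `(j+1)² ≤ 4^j`, `2^{jρ}` from the
weight, and `2 · 2^γ C / b ≤ 4C/b ≤ (1 + 4C/b)^j`. -/
lemma le_levelConst {ρ γ b C M K : ℝ} (hρ : 0 ≤ ρ) (hγ1 : γ ≤ 1) (hb : 0 < b) (hC : 0 ≤ C)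
    (hM : 0 ≤ M) (hK : K = 4 * 2 ^ ρ * (1 + 4 * C / b)) {j : ℕ} (hj : 1 ≤ j) :
    2 * (C * (M ^ j / Real.Gamma (j * ρ + 1))) * 2 ^ (j * ρ + γ) ≤ levelConst ρ b (K * M) j := by
  have hG := Gamma_level_pos hρ j
  have h1 : 4 * C / b ≤ (1 + 4 * C / b) ^ j := by
    have h0 : 0 ≤ 4 * C / b := by positivity
    have := le_self_pow₀ (show 1 ≤ 1 + 4 * C / b by linarith) (show j ≠ 0 by omega)
    linarith
  have h2 := succ_sq_le_four_pow hj
  have h3 : (2 : ℝ) ^ γ ≤ 2 := by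
    simpa using Real.rpow_le_rpow_of_exponent_le one_le_two hγ1
  have h4 : ((2 : ℝ) ^ ρ) ^ j = 2 ^ (j * ρ) := by
    rw [← Real.rpow_natCast, ← Real.rpow_mul (by norm_num), mul_comm]
  have h5 : ((j : ℝ) + 1) ^ 2 * 2 ^ (j * ρ) * (4 * C / b) ≤ K ^ j := by
    rw [hK, mul_pow, mul_pow, h4]
    gcongr
  unfold levelConst
  rw [le_div_iff₀ (by positivity), Real.rpow_add (by norm_num), mul_pow]
  calc 2 * (C * (M ^ j / Real.Gamma (j * ρ + 1))) * (2 ^ (j * ρ) * 2 ^ γ) *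
        (((j : ℝ) + 1) ^ 2 * Real.Gamma (j * ρ + 1))
      = 2 * 2 ^ γ * C * ((j : ℝ) + 1) ^ 2 * 2 ^ (j * ρ) * M ^ j := by field_simp
    _ ≤ 2 * 2 * C * ((j : ℝ) + 1) ^ 2 * 2 ^ (j * ρ) * M ^ j := by gcongr
    _ = b * (((j : ℝ) + 1) ^ 2 * 2 ^ (j * ρ) * (4 * C / b)) * M ^ j := by field_simp; ring
    _ ≤ b * K ^ j * M ^ j := by gcongr
    _ = _ := by ring

lemma levelConst_le {ρ b K M : ℝ} (hρ : 0 ≤ ρ) (hb1 : b ≤ 1) (hK : 0 ≤ K)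
    (hM : 0 ≤ M) (m : ℕ) :
    levelConst ρ b (K * M) m ≤ K ^ m * (M ^ m / Real.Gamma (m * ρ + 1)) := by
  have hG := Gamma_level_pos hρ m
  unfold levelConst
  rw [mul_div_assoc', ← mul_pow]
  refine div_le_div₀ (by positivity) (mul_le_of_le_one_left (by positivity) hb1) hG ?_
  refine le_mul_of_one_le_left hG.le ?_
  have : (0 : ℝ) ≤ m := Nat.cast_nonneg m
  nlinarith

/-! ### The tensor powers -/

lemma mul_mem_tensorPow {E : Type*} [NormedAddCommGroup E] [NormedSpace ℝ E] (p q : ℕ)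
    (x y : BanachTensor E) (hx : x ∈ tensorPow E p) (hy : y ∈ tensorPow E q) :
    x * y ∈ tensorPow E (p + q) := by
  refine map_mem_closure₂ continuous_mul hx hy ?_
  rintro _ ⟨a, ha, rfl⟩ _ ⟨b, hb, rfl⟩
  refine ⟨a * b, ?_, UniformSpace.Completion.coe_mul a b⟩
  have := Submodule.mul_mem_mul ha hb
  rwa [← pow_add] at this

/-! ### Pointwise estimates for Volterra rough paths -/

section RoughPath

variable {E : Type*} [NormedAddCommGroup E] [NormedSpace ℝ E]
variable {α γ T C M : ℝ} {z : ℕ → ℝ → ℝ → ℝ → BanachTensor E}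

lemma IsConvolutionalFunctional.chen_relation {N : ℕ∞} (h : IsConvolutionalFunctional T N z)
    {m : ℕ} (hm : 1 ≤ m) (hmN : (m : ℕ∞) ≤ N) {s u t τ : ℝ} (hs : 0 ≤ s) (hsu : s ≤ u)
    (hut : u ≤ t) (ht : t ≤ τ) (hτ : τ ≤ T) :
    z m s t τ = z m u t τ + z m s u τ +
      ∑ i ∈ Finset.Ico 1 m, conv z (m - i) (z i s u) u t τ := by
  rw [h.chen m hmN s u t τ hs hsu hut ht hτ, sum_chenTerm z hm]

lemma IsConvolutionalFunctional.self_eq_zero {N : ℕ∞} (h : IsConvolutionalFunctional T N z)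
    {m : ℕ} (hm : 1 ≤ m) (hmN : (m : ℕ∞) ≤ N) (s τ : ℝ) (hs : 0 ≤ s) (hsτ : s ≤ τ) (hτ : τ ≤ T) :
    z m s s τ = 0 :=
  level_self_eq_zero (h.chen_relation hm hmN hs le_rfl le_rfl hsτ hτ)

/-- A Volterra rough path satisfies the pointwise estimates with the constants `levelConst`. -/
lemma IsRoughPath.levelBounds (h : IsRoughPath α γ T C M z) (hρ : 0 < α - γ) (hγ₀ : 0 ≤ γ)
    (hγ₁ : γ ≤ 1) (hC : 0 ≤ C) (hM : 0 ≤ M) {b K : ℝ} (hb : 0 < b)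
    (hK : K = 4 * 2 ^ (α - γ) * (1 + 4 * C / b)) :
    LevelBounds T (α - γ) γ (levelConst (α - γ) b (K * M)) ⌊1 / (α - γ)⌋₊ z := by
  have hf := h.functional
  have hN : ∀ {p : ℕ}, p ≤ ⌊1 / (α - γ)⌋₊ → (p : ℕ∞) ≤ ((⌊1 / (α - γ)⌋₊ : ℕ) : ℕ∞) :=
    fun hp => by exact_mod_cast hp
  have hQ : ∀ p : ℕ, 0 ≤ C * (M ^ p / Real.Gamma (p * (α - γ) + 1)) := fun p => by
    have := Gamma_level_pos hρ.le p
    positivity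
  have hQ2 : ∀ p : ℕ, 0 ≤ C * (M ^ p / Real.Gamma (p * (α - γ) + 1)) *
      2 ^ (p * (α - γ) + γ) := fun p => mul_nonneg (hQ p) (by positivity)
  refine ⟨fun {p} hp hpn {s t τ} hs hst ht hτ => ?_,
    fun {p} hp hpn {s t q τ} hs hst ht hq hτ => ?_,
    fun {p} hp hpn {s u t τ} hs hsu hut ht hτ =>
      hf.chen_relation hp (hN hpn) hs hsu hut ht hτ⟩
  · have hν : 0 ≤ p * (α - γ) := by positivity
    refine (norm_le_of_norm_le_interior (hf.continuousOn p (hN hpn)) (hf.self_eq_zero hp (hN hpn))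
      (hQ2 p) (fun hs hst ht hτ =>
        norm_le_of_norm1_le hν hγ₀ (hQ p) (h.norm1_le p hp hpn) hs hst ht hτ) hs hst ht hτ).trans ?_
    refine mul_le_mul_of_nonneg_right (mul_le_mul_of_nonneg_right ?_
      (Real.rpow_nonneg (by linarith) _)) (ratioPow_nonneg hst ht)
    have h1 := le_levelConst hρ.le hγ₁ hb hC hM hK hp
    have h2 := hQ2 p
    linarith
  · have hν : 0 ≤ p * (α - γ) := by positivity
    refine (norm_sub_le_of_norm_sub_le_interior (hf.continuousOn p (hN hpn))
      (hf.self_eq_zero hp (hN hpn)) (Q := 2 * (C * (M ^ p / Real.Gamma (p * (α - γ) + 1))) *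
        2 ^ (p * (α - γ) + γ)) (by have := hQ2 p; linarith) (fun hs hst ht hq hτ =>
        norm_sub_le_of_norm12_le hν hγ₀ (hQ p) (h.norm12_le p hp hpn) hs hst ht hq hτ)
      hs hst ht hq hτ).trans ?_
    refine mul_le_mul_of_nonneg_right (mul_le_mul_of_nonneg_right ?_
      (Real.rpow_nonneg (by linarith) _))
      (mul_nonneg (ratio_nonneg ht hq) (ratioPow_nonneg hst ht))
    exact le_levelConst hρ.le hγ₁ hb hC hM hK hp

/-- A level of finite norm is bounded by a multiple of `(t-s)^{mρ}` on the closed simplex. -/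
lemma IsConvolutionalFunctional.exists_norm_le {N : ℕ∞} (h : IsConvolutionalFunctional T N z)
    {m : ℕ} (hm : 1 ≤ m) (hmN : (m : ℕ∞) ≤ N) (hγ : 0 ≤ γ) {ν : ℝ} (hν : 0 ≤ ν)
    (hfin : fullNorm T (ν + γ) γ (z m) < ⊤) :
    ∃ K, 0 ≤ K ∧ ∀ {s t τ : ℝ}, 0 ≤ s → s ≤ t → t ≤ τ → τ ≤ T →
      ‖z m s t τ‖ ≤ K * (t - s) ^ ν := by
  have h1 : norm1 T (ν + γ) γ (z m) ≠ ⊤ := (lt_of_le_of_lt le_self_add hfin).ne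
  set Q := (norm1 T (ν + γ) γ (z m)).toReal with hQ
  have hQ0 : 0 ≤ Q := ENNReal.toReal_nonneg
  have hQ1 : norm1 T (ν + γ) γ (z m) ≤ ENNReal.ofReal Q := (ENNReal.ofReal_toReal h1).ge
  refine ⟨Q * 2 ^ (ν + γ), by positivity, fun {s t τ} hs hst ht hτ => ?_⟩
  refine (norm_le_of_norm_le_interior (h.continuousOn m hmN) (h.self_eq_zero hm hmN)
    (by positivity) (fun hs hst ht hτ =>
      norm_le_of_norm1_le hν hγ hQ0 hQ1 hs hst ht hτ) hs hst ht hτ).trans ?_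
  have h0 : 0 ≤ t - s := sub_nonneg.2 hst
  exact mul_le_of_le_one_right (by positivity) (ratioPow_le_one hγ hst ht)

end RoughPath

end Volterra

/-! ### The extension theorem -/

open Volterra in
theorem mainTheorem2 (α γ C : ℝ) (hα₀ : 0 < α) (hα₁ : α < 1) (hγ₀ : 0 < γ) (hγ₁ : γ < 1)
    (hρ : 0 < α - γ) (hC : 0 < C) :
    ∃ K : ℝ, 0 < K ∧
      ∀ (E : Type*) [NormedAddCommGroup E] [NormedSpace ℝ E] [CompleteSpace E]
        (T M : ℝ) (z : ℕ → ℝ → ℝ → ℝ → BanachTensor E),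
        0 < T → 0 < M → Volterra.IsRoughPath α γ T C M z →
        ∃ Z : ℕ → ℝ → ℝ → ℝ → BanachTensor E,
          Volterra.IsExtension α γ T ⊤ z Z ∧
          -- every convolution product in the Chen relation is a genuine limit
          (∀ (p i : ℕ) (s u t τ : ℝ), 0 ≤ s → s ≤ u → u ≤ t → t ≤ τ → τ ≤ T →
            Volterra.ConvExists Z p (fun r => Z i s u r) u t τ) ∧
          -- factorial bounds
          (∀ m : ℕ, ⌊1 / (α - γ)⌋₊ + 1 ≤ m →
            Volterra.norm1 T (m * (α - γ) + γ) γ (Z m) ≤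
              ENNReal.ofReal (K ^ m * (M ^ m / Real.Gamma (m * (α - γ) + 1))) ∧
            Volterra.norm12 T (m * (α - γ) + γ) γ (Z m) ≤
              ENNReal.ofReal (K ^ m * (M ^ m / Real.Gamma (m * (α - γ) + 1)))) ∧
          -- uniqueness, of the whole extension and of each finite extension
          (∀ (N : ℕ∞) (Z' : ℕ → ℝ → ℝ → ℝ → BanachTensor E),
            Volterra.IsExtension α γ T N z Z' →
            ∀ m : ℕ, (m : ℕ∞) ≤ N → ∀ s t τ, (s, t, τ) ∈ Volterra.simplex T →
              Z' m s t τ = Z m s t τ) := by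
  set ρ := α - γ with hρdef
  set n := ⌊1 / ρ⌋₊ with hn
  have hn1 : 1 < ((n : ℝ) + 1) * ρ := by
    have := Nat.lt_floor_add_one (1 / ρ)
    rwa [div_lt_iff₀ hρ] at this
  -- The surplus of the exponent at the first new level, positive because `n = ⌊1/ρ⌋`.
  set σ := ((n : ℝ) + 1) * ρ - 1 with hσdef
  have hσ : 0 < σ := by linarith
  have hnσ : 1 + σ ≤ ((n : ℝ) + 1) * ρ := by rw [hσdef]; linarith
  set B := 1 + 2 * ∑' k, dyadicTerm ρ k with hB
  set S := ∑' k, dyadicTerm σ k with hS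
  have hB1 : 1 ≤ B := by
    have : 0 ≤ ∑' k, dyadicTerm ρ k := tsum_nonneg fun k => dyadicTerm_nonneg ρ k
    rw [hB]; linarith
  have hS0 : 0 ≤ S := tsum_nonneg fun k => dyadicTerm_nonneg σ k
  -- With `β = 8b` this makes `B² β (1 + S) = 1`. Both smallness conditions, `B² β ≤ 1` and `B β S ≤
  -- 1`, follow since `B ≥ 1`, and `b` depends only on `ρ`.
  set b := 1 / (8 * B ^ 2 * (1 + S)) with hb
  have hb0 : 0 < b := by positivity
  have hbeq : 8 * b * B ^ 2 * (1 + S) = 1 := by rw [hb]; field_simp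
  have hb1 : b ≤ 1 := by
    rw [hb, div_le_one (by positivity)]
    nlinarith [mul_nonneg (show 0 ≤ B ^ 2 by positivity) hS0]
  -- Only `ρ` and `C` enter, so `K` is fixed before `E`, `T`, `M` and the rough path.
  set K := 4 * 2 ^ ρ * (1 + 4 * C / b) with hK
  have hK0 : 0 < K := by positivity
  refine ⟨K, hK0, fun E _ _ _ T M z hT hM hz => ?_⟩
  set c := levelConst ρ b (K * M) with hc
  have hcn : ∀ p, 0 ≤ c p := levelConst_nonneg hρ.le hb0.le (by positivity)
  have hadm : Admissible ρ γ (8 * b) B c :=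
    { rho_pos := hρ
      gamma_pos := hγ₀
      c_nonneg := hcn
      sum_le := fun p _ => sum_levelConst_le hρ.le (by positivity) p
      le_B := le_rfl
      mul_le_one := by nlinarith [mul_nonneg (show 0 ≤ 8 * b * B ^ 2 by positivity) hS0] }
  have hβ : 0 ≤ 8 * b := by positivity
  have hβB : B * (8 * b) * S ≤ 1 := by
    have h1 : B * (8 * b) * S ≤ B * (8 * b) * S * B := le_mul_of_one_le_right (by positivity) hB1
    nlinarith [show 0 ≤ 8 * b * B ^ 2 by positivity]
  have hz0 : LevelBounds T ρ γ c n z := hz.levelBounds hρ hγ₀.le hγ₁.le hC.le hM.le hb0 hK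
  have hf := hz.functional
  have hN : ∀ {p : ℕ}, p ≤ n → (p : ℕ∞) ≤ ((n : ℕ) : ℕ∞) := fun hp => by exact_mod_cast hp
  have hZ : ∀ L, LevelBounds T ρ γ c L (extension z n) :=
    hz0.extension hadm hσ hnσ hβ hβB
  have hν : ∀ m : ℕ, 0 ≤ m * ρ := fun m => by positivity
  have hn1' : ∀ m : ℕ, 1 ≤ m →
      norm1 T (m * ρ + γ) γ (extension z n m) ≤ ENNReal.ofReal (c m) := fun m hm =>
    norm1_le_of_norm_le (hν m) hγ₀.le (hcn m) ((hZ m).bound hm le_rfl)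
  have hn12 : ∀ m : ℕ, 1 ≤ m →
      norm12 T (m * ρ + γ) γ (extension z n m) ≤ ENNReal.ofReal (c m) := fun m hm =>
    norm12_le_of_norm_sub_le (hν m) hγ₀.le (hcn m) ((hZ m).incr hm le_rfl)
  have hzero : ∀ s t τ, (s, t, τ) ∈ simplex T → extension z n 0 s t τ = 1 := fun s t τ h => by
    rw [extension_of_le z (Nat.zero_le n)]
    exact hf.level_zero s t τ h
  have hfun : IsConvolutionalFunctional T ⊤ (extension z n) :=
    { level_zero := hzero
      mem_tensorPow := fun m _ s t τ h =>
        extension_mem (S := fun k => (tensorPow E k).toAddSubmonoid)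
          (fun k => Submodule.isClosed_topologicalClosure _) mul_mem_tensorPow
          (fun k hk s t τ hs hst ht hτ => hf.mem_tensorPow k (hN hk) s t τ ⟨hs, hst, ht, hτ⟩) m
          h.1 h.2.1 h.2.2.1 h.2.2.2
      continuousOn := fun m _ => continuousOn_extension hz0 hadm hσ hnσ hβ hβB
        (fun k hk => hf.continuousOn k (hN hk)) m
      chen := fun m _ s u t τ hs hsu hut ht hτ => by
        rcases Nat.eq_zero_or_pos m with rfl | hm
        · rw [zero_add, Finset.sum_range_one, chenTerm, if_pos rfl,
            hzero s t τ ⟨hs, hsu.trans hut, ht, hτ⟩, hzero u t τ ⟨hs.trans hsu, hut, ht, hτ⟩]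
        · rw [sum_chenTerm _ hm]
          exact (hZ m).chen hm le_rfl hs hsu hut ht hτ }
  refine ⟨extension z n, ⟨hfun, fun j hj s t τ _ => by rw [extension_of_le z hj], fun m hm _ => ?_⟩,
    fun p i s u t τ hs hsu hut ht hτ => ?_, fun m hm => ⟨?_, ?_⟩, fun N Z' hZ' m => ?_⟩
  · exact ENNReal.add_lt_top.2 ⟨(hn1' m hm).trans_lt ENNReal.ofReal_lt_top,
      (hn12 m hm).trans_lt ENNReal.ofReal_lt_top⟩
  -- For `i = 0` the function of the upper variable is the constant `1`, which is controlled.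
  · rcases Nat.eq_zero_or_pos i with rfl | hi
    · exact convExists_of_bounds (hZ p) hadm le_rfl (hs.trans hsu) hut ht hτ
        ((controlled_const u t 1).congr fun r h1 h2 =>
          (hzero s u r ⟨hs, hsu, h1, h2.trans (ht.trans hτ)⟩).symm)
    · exact convExists_of_bounds (hZ p) hadm le_rfl (hs.trans hsu) hut ht hτ
        ((hZ i).controlled hadm hi le_rfl hs hsu (ht.trans hτ))
  · exact (hn1' m (by omega)).trans
      (ENNReal.ofReal_le_ofReal (levelConst_le hρ.le hb1 hK0.le hM.le m))
  · exact (hn12 m (by omega)).trans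
      (ENNReal.ofReal_le_ofReal (levelConst_le hρ.le hb1 hK0.le hM.le m))
  · induction m using Nat.strong_induction_on with
    | _ m ih =>
      intro hmN s t τ hst
      rcases Nat.lt_or_ge n m with h | h
      · have hm : 1 ≤ m := by omega
        -- The competitor has some finite constant at level `m`, without any factorial bound; the
        -- order `mρ > 1` alone determines the level.
        obtain ⟨Q, hQ, hQb⟩ := hZ'.functional.exists_norm_le hm hmN hγ₀.le (hν m)
          (hZ'.norm_lt_top m hm hmN)
        have hm1 : 1 < m * ρ := hn1.trans_le
          (mul_le_mul_of_nonneg_right (by exact_mod_cast h) hρ.le)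
        refine level_unique hm1 hQ (hcn m) (fun k _ hk s t τ h1 h2 h3 h4 =>
          ih k hk (le_trans (by exact_mod_cast hk.le) hmN) s t τ ⟨h1, h2, h3, h4⟩)
          (hZ'.functional.chen_relation hm hmN) ((hZ m).chen hm le_rfl) hQb ?_
          hst.1 hst.2.1 hst.2.2.1 hst.2.2.2
        intro s t τ hs hst ht hτ
        have h0 : 0 ≤ t - s := sub_nonneg.2 hst
        exact ((hZ m).bound hm le_rfl hs hst ht hτ).trans
          (mul_le_of_le_one_right (mul_nonneg (hcn m) (by positivity))
            (ratioPow_le_one hγ₀.le hst ht))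
      · rw [extension_of_le z h]
        exact hZ'.agrees m h s t τ hst
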